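/- An index is a finite (possibly empty) sequence of positive integers; it is admissible if its last component is greater than $1$. For an admissible index $\boldsymbol{k}=(k_1,\dots,k_r)$ let $$\zeta(\boldsymbol{k})=\sum_{1\le m_1<\cdots<m_r}\frac{1}{m_1^{k_1}\cdots m_r^{k_r}},$$ and define its Ohno-sum generating series by $$\mathcal{O}(\boldsymbol{k})=\sum_{m=0}^{\infty}\mathcal{O}_m(\boldsymbol{k})X^m\in\mathbb{R}[[X]],\qquad \mathcal{O}_m(\boldsymbol{k})=\sum_{\substack{e_1+\cdots+e_r=m\\ e_1,\dots,e_r\ge 0}}\zeta(k_1+e_1,\dots,k_r+e_r).$$ For $\boldsymbol{k}=(\{1\}^{a_1-1},b_1+1,\dots,\{1\}^{a_n-1},b_n+1)$ with all $a_p,b_q\ge1$ (every admissible index is uniquely of this form), the dual index is $\boldsymbol{k}^\dagger=(\{1\}^{b_n-1},a_n+1,\dots,\{1\}^{b_1-1},a_1+1)$; here $\{c\}^{j}$ denotes $c$ repeated $j$ times. Let $\mathcal{I}$ be the $\mathbb{Q}$-vector space with basis all indices, and let $ш\colon\mathcal{I}\times\mathcal{I}\to\mathcal{I}$ be the $\mathbb{Q}$-bilinear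 product determined by $\emptyset\, ш\,\boldsymbol{k}=\boldsymbol{k}\, ш\,\emptyset=\boldsymbol{k}$ and $$(\boldsymbol{k},k)\, ш\,(\boldsymbol{l},l)=(\boldsymbol{k}\, ш\,(\boldsymbol{l},l),k)+((\boldsymbol{k},k)\, ш\,\boldsymbol{l},l)$$ for indices $\boldsymbol{k},\boldsymbol{l}$ and integers $k,l\ge1$, where appending a component is extended linearly. Extend $\mathcal{O}$ and $\dagger$ $\mathbb{Q}$-linearly to linear combinations of admissible indices, and for an integer $s\ge2$ and such a combination $\boldsymbol{k}$ put $$F(s;\boldsymbol{k})=\mathcal{O}((s)\, ш\,\boldsymbol{k})-\mathcal{O}((s)\, ш\,\boldsymbol{k}^\dagger).$$ Theorem. For all integers $s,t\ge2$ and $l\ge0$, $$F(s;(t+1)\, ш\,(\{2\}^{l}))=F(t;(s+1)\, ш\,(\{2\}^{l})).$$ -/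

import Mathlib

noncomputable section

namespace OhnoSum

/-- An index: a (possibly empty) finite sequence of positive integers. -/
abbrev Index : Type := List ℕ+

/-- An index is admissible if its last component is greater than `1`. -/
def IsAdmissible (k : Index) : Prop := ∃ h : k ≠ [], 1 < k.getLast h

/-- The multiple zeta value
`ζ(k₁, …, k_r) = ∑_{1 ≤ m₁ < ⋯ < m_r} 1 / (m₁ ^ k₁ ⋯ m_r ^ k_r)`;
the series converges absolutely when the index is admissible. -/
def mzv (k : Index) : ℝ :=
  ∑' m : {m : Fin k.length → ℕ+ // StrictMono m},
    1 / ∏ i, ((m.1 i : ℕ) : ℝ) ^ (k.get i : ℕ)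

/-- Componentwise sum `k ⊕ e` of an index and a sequence of nonnegative integers of
the same depth. -/
def addSeq (k : Index) (e : Fin k.length → ℕ) : Index :=
  List.ofFn fun i => ⟨(k.get i : ℕ) + e i, Nat.add_pos_left (k.get i).pos _⟩

/-- The Ohno sum `O_m(k)`: the sum of `ζ(k ⊕ e)` over all `e` with `|e| = m`. -/
def ohnoCoeff (m : ℕ) (k : Index) : ℝ :=
  ∑ e ∈ Finset.Nat.antidiagonalTuple k.length m, mzv (addSeq k e)

/-- The generating series `O(k) = ∑_m O_m(k) X ^ m` of an index. -/
def ohnoSeries (k : Index) : PowerSeries ℝ := PowerSeries.mk fun m => ohnoCoeff m k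

/-- The `ℚ`-linear space with basis all indices. -/
abbrev IndexSpace : Type := Index →₀ ℚ

/-- An index as an element of the space of formal sums of indices. -/
def single (k : Index) : IndexSpace := Finsupp.single k 1

/-! ### The dual index -/

/-- The index `({1}^{a₁-1}, b₁+1, …, {1}^{a_l-1}, b_l+1)` given by
`(a₁, b₁), …, (a_l, b_l)`. -/
def ofBlocks (L : List (ℕ+ × ℕ+)) : Index :=
  L.flatMap fun p => List.replicate ((p.1 : ℕ) - 1) 1 ++ [p.2 + 1]

/-- Auxiliary scan: `a - 1` ones have been read since the last component that exceeds `1`. -/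
def blocksAux : ℕ+ → Index → List (ℕ+ × ℕ+)
  | _, [] => []
  | a, c :: k => if c = 1 then blocksAux (a + 1) k else (a, c - 1) :: blocksAux 1 k

/-- The sequence `(a₁, b₁), …, (a_l, b_l)` with `k = ofBlocks [(a₁, b₁), …, (a_l, b_l)]`, for
an admissible index `k`. -/
def blocks (k : Index) : List (ℕ+ × ℕ+) := blocksAux 1 k

/-- The dual index `({1}^{b_l-1}, a_l+1, …, {1}^{b₁-1}, a₁+1)` of the admissible index
`({1}^{a₁-1}, b₁+1, …, {1}^{a_l-1}, b_l+1)`. -/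
def dualIndex (k : Index) : Index := ofBlocks ((blocks k).map Prod.swap).reverse

theorem blocksAux_replicate (n : ℕ) (a b : ℕ+) (k : Index) :
    blocksAux a (List.replicate n 1 ++ (b + 1) :: k) =
      (⟨(a : ℕ) + n, Nat.add_pos_left a.pos _⟩, b) :: blocksAux 1 k := by
  induction n generalizing a with
  | zero =>
    have h : b + 1 ≠ 1 := fun h => by
      have h2 := congrArg PNat.val h
      have h3 := b.pos
      simp only [PNat.add_coe, PNat.one_coe] at h2
      omega
    rw [List.replicate_zero, List.nil_append, blocksAux, if_neg h]
    congr 2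
    apply PNat.eq
    simp [PNat.add_sub]
  | succ n ih =>
    rw [List.replicate_succ, List.cons_append, blocksAux, if_pos rfl, ih]
    congr 2
    apply PNat.eq
    simp only [PNat.mk_coe, PNat.add_coe, PNat.one_coe]
    omega

theorem blocks_ofBlocks (L : List (ℕ+ × ℕ+)) : blocks (ofBlocks L) = L := by
  induction L with
  | nil => rfl
  | cons p L ih =>
    have h : ofBlocks (p :: L) =
        List.replicate ((p.1 : ℕ) - 1) 1 ++ (p.2 + 1) :: ofBlocks L := by
      simp [ofBlocks]
    rw [blocks, h, blocksAux_replicate]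
    change _ :: blocks (ofBlocks L) = _
    rw [ih]
    congr 1
    refine Prod.ext (PNat.eq ?_) rfl
    have := p.1.pos
    simp only [PNat.mk_coe, PNat.one_coe]
    omega

theorem dualIndex_ofBlocks (L : List (ℕ+ × ℕ+)) :
    dualIndex (ofBlocks L) = ofBlocks (L.map Prod.swap).reverse := by
  rw [dualIndex, blocks_ofBlocks]

theorem ofBlocks_blocksAux (a : ℕ+) (k : Index) (hk : IsAdmissible k) :
    ofBlocks (blocksAux a k) = List.replicate ((a : ℕ) - 1) 1 ++ k := by
  induction k generalizing a with
  | nil => exact absurd rfl hk.1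
  | cons c k ih =>
    obtain ⟨_, hl⟩ := hk
    by_cases hc : c = 1
    · subst hc
      have hk0 : k ≠ [] := by
        rintro rfl
        simp at hl
      rw [List.getLast_cons hk0] at hl
      rw [blocksAux, if_pos rfl, ih _ ⟨hk0, hl⟩]
      have h : ((a + 1 : ℕ+) : ℕ) - 1 = ((a : ℕ) - 1) + 1 := by
        have := a.pos
        simp only [PNat.add_coe, PNat.one_coe]
        omega
      rw [h, List.replicate_succ', List.append_assoc]
      rfl
    · have h1 : c - 1 + 1 = c := PNat.sub_add_of_lt
        (lt_of_le_of_ne one_le (Ne.symm hc))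
      have h2 : ofBlocks (blocksAux 1 k) = k := by
        by_cases hk0 : k = []
        · subst hk0
          rfl
        · rw [List.getLast_cons hk0] at hl
          rw [ih 1 ⟨hk0, hl⟩]
          simp
      rw [blocksAux, if_neg hc]
      have h3 : ofBlocks ((a, c - 1) :: blocksAux 1 k) =
          List.replicate ((a : ℕ) - 1) 1 ++ (c - 1 + 1) :: ofBlocks (blocksAux 1 k) := by
        simp [ofBlocks]
      rw [h3, h1, h2]

/-- Every admissible index is of the form that the definition of the dual index presupposes. -/
theorem ofBlocks_blocks (k : Index) (hk : IsAdmissible k) : ofBlocks (blocks k) = k := by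
  rw [blocks, ofBlocks_blocksAux 1 k hk]
  simp

/-! ### The shuffle product of indices -/

/-- The map `(l₁, …, l_r) ↦ (c, l₁, …, l_r)` on formal sums of indices. -/
def consMap (c : ℕ+) : IndexSpace →ₗ[ℚ] IndexSpace := Finsupp.lmapDomain ℚ ℚ (List.cons c)

/-- The map `(l₁, …, l_r) ↦ (l₁, …, l_r, c)` on formal sums of indices. -/
def snocMap (c : ℕ+) : IndexSpace →ₗ[ℚ] IndexSpace := Finsupp.lmapDomain ℚ ℚ (· ++ [c])

/-- The map `(l₁, …, l_r) ↦ (l_r, …, l₁)` on formal sums of indices. -/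
def revMap : IndexSpace →ₗ[ℚ] IndexSpace := Finsupp.lmapDomain ℚ ℚ List.reverse

/-- The shuffle of two index words by recursion on first components. -/
def shuffleFront : Index → Index → IndexSpace
  | [], l => single l
  | a :: k, [] => single (a :: k)
  | a :: k, b :: l => consMap a (shuffleFront k (b :: l)) + consMap b (shuffleFront (a :: k) l)

/-- The shuffle of two indices. The recursion on last components,
`(k, a) ⧢ (l, b) = (k ⧢ (l, b), a) + ((k, a) ⧢ l, b)`, is carried out on the reversed
sequences; see `shuffleIndex_nil_left`, `shuffleIndex_nil_right`, `shuffleIndex_snoc_snoc`. -/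
def shuffleIndex (k l : Index) : IndexSpace := revMap (shuffleFront k.reverse l.reverse)

theorem shuffleIndex_nil_left (l : Index) : shuffleIndex [] l = single l := by
  simp [shuffleIndex, shuffleFront, revMap, single]

theorem shuffleIndex_nil_right (k : Index) : shuffleIndex k [] = single k := by
  cases h : k.reverse with
  | nil => simp_all [shuffleIndex, shuffleFront, revMap, single]
  | cons a k' =>
    rw [shuffleIndex, h, List.reverse_nil, shuffleFront, ← h]
    simp [revMap, single]

theorem revMap_consMap (c : ℕ+) (x : IndexSpace) :
    revMap (consMap c x) = snocMap c (revMap x) := by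
  simp only [revMap, consMap, snocMap, Finsupp.lmapDomain_apply, ← Finsupp.mapDomain_comp]
  congr 1
  funext l
  simp

theorem shuffleIndex_snoc_snoc (k l : Index) (a b : ℕ+) :
    shuffleIndex (k ++ [a]) (l ++ [b]) =
      snocMap a (shuffleIndex k (l ++ [b])) + snocMap b (shuffleIndex (k ++ [a]) l) := by
  simp only [shuffleIndex, List.reverse_append, List.reverse_cons, List.reverse_nil,
    List.nil_append, List.cons_append, shuffleFront, map_add, revMap_consMap]

/-! ### Linear extensions and the function `F` -/

/-- The `ℚ`-bilinear shuffle product on formal sums of indices. -/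
def shuffle : IndexSpace →ₗ[ℚ] IndexSpace →ₗ[ℚ] IndexSpace :=
  Finsupp.linearCombination ℚ fun k => Finsupp.linearCombination ℚ (shuffleIndex k)

/-- The `ℚ`-linear extension of the dual `k ↦ k†`. It is used on combinations of admissible
indices only. -/
def dual : IndexSpace →ₗ[ℚ] IndexSpace :=
  Finsupp.linearCombination ℚ fun k => single (dualIndex k)

/-- The `ℚ`-linear extension of the generating series `k ↦ O(k)`. It is used on combinations of
admissible indices only. -/
def ohno : IndexSpace →ₗ[ℚ] PowerSeries ℝ := Finsupp.linearCombination ℚ ohnoSeries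

/-- `F(s; k) = O((s) ⧢ k) - O((s) ⧢ k†)`. -/
def F (s : ℕ+) (k : IndexSpace) : PowerSeries ℝ :=
  ohno (shuffle (single [s]) k) - ohno (shuffle (single [s]) (dual k))

end OhnoSum

end

open scoped ENNReal

namespace OhnoSum

/-! ### Truncated multiple sums with arbitrary letters -/

/-! For `0 ≤ x < 1`, `zeta x k` is the value at `x` of the series `𝒪(k)`: a component `c` at the
place `m` gets the weight `1 / (m ^ (c - 1) * (m - x)) = ∑ x ^ j / m ^ (c + j)` (`zeta_eq_tsum`).
The sums are taken in `ℝ≥0∞`, where they may be rearranged freely; finiteness matters only for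
cancellation and for passing to real numbers.

Let `Φ_s(τ)` be the value at `x` of `F(s; (τ + 2) ш {2}^l)`, that is `insA - insB`; the claim is
`Φ_s(t - 1) = Φ_t(s - 1)`. Raise in turn each component of the dual of `(s + 1) ш {2}^l` by `τ + 1`,
do the same for `(s + 1) ш {2}^l` itself, and let `δ_s(τ)` be the difference, `raiD - raiC`. It is
evaluated in two ways.

The harmonic product of `∑ n^{-t}` with `zeta x k` inserts a letter `n^{-t}` or raises a component
by `t`. Since `zeta x` is invariant under duality and `wt x t n = n^{-t} + x * wt x (t + 1) n`, this
gives `δ_s(t - 1) = Φ_t(s - 1) - x Φ_{t+1}(s - 1)` (`ins_balance`). On the other hand `δ_s(τ) =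
Φ_s(τ) - x Φ_s(τ + 1)` (`coeff_identity`). Hence `Δ(s, t) = Φ_s(t - 1) - Φ_t(s - 1)` satisfies `Δ(s,
t) = x Δ(s, t + 1)`, so all its coefficients vanish (`coeff_symm`).

The second evaluation is the core. It is proved for generating functions, with `y` marking `l` and
`u` marking `τ` (`Small.pairs_total`), by writing the terms as sums over the place `n` of the letter
coming from `s` or `s + 1`. Raising a component of the dual index means splitting a component of the
index (`raiseSum_dualIndex`). Splitting `s + 1` itself produces two places `m < M`, which a divided
difference redistributes to single places (`twoPlaces_add`). The remaining identity holds for each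
`n` separately (`Small.local_identity`): the words to the left and to the right of `n` have
generating functions governed by first order recurrences, the unknown part is found by cutting the
duality relation at `n` (`Small.realV_identity`), and what is left is a bilinear relation between
head and tail sums, proved by induction on `n` (`RecData.bilinear`).

Duality itself, which is Ohno's relation, comes from a connected sum (`ev_conn_dual`). -/

/-- `∑ a₁(m₁) ⋯ a_r(m_r)` over `n < m₁ < ⋯ < m_r < M`, for the word `a₁ ⋯ a_r`. -/
noncomputable def win : List (ℕ → ℝ≥0∞) → ℕ → ℕ∞ → ℝ≥0∞
  | [], _, _ => 1
  | a :: w, n, M => ∑' m : ℕ, if n < m ∧ (m : ℕ∞) < M then a m * win w m M else 0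

/-- Once the variable of one letter is fixed, the letters before it are confined below it and those
after it above it. All decompositions by places rest on this factorisation. -/
theorem win_append_cons (U V : List (ℕ → ℝ≥0∞)) (a : ℕ → ℝ≥0∞) (n : ℕ) (M : ℕ∞) :
    win (U ++ a :: V) n M =
      ∑' m : ℕ, if n < m ∧ (m : ℕ∞) < M then win U n m * a m * win V m M else 0 := by
  induction U generalizing n with
  | nil => simp [win]
  | cons b U ih =>
    rw [List.cons_append, win]
    have h1 : ∀ k : ℕ, (if n < k ∧ (k : ℕ∞) < M then b k * win (U ++ a :: V) k M else 0) =
        ∑' m : ℕ, if n < k ∧ k < m ∧ (m : ℕ∞) < M then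
          b k * win U k m * a m * win V m M else 0 := by
      intro k
      rw [ih]
      by_cases hk : n < k ∧ (k : ℕ∞) < M
      · rw [if_pos hk, ← ENNReal.tsum_mul_left]
        refine tsum_congr fun m => ?_
        simp only [hk.1, true_and]
        split_ifs <;> ring
      · rw [if_neg hk, eq_comm, ENNReal.tsum_eq_zero]
        intro m
        rw [if_neg]
        rintro ⟨h1, h2, h3⟩
        exact hk ⟨h1, lt_trans (by exact_mod_cast h2) h3⟩
    rw [tsum_congr h1, ENNReal.tsum_comm]
    refine tsum_congr fun m => ?_
    by_cases hm : n < m ∧ (m : ℕ∞) < M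
    · rw [if_pos hm, win, ← ENNReal.tsum_mul_right, ← ENNReal.tsum_mul_right]
      refine tsum_congr fun k => ?_
      simp only [hm.2, and_true, Nat.cast_lt]
      split_ifs <;> ring
    · rw [if_neg hm, ENNReal.tsum_eq_zero]
      intro k
      rw [if_neg]
      rintro ⟨h1, h2, h3⟩
      exact hm ⟨h1.trans h2, h3⟩

theorem win_snoc (U : List (ℕ → ℝ≥0∞)) (a : ℕ → ℝ≥0∞) (n : ℕ) (M : ℕ∞) :
    win (U ++ [a]) n M =
      ∑' m : ℕ, if n < m ∧ (m : ℕ∞) < M then win U n m * a m else 0 := by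
  rw [win_append_cons]
  simp [win]

theorem tsum_window_succ_right (F : ℕ → ℝ≥0∞) {n m : ℕ} (h : n < m) :
    ∑' k : ℕ, (if n < k ∧ (k : ℕ∞) < ((m + 1 : ℕ) : ℕ∞) then F k else 0) =
      (∑' k : ℕ, if n < k ∧ (k : ℕ∞) < (m : ℕ∞) then F k else 0) + F m := by
  rw [← tsum_ite_eq m F, ← ENNReal.tsum_add]
  refine tsum_congr fun k => ?_
  simp only [Nat.cast_lt]
  rcases lt_trichotomy k m with hk | hk | hk
  · simp [hk, hk.ne, Nat.lt_succ_of_lt hk]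
  · subst hk; simp [h]
  · have h1 : ¬ k < m + 1 := by omega
    have h2 : ¬ k < m := by omega
    simp [h1, h2, hk.ne']

theorem tsum_window_succ_left (F : ℕ → ℝ≥0∞) {n : ℕ} {M : ℕ∞} (h : ((n + 1 : ℕ) : ℕ∞) < M) :
    ∑' k : ℕ, (if n < k ∧ (k : ℕ∞) < M then F k else 0) =
      F (n + 1) + ∑' k : ℕ, if n + 1 < k ∧ (k : ℕ∞) < M then F k else 0 := by
  rw [← tsum_ite_eq (n + 1) F, ← ENNReal.tsum_add]
  refine tsum_congr fun k => ?_
  rcases lt_trichotomy k (n + 1) with hk | hk | hk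
  · have h1 : ¬ n < k := by omega
    have h2 : ¬ n + 1 < k := by omega
    simp [h1, h2, hk.ne]
  · subst hk
    have h3 : ((n : ℕ∞) + 1) < M := by exact_mod_cast h
    simp [h3]
  · have h1 : n < k := by omega
    simp [h1, hk, hk.ne']

theorem tsum_window_cut (F : ℕ → ℝ≥0∞) {p n : ℕ} (h : p ≤ n) :
    ∑' k : ℕ, (if p < k ∧ (k : ℕ∞) < ⊤ then F k else 0) =
      (∑' k : ℕ, if p < k ∧ (k : ℕ∞) < ((n + 1 : ℕ) : ℕ∞) then F k else 0) +
        ∑' k : ℕ, if n < k ∧ (k : ℕ∞) < ⊤ then F k else 0 := by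
  rw [← ENNReal.tsum_add]
  refine tsum_congr fun k => ?_
  simp only [ENat.natCast_lt_top, and_true, Nat.cast_lt]
  by_cases h1 : n < k
  · have h2 : ¬ k < n + 1 := by omega
    simp [h1, h2, lt_of_le_of_lt h h1]
  · have h2 : k < n + 1 := by omega
    simp [h1, h2]

theorem tsum_window_empty (F : ℕ → ℝ≥0∞) (n : ℕ) :
    ∑' k : ℕ, (if n < k ∧ (k : ℕ∞) < ((n + 1 : ℕ) : ℕ∞) then F k else 0) = 0 := by
  rw [ENNReal.tsum_eq_zero]
  intro k
  rw [if_neg]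
  rw [Nat.cast_lt]
  omega

theorem win_snoc_succ (U : List (ℕ → ℝ≥0∞)) (a : ℕ → ℝ≥0∞) {n m : ℕ} (h : n < m) :
    win (U ++ [a]) n (m + 1 : ℕ) = win (U ++ [a]) n m + win U n m * a m := by
  rw [win_snoc, win_snoc, tsum_window_succ_right _ h]

theorem win_cons_succ (U : List (ℕ → ℝ≥0∞)) (a : ℕ → ℝ≥0∞) {n : ℕ} {M : ℕ∞}
    (h : ((n + 1 : ℕ) : ℕ∞) < M) :
    win (a :: U) n M = a (n + 1) * win U (n + 1) M + win (a :: U) (n + 1) M := by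
  rw [win, win, tsum_window_succ_left _ h]

theorem win_cons_empty (U : List (ℕ → ℝ≥0∞)) (a : ℕ → ℝ≥0∞) (n : ℕ) :
    win (a :: U) n (n + 1 : ℕ) = 0 := by
  rw [win, tsum_window_empty]

theorem win_snoc_empty (U : List (ℕ → ℝ≥0∞)) (a : ℕ → ℝ≥0∞) (n : ℕ) :
    win (U ++ [a]) n (n + 1 : ℕ) = 0 := by
  rw [win_snoc, tsum_window_empty]

/-! ### Sums over splittings, insertions and replacements of letters -/

section Combinatorics

variable {α R M : Type*}

/-- `∑ P(U) Q(V)` over all splittings `k = U V`. -/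
def splitSum [CommSemiring R] (P Q : List α → R) : List α → R
  | [] => P [] * Q []
  | a :: k => P [] * Q (a :: k) + splitSum (fun w => P (a :: w)) Q k

/-- `∑ P(U) Q(V)` over all splittings `k = U V` with `U` nonempty. -/
def splitSumPos [CommSemiring R] (P Q : List α → R) : List α → R
  | [] => 0
  | a :: k => splitSum (fun w => P (a :: w)) Q k

theorem splitSum_eq [CommSemiring R] (P Q : List α → R) (k : List α) :
    splitSum P Q k = P [] * Q k + splitSumPos P Q k := by
  cases k <;> simp [splitSum, splitSumPos]

/-- `∑ φ(U h V)` over all splittings `k = U V`. -/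
def insSum [AddCommMonoid M] (φ : List α → M) (h : α) : List α → M
  | [] => φ [h]
  | a :: k => φ (h :: a :: k) + insSum (fun w => φ (a :: w)) h k

/-- `∑ φ(U (g c) V)` over all splittings `k = U c V`. -/
def raiseSum [AddCommMonoid M] (φ : List α → M) (g : α → α) : List α → M
  | [] => 0
  | a :: k => φ (g a :: k) + raiseSum (fun w => φ (a :: w)) g k

theorem insSum_map {N : Type*} [AddCommMonoid M] [AddCommMonoid N] (T : M →+ N)
    (φ : List α → M) (h : α) (k : List α) : T (insSum φ h k) = insSum (fun w => T (φ w)) h k := by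
  induction k generalizing φ with
  | nil => rfl
  | cons a k ih => rw [insSum, insSum, map_add, ih]

theorem insSum_listMap {β : Type*} [AddCommMonoid M] (F : α → β) (φ : List β → M) (h : α)
    (k : List α) : insSum (fun w => φ (w.map F)) h k = insSum φ (F h) (k.map F) := by
  induction k generalizing φ with
  | nil => rfl
  | cons a k ih =>
    simp only [insSum, List.map_cons]
    rw [← ih]

theorem raiseSum_listMap {β : Type*} [AddCommMonoid M] (F : α → β) (φ : List β → M) (g : α → α)
    (g' : β → β) (hg : ∀ c, F (g c) = g' (F c)) (k : List α) :
    raiseSum (fun w => φ (w.map F)) g k = raiseSum φ g' (k.map F) := by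
  induction k generalizing φ with
  | nil => rfl
  | cons a k ih =>
    simp only [raiseSum, List.map_cons, hg]
    rw [← ih]

theorem insSum_snoc [AddCommMonoid M] (φ : List α → M) (h a : α) (k : List α) :
    insSum φ h (k ++ [a]) = insSum (fun w => φ (w ++ [a])) h k + φ (k ++ [a, h]) := by
  induction k generalizing φ with
  | nil => simp [insSum]
  | cons b k ih =>
    simp only [List.cons_append, insSum]
    rw [ih, add_assoc]

theorem insSum_reverse [AddCommMonoid M] (φ : List α → M) (h : α) (k : List α) :
    insSum (fun w => φ w.reverse) h k.reverse = insSum φ h k := by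
  induction k generalizing φ with
  | nil => simp [insSum]
  | cons a k ih =>
    rw [List.reverse_cons, insSum_snoc, insSum]
    simp only [List.reverse_append, List.reverse_cons, List.reverse_nil, List.nil_append,
      List.cons_append, List.reverse_reverse]
    rw [ih (fun w => φ (a :: w)), add_comm]

theorem insSum_replicate [AddCommMonoid M] (φ : List α → M) (c d : α) (l : ℕ) :
    insSum φ c (List.replicate l d) =
      ∑ p ∈ Finset.HasAntidiagonal.antidiagonal l,
        φ (List.replicate p.1 d ++ c :: List.replicate p.2 d) := by
  induction l generalizing φ with
  | zero => simp [insSum]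
  | succ l ih =>
    rw [List.replicate_succ, insSum, ih, Finset.Nat.sum_antidiagonal_succ]
    simp [List.replicate_succ]

theorem splitSum_replicate_append [CommSemiring R] (P Q : List α → R) (j : ℕ) (a : α)
    (w : List α) :
    splitSum P Q (List.replicate j a ++ w) =
      (∑ p ∈ Finset.HasAntidiagonal.antidiagonal j,
        P (List.replicate p.1 a) * Q (List.replicate p.2 a ++ w)) +
        splitSumPos (fun v => P (List.replicate j a ++ v)) Q w := by
  induction j generalizing P with
  | zero => simp [splitSum_eq]
  | succ j ih =>
    rw [List.replicate_succ, List.cons_append, splitSum, ih, Finset.Nat.sum_antidiagonal_succ]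
    simp [List.replicate_succ, add_assoc]

theorem splitSumPos_replicate_succ_append [CommSemiring R] (P Q : List α → R) (j : ℕ) (a : α)
    (w : List α) :
    splitSumPos P Q (List.replicate (j + 1) a ++ w) =
      (∑ p ∈ Finset.HasAntidiagonal.antidiagonal j,
        P (List.replicate (p.1 + 1) a) * Q (List.replicate p.2 a ++ w)) +
        splitSumPos (fun v => P (List.replicate (j + 1) a ++ v)) Q w := by
  rw [List.replicate_succ, List.cons_append, splitSumPos, splitSum_replicate_append]
  simp [List.replicate_succ]

theorem splitSumPos_cons_replicate [CommSemiring R] (P Q : List α → R) (j : ℕ) (c a : α) :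
    splitSumPos P Q (c :: List.replicate j a) =
      ∑ p ∈ Finset.HasAntidiagonal.antidiagonal j,
        P (c :: List.replicate p.1 a) * Q (List.replicate p.2 a) := by
  have := splitSum_replicate_append (fun v => P (c :: v)) Q j a []
  simpa [splitSumPos] using this

end Combinatorics

/-! ### Cutting, inserting and multiplying truncated sums -/

/-- The variables increase, so those with `m ≤ n` belong to a prefix of the word; summing over all
prefixes accounts for every configuration once. The left window ends at `n + 1` because upper bounds
are strict. -/
theorem win_cut (k : List (ℕ → ℝ≥0∞)) {p n : ℕ} (h : p ≤ n) :
    splitSum (fun U => win U p (n + 1 : ℕ)) (fun V => win V n ⊤) k = win k p ⊤ := by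
  -- `splitSum` is linear in its left functional, also for infinite combinations; this pulls the sum
  -- over the first place out.
  have key : ∀ (k : List (ℕ → ℝ≥0∞)) (p : ℕ) (P : List (ℕ → ℝ≥0∞) → ℝ≥0∞) (c : ℕ → ℝ≥0∞)
      (G : ℕ → List (ℕ → ℝ≥0∞) → ℝ≥0∞) (_ : ∀ U, P U = ∑' m, c m * G m U),
      splitSum P (fun V => win V n ⊤) k =
        ∑' m, c m * splitSum (G m) (fun V => win V n ⊤) k := by
    intro k
    induction k with
    | nil =>
      intro p P c G hP
      simp only [splitSum, hP]
      rw [← ENNReal.tsum_mul_right]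
      simp [mul_assoc]
    | cons a k ih =>
      intro p P c G hP
      simp only [splitSum, mul_add, ENNReal.tsum_add]
      rw [ih p (fun w => P (a :: w)) c (fun m w => G m (a :: w)) (fun U => hP _), hP,
        ← ENNReal.tsum_mul_right]
      simp [mul_assoc]
  induction k generalizing p with
  | nil => simp [splitSum, win]
  | cons a k ih =>
    rw [splitSum]
    rw [key k p _ (fun m => if p < m ∧ (m : ℕ∞) < ((n + 1 : ℕ) : ℕ∞) then a m else 0)
      (fun m U => win U m (n + 1 : ℕ))]
    · rw [show win [] p (n + 1 : ℕ) = 1 from rfl, one_mul]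
      conv_rhs => rw [win, tsum_window_cut _ h, add_comm]
      congr 1
      refine tsum_congr fun m => ?_
      split_ifs with hm
      · rw [ih]
        have := Nat.cast_lt.1 hm.2
        omega
      · simp
    · intro U
      rw [win]
      refine tsum_congr fun m => ?_
      split_ifs <;> simp

theorem insSum_mul_tsum_left (c : ℕ → ℝ≥0∞) (G : ℕ → List (ℕ → ℝ≥0∞) → ℝ≥0∞)
    (h : ℕ → ℝ≥0∞) (k : List (ℕ → ℝ≥0∞)) :
    insSum (fun w => ∑' m, c m * G m w) h k = ∑' m, c m * insSum (G m) h k := by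
  induction k generalizing G with
  | nil => rfl
  | cons a k ih =>
    simp only [insSum, mul_add, ENNReal.tsum_add]
    rw [ih (fun m w => G m (a :: w))]

theorem raiseSum_mul_tsum_left (c : ℕ → ℝ≥0∞) (G : ℕ → List (ℕ → ℝ≥0∞) → ℝ≥0∞)
    (h : (ℕ → ℝ≥0∞) → ℕ → ℝ≥0∞) (k : List (ℕ → ℝ≥0∞)) :
    raiseSum (fun w => ∑' m, c m * G m w) h k = ∑' m, c m * raiseSum (G m) h k := by
  induction k generalizing G with
  | nil => simp [raiseSum]
  | cons a k ih =>
    simp only [raiseSum, mul_add, ENNReal.tsum_add]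
    rw [ih (fun m w => G m (a :: w))]

theorem win_cons_eq (a : ℕ → ℝ≥0∞) (w : List (ℕ → ℝ≥0∞)) (n : ℕ) (M : ℕ∞) :
    win (a :: w) n M = ∑' m : ℕ, (if n < m ∧ (m : ℕ∞) < M then a m else 0) * win w m M := by
  rw [win]
  refine tsum_congr fun m => ?_
  split_ifs <;> simp

/-- The insertion of a letter, in terms of the place at which it is inserted. -/
theorem insSum_win (h : ℕ → ℝ≥0∞) (k : List (ℕ → ℝ≥0∞)) :
    insSum (fun w => win w 0 ⊤) h k =
      ∑' n : ℕ, if 0 < n then h n * splitSum (fun U => win U 0 n) (fun V => win V n ⊤) k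
        else 0 := by
  -- The prefix `X` collects the letters already passed, so that the induction can move the
  -- insertion point to the right.
  have key : ∀ (k X : List (ℕ → ℝ≥0∞)),
      insSum (fun w => win (X ++ w) 0 ⊤) h k =
      ∑' n : ℕ, if 0 < n then
        h n * splitSum (fun U => win (X ++ U) 0 n) (fun V => win V n ⊤) k else 0 := by
    intro k
    induction k with
    | nil =>
      intro X
      rw [insSum, win_append_cons]
      refine tsum_congr fun n => ?_
      simp [splitSum, win, mul_comm]
    | cons a k ih =>
      intro X
      have e : (fun w => win (X ++ a :: w) 0 ⊤) = fun w => win ((X ++ [a]) ++ w) 0 ⊤ := by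
        simp
      rw [insSum, e, ih, win_append_cons, ← ENNReal.tsum_add]
      refine tsum_congr fun n => ?_
      by_cases hn : 0 < n
      · simp only [hn, ENat.natCast_lt_top, and_self, if_true, splitSum, List.append_nil,
          List.append_assoc, List.cons_append, List.nil_append]
        ring
      · simp [hn]
  simpa using key k []

/-- The harmonic product with a single letter. -/
theorem tsum_mul_win (h : ℕ → ℝ≥0∞) (k : List (ℕ → ℝ≥0∞)) (p : ℕ) :
    (∑' n : ℕ, if p < n then h n else 0) * win k p ⊤ =
      insSum (fun w => win w p ⊤) h k +
        raiseSum (fun w => win w p ⊤) (fun a n => h n * a n) k := by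
  induction k generalizing p with
  | nil => simp [insSum, raiseSum, win]
  | cons a k ih =>
    rw [insSum, raiseSum]
    simp only [win_cons_eq a, insSum_mul_tsum_left, raiseSum_mul_tsum_left]
    -- Compare the new variable with the first place `m` of the word: smaller gives insertion in
    -- front, equal raises the first letter, larger is left to the induction hypothesis.
    have h1 : ∀ m : ℕ, p < m → (∑' n : ℕ, if p < n then h n else 0) =
        (∑' n : ℕ, if p < n ∧ n < m then h n else 0) + h m +
          ∑' n : ℕ, if m < n then h n else 0 := by
      intro m hm
      rw [← tsum_ite_eq m h, ← ENNReal.tsum_add, ← ENNReal.tsum_add]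
      refine tsum_congr fun n => ?_
      rcases lt_trichotomy n m with hk | hk | hk
      · simp [hk, hk.ne, hk.le.not_gt]
      · subst hk; simp [hm]
      · simp [hk, hk.ne', hk.le.not_gt, hm.trans hk]
    have h2 : ∀ m : ℕ, (∑' n : ℕ, if p < n then h n else 0) *
        ((if p < m ∧ (m : ℕ∞) < ⊤ then a m else 0) * win k m ⊤) =
        (if p < m then (∑' n : ℕ, if p < n ∧ n < m then h n else 0) * (a m * win k m ⊤) else 0) +
        (if p < m then h m * a m * win k m ⊤ else 0) +
        ((if p < m ∧ (m : ℕ∞) < ⊤ then a m else 0) * insSum (fun w => win w m ⊤) h k +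
        (if p < m ∧ (m : ℕ∞) < ⊤ then a m else 0) *
          raiseSum (fun w => win w m ⊤) (fun a n => h n * a n) k) := by
      intro m
      by_cases hm : p < m
      · rw [h1 m hm]
        simp only [hm, ENat.natCast_lt_top, and_self, if_true]
        rw [add_mul, ← mul_add, ← ih m]
        ring
      · simp [hm]
    rw [← ENNReal.tsum_mul_left, tsum_congr h2, ENNReal.tsum_add, ENNReal.tsum_add,
      ENNReal.tsum_add]
    have h3 : win (h :: a :: k) p ⊤ = ∑' m : ℕ, if p < m then
        (∑' n : ℕ, if p < n ∧ n < m then h n else 0) * (a m * win k m ⊤) else 0 := by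
      rw [show h :: a :: k = [h] ++ a :: k from rfl, win_append_cons]
      refine tsum_congr fun m => ?_
      simp [win, mul_assoc]
    have h4 : win ((fun n => h n * a n) :: k) p ⊤ =
        ∑' m : ℕ, if p < m then h m * a m * win k m ⊤ else 0 := by
      rw [win]; simp
    rw [h3, h4]
    ring

/-! ### Duality through connected sums -/

theorem tsum_gt_eq (F : ℕ → ℝ≥0∞) (b : ℕ) :
    ∑' n : ℕ, (if b < n then F n else 0) = ∑' d : ℕ, F (d + (b + 1)) := by
  have h := Summable.sum_add_tsum_nat_add' (f := fun n : ℕ => if b < n then F n else 0)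
    (k := b + 1) ENNReal.summable
  rw [← h, Finset.sum_eq_zero, zero_add]
  · refine tsum_congr fun d => ?_
    rw [if_pos (by omega)]
  · intro i hi
    rw [if_neg]
    have := Finset.mem_range.1 hi
    omega

theorem hasSum_telescope {c : ℕ → ℝ} (h0 : Filter.Tendsto c Filter.atTop (nhds 0))
    (hf : ∀ n, c (n + 1) ≤ c n) : HasSum (fun n => c n - c (n + 1)) (c 0) := by
  rw [hasSum_iff_tendsto_nat_of_nonneg fun n => sub_nonneg.2 (hf n)]
  simp only [Finset.sum_range_sub']
  simpa using tendsto_const_nhds.sub h0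

/-- The shifted factorial `(1 - x) (2 - x) ⋯ (m - x)`. -/
def shiftFact (x : ℝ) (m : ℕ) : ℝ := ∏ j ∈ Finset.range m, ((j : ℝ) + 1 - x)

theorem shiftFact_succ (x : ℝ) (m : ℕ) :
    shiftFact x (m + 1) = shiftFact x m * ((m : ℝ) + 1 - x) := Finset.prod_range_succ _ _

theorem shiftFact_pos {x : ℝ} (hx : x < 1) (m : ℕ) : 0 < shiftFact x m :=
  Finset.prod_pos fun j _ => by
    have : (0 : ℝ) ≤ j := Nat.cast_nonneg j
    linarith

/-- The real-valued connector. -/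
noncomputable def connReal (x : ℝ) (m n : ℕ) : ℝ :=
  shiftFact x m * shiftFact x n / shiftFact x (m + n)

theorem connReal_comm (x : ℝ) (m n : ℕ) : connReal x m n = connReal x n m := by
  rw [connReal, connReal, mul_comm, add_comm]

theorem connReal_zero {x : ℝ} (hx : x < 1) (n : ℕ) : connReal x 0 n = 1 := by
  have := (shiftFact_pos hx n).ne'
  rw [connReal, zero_add, show shiftFact x 0 = 1 from rfl, one_mul, div_self this]

theorem connReal_pos {x : ℝ} (hx : x < 1) (m n : ℕ) : 0 < connReal x m n :=
  div_pos (mul_pos (shiftFact_pos hx m) (shiftFact_pos hx n)) (shiftFact_pos hx _)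

theorem connReal_succ_right {x : ℝ} (hx : x < 1) (m n : ℕ) :
    connReal x m (n + 1) = connReal x m n * (((n : ℝ) + 1 - x) / ((m : ℝ) + n + 1 - x)) := by
  have h1 := (shiftFact_pos hx (m + n)).ne'
  have h2 : (m : ℝ) + n + 1 - x ≠ 0 := by
    have : (0 : ℝ) ≤ m := Nat.cast_nonneg m
    have : (0 : ℝ) ≤ n := Nat.cast_nonneg n
    apply ne_of_gt
    linarith
  rw [connReal, connReal, ← add_assoc, shiftFact_succ, shiftFact_succ]
  push_cast
  field_simp

/-- This is what makes the connector work: multiplication by `1 / (n + 1 - x)` turns it into a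
difference in `n`, so sums over `n` telescope. -/
theorem connReal_sub {x : ℝ} (hx : x < 1) {m : ℕ} (hm : m ≠ 0) (n : ℕ) :
    connReal x m n / m - connReal x m (n + 1) / m =
      1 / (((n + 1 : ℕ) : ℝ) - x) * connReal x m (n + 1) := by
  have h1 : (m : ℝ) ≠ 0 := by exact_mod_cast hm
  have h3 : (0 : ℝ) ≤ m := Nat.cast_nonneg m
  have h4 : (0 : ℝ) ≤ n := Nat.cast_nonneg n
  have h2 : (m : ℝ) + n + 1 - x ≠ 0 := by
    apply ne_of_gt
    linarith
  have h5 : (n : ℝ) + 1 - x ≠ 0 := by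
    apply ne_of_gt
    linarith
  rw [connReal_succ_right hx]
  push_cast
  field_simp
  ring

/-- Needed only to see that the connector tends to `0` in its second argument when the first is
positive, so that the telescoping sum has no boundary term at infinity. -/
theorem connReal_le {x : ℝ} (hx : x < 1) (m n : ℕ) :
    connReal x (m + 1) n ≤ (1 - x) / ((n : ℝ) + 1 - x) := by
  induction m with
  | zero =>
    rw [zero_add, connReal_comm, connReal_succ_right hx, connReal_comm, connReal_zero hx]
    simp
  | succ m ih =>
    refine le_trans ?_ ih
    rw [connReal_comm, connReal_succ_right hx, connReal_comm x n]
    have h3 : (0 : ℝ) ≤ m := Nat.cast_nonneg m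
    have h4 : (0 : ℝ) ≤ n := Nat.cast_nonneg n
    refine mul_le_of_le_one_right (connReal_pos hx _ _).le ?_
    rw [div_le_one] <;> push_cast <;> linarith

/-- The connector of the connected sums. -/
noncomputable def conn (x : ℝ) (m n : ℕ) : ℝ≥0∞ := ENNReal.ofReal (connReal x m n)

theorem conn_comm (x : ℝ) (m n : ℕ) : conn x m n = conn x n m := by
  rw [conn, connReal_comm, conn]

theorem conn_zero_left {x : ℝ} (hx : x < 1) (n : ℕ) : conn x 0 n = 1 := by
  rw [conn, connReal_zero hx, ENNReal.ofReal_one]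

theorem conn_zero_right {x : ℝ} (hx : x < 1) (n : ℕ) : conn x n 0 = 1 := by
  rw [conn_comm, conn_zero_left hx]

theorem tsum_harmonic_eq_top {x : ℝ} (hx0 : 0 ≤ x) (hx : x < 1) (b : ℕ) :
    ∑' d : ℕ, ENNReal.ofReal (1 / (((d + (b + 1) : ℕ) : ℝ) - x)) = ⊤ := by
  by_contra h
  have h1 := ENNReal.summable_toReal h
  refine Real.not_summable_one_div_natCast ((summable_nat_add_iff (b + 1)).1 ?_)
  refine Summable.of_nonneg_of_le (fun d => by positivity) (fun d => ?_) h1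
  have h2 : (0 : ℝ) < ((d + (b + 1) : ℕ) : ℝ) - x := by
    push_cast
    have : (0 : ℝ) ≤ d := Nat.cast_nonneg d
    have : (0 : ℝ) ≤ b := Nat.cast_nonneg b
    linarith
  rw [ENNReal.toReal_ofReal (by positivity)]
  apply one_div_le_one_div_of_le h2
  linarith

/-- The telescoping of `connReal_sub`: a summation on one side of the connector becomes a division
on the other. -/
theorem conn_transport {x : ℝ} (hx0 : 0 ≤ x) (hx : x < 1) (m b : ℕ) :
    ∑' n : ℕ, (if b < n then ENNReal.ofReal (1 / ((n : ℝ) - x)) * conn x m n else 0) =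
      (m : ℝ≥0∞)⁻¹ * conn x m b := by
  rw [tsum_gt_eq (fun n => ENNReal.ofReal (1 / ((n : ℝ) - x)) * conn x m n)]
  -- For `m = 0` the connector is `1`; the left side is a divergent harmonic sum and the right side
  -- is `0⁻¹ = ⊤`. The transport relation therefore needs no restriction on `m`.
  rcases Nat.eq_zero_or_pos m with rfl | hm
  · simp only [conn_zero_left hx, mul_one]
    rw [tsum_harmonic_eq_top hx0 hx]
    simp
  · have hpos : ∀ n : ℕ, 0 ≤ 1 / (((n + 1 : ℕ) : ℝ) - x) := fun n => by
      have : (0 : ℝ) ≤ n := Nat.cast_nonneg n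
      push_cast
      apply div_nonneg zero_le_one
      linarith
    have hs : HasSum (fun d : ℕ => 1 / (((d + (b + 1) : ℕ) : ℝ) - x) * connReal x m (d + (b + 1)))
        (connReal x m b / m) := by
      have h1 := hasSum_telescope (c := fun d => connReal x m (d + b) / m) ?_ ?_
      · simp only [zero_add] at h1
        have e : ∀ d : ℕ, 1 / (((d + (b + 1) : ℕ) : ℝ) - x) * connReal x m (d + (b + 1)) =
            connReal x m (d + b) / m - connReal x m (d + 1 + b) / m := fun d => by
          rw [show d + 1 + b = d + b + 1 by ring, connReal_sub hx hm.ne' (d + b)]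
          rfl
        simpa only [e] using h1
      · have h2 : Filter.Tendsto (fun n : ℕ => connReal x m n / m) Filter.atTop (nhds 0) := by
          obtain ⟨k, rfl⟩ := Nat.exists_eq_succ_of_ne_zero hm.ne'
          refine squeeze_zero (fun n => div_nonneg (connReal_pos hx _ _).le (Nat.cast_nonneg _))
            (g := fun n : ℕ => (1 - x) / ((n : ℝ) + (1 - x))) (fun n => ?_) ?_
          · refine (div_le_self (connReal_pos hx _ _).le ?_).trans ?_
            · exact_mod_cast hm
            · rw [← add_sub_assoc]
              exact connReal_le hx k n
          · exact tendsto_const_nhds.div_atTop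
              (Filter.tendsto_atTop_add_const_right _ _ tendsto_natCast_atTop_atTop)
        exact h2.comp (Filter.tendsto_add_atTop_nat b)
      · intro n
        have h2 := connReal_sub hx hm.ne' (n + b)
        have h3 := mul_nonneg (hpos (n + b)) (connReal_pos hx m (n + b + 1)).le
        rw [show n + 1 + b = n + b + 1 by ring]
        linarith
    have h1 : ∀ d : ℕ, ENNReal.ofReal (1 / (((d + (b + 1) : ℕ) : ℝ) - x)) *
        conn x m (d + (b + 1)) =
        ENNReal.ofReal (1 / (((d + (b + 1) : ℕ) : ℝ) - x) * connReal x m (d + (b + 1))) :=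
      fun d => (ENNReal.ofReal_mul (hpos (d + b))).symm
    have h2 : ∀ d : ℕ, 0 ≤ 1 / (((d + (b + 1) : ℕ) : ℝ) - x) * connReal x m (d + (b + 1)) :=
      fun d => mul_nonneg (hpos (d + b)) (connReal_pos hx _ _).le
    rw [tsum_congr h1, ← ENNReal.ofReal_tsum_of_nonneg h2 hs.summable, hs.tsum_eq,
      div_eq_inv_mul, ENNReal.ofReal_mul (by positivity), conn,
      ENNReal.ofReal_inv_of_pos (by exact_mod_cast hm), ENNReal.ofReal_natCast]

/-- The functional attached to a word in two letters (`true` opens a new summation variable,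
`false` divides by the current one). -/
noncomputable def ev (x : ℝ) : List Bool → (ℕ → ℝ≥0∞) → ℕ → ℝ≥0∞
  | [], h => h
  | true :: w, h => fun m =>
      ∑' k : ℕ, if m < k then ENNReal.ofReal (1 / ((k : ℝ) - x)) * ev x w h k else 0
  | false :: w, h => fun m => (m : ℝ≥0∞)⁻¹ * ev x w h m

/-- The dual word. -/
def dualWord (w : List Bool) : List Bool := (w.map not).reverse

theorem ev_append (x : ℝ) (w v : List Bool) (h : ℕ → ℝ≥0∞) :
    ev x (w ++ v) h = ev x w (ev x v h) := by
  induction w with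
  | nil => rfl
  | cons c w ih => cases c <;> simp only [List.cons_append, ev, ih]

theorem ev_tsum (x : ℝ) (w : List Bool) (c : ℕ → ℝ≥0∞) (H : ℕ → ℕ → ℝ≥0∞) (m : ℕ) :
    ev x w (fun k => ∑' n, c n * H n k) m = ∑' n, c n * ev x w (H n) m := by
  induction w generalizing m with
  | nil => rfl
  | cons b w ih =>
    cases b
    · simp only [ev, ih]
      rw [← ENNReal.tsum_mul_left]
      exact tsum_congr fun n => by ring
    · simp only [ev, ih, ← ENNReal.tsum_mul_left]
      rw [ENNReal.tsum_comm]
      refine tsum_congr fun k => ?_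
      split_ifs
      · exact tsum_congr fun n => by ring
      · simp

theorem ev_const_mul (x : ℝ) (w : List Bool) (c : ℝ≥0∞) (H : ℕ → ℝ≥0∞) (m : ℕ) :
    ev x w (fun k => c * H k) m = c * ev x w H m := by
  have := ev_tsum x w (fun n => if n = 0 then c else 0) (fun _ => H) m
  simpa using this

/-- By `conn_transport`, read in either direction, the last letter of `w` crosses the connector and
becomes the opposite letter at the front of the other word. Repeating this carries the whole word
across, reversed and with its letters exchanged. -/
theorem ev_conn_dual {x : ℝ} (hx0 : 0 ≤ x) (hx : x < 1) (w : List Bool) (a b : ℕ) :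
    ev x w (fun m => conn x m b) a = ev x (dualWord w) (fun n => conn x a n) b := by
  induction w using List.reverseRecOn generalizing b with
  | nil => rfl
  | append_singleton w c ih =>
    have hd : dualWord (w ++ [c]) = (!c) :: dualWord w := by simp [dualWord]
    rw [hd, ev_append]
    cases c
    · have h1 : ev x [false] (fun m => conn x m b) = fun m =>
          ∑' n : ℕ, (if b < n then ENNReal.ofReal (1 / ((n : ℝ) - x)) else 0) * conn x m n := by
        funext m
        simp only [ev]
        rw [← conn_transport hx0 hx]
        exact tsum_congr fun n => by split_ifs <;> simp
      rw [h1, ev_tsum]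
      simp only [Bool.not_false, ev]
      refine tsum_congr fun n => ?_
      rw [ih]
      split_ifs <;> simp
    · have h1 : ev x [true] (fun m => conn x m b) = fun m => (b : ℝ≥0∞)⁻¹ * conn x m b := by
        funext m
        simp only [ev]
        rw [conn_comm x m, ← conn_transport hx0 hx]
        exact tsum_congr fun n => by rw [conn_comm]
      rw [h1, ev_const_mul, ih]
      rfl

/-- With both outer variables equal to `0` the connector is identically `1`. Words with divergent
sums are included. -/
theorem ev_dualWord {x : ℝ} (hx0 : 0 ≤ x) (hx : x < 1) (w : List Bool) :
    ev x (dualWord w) (fun _ => 1) 0 = ev x w (fun _ => 1) 0 := by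
  have := ev_conn_dual hx0 hx w 0 0
  simp only [conn_zero_left hx, conn_zero_right hx] at this
  exact this.symm

/-! ### Words of indices -/

/-- The weight of a component `c` at the place `m`. -/
noncomputable def wt (x : ℝ) (c : ℕ+) (m : ℕ) : ℝ≥0∞ :=
  (m : ℝ≥0∞)⁻¹ ^ ((c : ℕ) - 1) * ENNReal.ofReal (1 / ((m : ℝ) - x))

/-- The value at `x` of the generating series of Ohno sums. -/
noncomputable def zeta (x : ℝ) (k : Index) : ℝ≥0∞ := win (k.map (wt x)) 0 ⊤

/-- The word of an index. -/
def wordOf (k : Index) : List Bool :=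
  k.flatMap fun c => true :: List.replicate ((c : ℕ) - 1) false

theorem wordOf_cons (c : ℕ+) (k : Index) :
    wordOf (c :: k) = true :: (List.replicate ((c : ℕ) - 1) false ++ wordOf k) := by
  simp [wordOf]

theorem wordOf_append (k l : Index) : wordOf (k ++ l) = wordOf k ++ wordOf l := by
  simp [wordOf]

theorem ev_replicate_false (x : ℝ) (j : ℕ) (w : List Bool) (h : ℕ → ℝ≥0∞) (m : ℕ) :
    ev x (List.replicate j false ++ w) h m = (m : ℝ≥0∞)⁻¹ ^ j * ev x w h m := by
  induction j with
  | zero => simp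
  | succ j ih =>
    rw [List.replicate_succ, List.cons_append, ev]
    simp only [ih, pow_succ]
    ring

theorem ev_wordOf (x : ℝ) (k : Index) (m : ℕ) :
    ev x (wordOf k) (fun _ => 1) m = win (k.map (wt x)) m ⊤ := by
  induction k generalizing m with
  | nil => rfl
  | cons c k ih =>
    rw [wordOf_cons, List.map_cons, win]
    simp only [ev]
    refine tsum_congr fun n => ?_
    rw [ev_replicate_false, ih, wt]
    simp only [ENat.natCast_lt_top, and_true]
    split_ifs
    · ring
    · rfl

theorem zeta_eq_ev (x : ℝ) (k : Index) : zeta x k = ev x (wordOf k) (fun _ => 1) 0 :=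
  (ev_wordOf x k 0).symm

theorem wordOf_replicate_one (n : ℕ) : wordOf (List.replicate n 1) = List.replicate n true := by
  induction n with
  | zero => rfl
  | succ n ih => rw [List.replicate_succ, wordOf_cons, ih]; rfl

theorem wordOf_ofBlocks (L : List (ℕ+ × ℕ+)) :
    wordOf (ofBlocks L) =
      L.flatMap fun p => List.replicate (p.1 : ℕ) true ++ List.replicate (p.2 : ℕ) false := by
  induction L with
  | nil => rfl
  | cons p L ih =>
    have h : ofBlocks (p :: L) =
        List.replicate ((p.1 : ℕ) - 1) 1 ++ (p.2 + 1) :: ofBlocks L := by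
      simp [ofBlocks]
    rw [h, wordOf_append, wordOf_replicate_one, wordOf_cons, ih, List.flatMap_cons]
    obtain ⟨n, hn⟩ := Nat.exists_eq_succ_of_ne_zero p.1.ne_zero
    rw [hn, List.replicate_succ', Nat.succ_sub_one]
    simp

theorem dualWord_append (w v : List Bool) : dualWord (w ++ v) = dualWord v ++ dualWord w := by
  simp [dualWord]

theorem wordOf_dualIndex {k : Index} (hk : IsAdmissible k) :
    wordOf (dualIndex k) = dualWord (wordOf k) := by
  rw [dualIndex]
  conv_rhs => rw [← ofBlocks_blocks k hk]
  generalize blocks k = L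
  rw [wordOf_ofBlocks, wordOf_ofBlocks]
  induction L with
  | nil => rfl
  | cons p L ih =>
    rw [List.map_cons, List.reverse_cons, List.flatMap_append, ih]
    simp only [List.flatMap_cons, List.flatMap_nil, List.append_nil, dualWord_append]
    simp [dualWord]

/-- The Ohno relation. -/
theorem zeta_dualIndex {x : ℝ} (hx0 : 0 ≤ x) (hx : x < 1) {k : Index} (hk : IsAdmissible k) :
    zeta x (dualIndex k) = zeta x k := by
  rw [zeta_eq_ev, zeta_eq_ev, wordOf_dualIndex hk, ev_dualWord hx0 hx]

/-! ### Duality and raised components -/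

section Replacement

variable {M : Type*} [AddCommMonoid M]

/-- `∑ φ(U r V)` over all splittings `w = U b V`. -/
def replSum (φ : List Bool → M) (b : Bool) (r : List Bool) : List Bool → M
  | [] => 0
  | c :: w => (if c = b then φ (r ++ w) else 0) + replSum (fun v => φ (c :: v)) b r w

theorem replSum_append (φ : List Bool → M) (b : Bool) (r w v : List Bool) :
    replSum φ b r (w ++ v) =
      replSum (fun z => φ (z ++ v)) b r w + replSum (fun z => φ (w ++ z)) b r v := by
  induction w generalizing φ with
  | nil => simp [replSum]
  | cons c w ih => simp [replSum, ih, add_assoc]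

/-- Duality reverses words and exchanges letters, so replacing one letter in the dual word
corresponds to replacing the opposite letter, by the dual block, in the word itself. -/
theorem replSum_dualWord (φ : List Bool → M) (b : Bool) (r w : List Bool) :
    replSum (fun v => φ (dualWord v)) b r w = replSum φ (!b) (dualWord r) (dualWord w) := by
  induction w generalizing φ with
  | nil => rfl
  | cons c w ih =>
    have h : dualWord (c :: w) = dualWord w ++ [!c] := by simp [dualWord]
    rw [h, replSum_append, add_comm]
    change (if c = b then φ (dualWord (r ++ w)) else 0) +
      replSum (fun v => φ (dualWord (c :: v))) b r w = _
    congr 1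
    · have h3 : ∀ (ψ : List Bool → M) (b c : Bool) (r : List Bool),
          replSum ψ b r [c] = if c = b then ψ r else 0 := fun ψ b c r => by simp [replSum]
      rw [h3, dualWord_append]
      cases b <;> cases c <;> simp
    · have h2 : ∀ v, dualWord (c :: v) = dualWord v ++ [!c] := fun v => by simp [dualWord]
      simp only [h2]
      rw [ih (fun v => φ (v ++ [!c]))]

theorem replSum_replicate_of_ne (φ : List Bool → M) {b c : Bool} (h : c ≠ b) (r : List Bool)
    (n : ℕ) : replSum φ b r (List.replicate n c) = 0 := by
  induction n generalizing φ with
  | zero => rfl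
  | succ n ih => rw [List.replicate_succ, replSum, if_neg h, ih, add_zero]

theorem replSum_replicate_succ (φ : List Bool → M) (b : Bool) (r : List Bool) (n : ℕ) :
    replSum φ b r (List.replicate (n + 1) b) =
      ∑ p ∈ Finset.HasAntidiagonal.antidiagonal n,
        φ (List.replicate p.1 b ++ (r ++ List.replicate p.2 b)) := by
  induction n generalizing φ with
  | zero => simp [replSum]
  | succ n ih =>
    rw [List.replicate_succ, replSum, ih, Finset.Nat.sum_antidiagonal_succ]
    simp [List.replicate_succ]

/-- Every component contains exactly one `true`, its first letter; raising the component by `t`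
inserts `t` letters `false` right after it. -/
theorem raiseSum_wordOf (φ : List Bool → M) (t : ℕ+) (k : Index) :
    raiseSum (fun w => φ (wordOf w)) (· + t) k =
      replSum φ true (true :: List.replicate (t : ℕ) false) (wordOf k) := by
  induction k generalizing φ with
  | nil => rfl
  | cons c k ih =>
    rw [raiseSum, wordOf_cons c k, replSum, if_pos rfl, replSum_append,
      replSum_replicate_of_ne _ (by decide), zero_add]
    simp only [wordOf_cons]
    rw [ih (fun w => φ (true :: (List.replicate ((c : ℕ) - 1) false ++ w)))]
    have : ((c + t : ℕ+) : ℕ) - 1 = (t : ℕ) + ((c : ℕ) - 1) := by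
      have := c.pos
      rw [PNat.add_coe]
      omega
    rw [this, List.replicate_add, List.append_assoc]
    rfl

/-- The sum of the values of `φ` at the indices obtained by replacing a component
`p₁ + p₂ + 2` by `(p₁ + 1, {1}^τ, p₂ + 2)`. -/
def expandSum (φ : Index → M) (τ : ℕ) : Index → M
  | [] => 0
  | c :: k =>
    (match (c : ℕ) - 1 with
      | 0 => 0
      | n + 1 => ∑ p ∈ Finset.HasAntidiagonal.antidiagonal n,
          φ (p.1.succPNat :: (List.replicate τ 1 ++ (p.2 + 1).succPNat :: k))) +
      expandSum (fun w => φ (c :: w)) τ k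

/-- Only the `c - 1` letters `false` of a component `c` are replaced. The inserted block of `true`
cuts the component in two: the letters before it form `p₁ + 1`, its first `τ` letters form ones, and
its last `true` together with the remaining `false` forms `p₂ + 2`. -/
theorem replSum_wordOf (φ : List Bool → M) (τ : ℕ) (k : Index) :
    replSum φ false (List.replicate (τ + 1) true ++ [false]) (wordOf k) =
      expandSum (fun w => φ (wordOf w)) τ k := by
  induction k generalizing φ with
  | nil => rfl
  | cons c k ih =>
    rw [expandSum, wordOf_cons, replSum, if_neg (by decide), zero_add, replSum_append, ih]
    congr 1
    · obtain ⟨n, hn⟩ : ∃ n, (c : ℕ) - 1 = n := ⟨_, rfl⟩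
      rw [hn]
      cases n with
      | zero => rfl
      | succ n =>
        rw [replSum_replicate_succ]
        refine Finset.sum_congr rfl fun p _ => ?_
        have h2 : ∀ v : List Bool, false :: (List.replicate p.2 false ++ v) =
            List.replicate p.2 false ++ false :: v := fun v => by
          rw [← List.cons_append, ← List.replicate_succ, List.replicate_succ', List.append_assoc]
          rfl
        simp [wordOf_cons, wordOf_append, wordOf_replicate_one, List.replicate_succ', h2]

end Replacement

theorem wt_add (x : ℝ) (c t : ℕ+) :
    wt x (c + t) = fun m : ℕ => (m : ℝ≥0∞)⁻¹ ^ (t : ℕ) * wt x c m := by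
  funext m
  have : ((c + t : ℕ+) : ℕ) - 1 = (t : ℕ) + ((c : ℕ) - 1) := by
    have := c.pos
    rw [PNat.add_coe]
    omega
  rw [wt, wt, this, pow_add, mul_assoc]

/-- Raising the components of the dual index, in terms of the index itself. -/
theorem raiseSum_dualIndex {x : ℝ} (hx0 : 0 ≤ x) (hx : x < 1) {k : Index} (hk : IsAdmissible k)
    (τ : ℕ) :
    raiseSum (zeta x) (· + τ.succPNat) (dualIndex k) = expandSum (zeta x) τ k := by
  have h1 : zeta x = fun w => ev x (wordOf w) (fun _ => 1) 0 := funext fun w => zeta_eq_ev x w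
  rw [h1, raiseSum_wordOf (fun w => ev x w (fun _ => 1) 0), wordOf_dualIndex hk,
    ← replSum_wordOf (fun w => ev x w (fun _ => 1) 0)]
  have h2 := replSum_dualWord (fun w => ev x w (fun _ => 1) 0) false
    (List.replicate (τ + 1) true ++ [false]) (wordOf k)
  simp only [ev_dualWord hx0 hx] at h2
  rw [h2]
  congr 1
  simp [dualWord]

/-! ### A bilinear identity for solutions of first order recurrences -/

/-- Sequences attached to the parameters `x, y, u`: `g` and `q` are finite products, `R` is an
infinite product and `f` is an iterated sum. -/
structure RecData (x y u : ℝ) (g f q R : ℕ → ℝ) : Prop where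
  x_le : x ≤ 1 / 2
  y_nonneg : 0 ≤ y
  u_nonneg : 0 ≤ u
  u_le : u ≤ 1 / 8
  g_one : g 1 = 1
  g_succ : ∀ n : ℕ, 1 ≤ n → g (n + 1) = g n * (1 + y / (n * (n - x)))
  f_one : f 1 = 1
  f_succ : ∀ n : ℕ, 1 ≤ n → f (n + 1) = f n * (1 + u / (n - x)) + y / (n * (n - x)) * g n
  q_one : q 1 = 1
  q_succ : ∀ n : ℕ, 1 ≤ n → q (n + 1) = q n * (1 + u / (n - x))
  R_eq : ∀ n : ℕ, R n = (1 + y / (((n : ℝ) + 1) * ((n : ℝ) + 1 - x))) * R (n + 1)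
  R_nonneg : ∀ n : ℕ, 0 ≤ R n

namespace RecData

variable {x y u : ℝ} {g f q R : ℕ → ℝ}

theorem sub_pos (h : RecData x y u g f q R) {n : ℕ} (hn : 1 ≤ n) : 0 < (n : ℝ) - x := by
  have h1 : (1 : ℝ) ≤ n := by exact_mod_cast hn
  linarith [h.x_le]

theorem q_pos (h : RecData x y u g f q R) {n : ℕ} (hn : 1 ≤ n) : 0 < q n := by
  induction n, hn using Nat.le_induction with
  | base => rw [h.q_one]; exact one_pos
  | succ n hn ih =>
    rw [h.q_succ n hn]
    have := div_nonneg h.u_nonneg (h.sub_pos hn).le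
    positivity

theorem R_le (h : RecData x y u g f q R) (n : ℕ) : R n ≤ R 0 := by
  induction n with
  | zero => exact le_rfl
  | succ n ih =>
    refine le_trans ?_ ih
    rw [h.R_eq n]
    refine le_mul_of_one_le_left (h.R_nonneg _) ?_
    have h1 := h.sub_pos (n := n + 1) (by omega)
    push_cast at h1
    have := div_nonneg h.y_nonneg (mul_nonneg (by positivity : (0 : ℝ) ≤ (n : ℝ) + 1) h1.le)
    linarith

/-- Each factor satisfies `u / (M - x) ≤ 1 / (4 M)`, because `u ≤ 1 / 8` and `M - x ≥ M / 2`, and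
`(1 + 1 / (4 M)) ^ 2 ≤ 1 + 1 / M`. The product of these square roots telescopes. -/
theorem rho_le (h : RecData x y u g f q R) (n d : ℕ) :
    q (n + 1 + d) / q (n + 1) ≤ √(((n : ℝ) + 1 + d) / ((n : ℝ) + 1)) := by
  have hq := h.q_pos (n := n + 1) (by omega)
  induction d with
  | zero =>
    have h1 : ((n : ℝ) + 1) ≠ 0 := by positivity
    simp [hq.ne', h1]
  | succ d ih =>
    have hs := h.sub_pos (n := n + 1 + d) (by omega)
    rw [← add_assoc, h.q_succ _ (by omega), mul_comm, mul_div_assoc]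
    have hM : (0 : ℝ) < (n : ℝ) + 1 + d := by positivity
    push_cast at hs ⊢
    have h2 : 1 + u / ((n : ℝ) + 1 + d - x) ≤
        √(((n : ℝ) + 1 + (d + 1)) / ((n : ℝ) + 1 + d)) := by
      apply Real.le_sqrt_of_sq_le
      have h3 : u / ((n : ℝ) + 1 + d - x) ≤ 1 / (4 * ((n : ℝ) + 1 + d)) := by
        rw [div_le_div_iff₀ hs (by positivity)]
        have : (0 : ℝ) ≤ (n : ℝ) + d := by positivity
        nlinarith [h.u_le, h.x_le, h.u_nonneg]
      have h4 : 0 ≤ u / ((n : ℝ) + 1 + d - x) := div_nonneg h.u_nonneg hs.le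
      have h5 : ((n : ℝ) + 1 + (d + 1)) / ((n : ℝ) + 1 + d) = 1 + 1 / ((n : ℝ) + 1 + d) := by
        field_simp
        ring
      rw [h5]
      have h6 : 1 / (4 * ((n : ℝ) + 1 + d)) = (1 / 4) * (1 / ((n : ℝ) + 1 + d)) := by
        field_simp
      have h7 : 1 / ((n : ℝ) + 1 + d) ≤ 1 := by
        rw [div_le_one hM]
        have : (0 : ℝ) ≤ (n : ℝ) + d := by positivity
        linarith
      have h8 : 0 ≤ 1 / ((n : ℝ) + 1 + d) := by positivity
      rw [h6] at h3
      nlinarith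
    calc (1 + u / ((n : ℝ) + 1 + d - x)) * (q (n + 1 + d) / q (n + 1))
        ≤ √(((n : ℝ) + 1 + (d + 1)) / ((n : ℝ) + 1 + d)) *
            √(((n : ℝ) + 1 + d) / ((n : ℝ) + 1)) := by
          refine mul_le_mul h2 ih ?_ (Real.sqrt_nonneg _)
          exact div_nonneg (h.q_pos (by omega)).le hq.le
      _ = _ := by
          rw [← Real.sqrt_mul (by positivity)]
          congr 1
          field_simp

theorem rho_le' (h : RecData x y u g f q R) (n d : ℕ) :
    q (n + 1 + d) / q (n + 1) ≤ √((d : ℝ) + 1) := by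
  refine (h.rho_le n d).trans (Real.sqrt_le_sqrt ?_)
  rw [div_le_iff₀ (by positivity)]
  have : (0 : ℝ) ≤ n * d := by positivity
  nlinarith

/-- The common factor of the terms of the tail sums. -/
noncomputable def tailTerm (x : ℝ) (q R : ℕ → ℝ) (n d : ℕ) : ℝ :=
  q (n + 1 + d) / q (n + 1) * R (n + 1 + d) / ((n : ℝ) + 1 + d - x)

theorem tailTerm_nonneg (h : RecData x y u g f q R) (n d : ℕ) : 0 ≤ tailTerm x q R n d := by
  have hs := h.sub_pos (n := n + 1 + d) (by omega)
  push_cast at hs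
  exact div_nonneg (mul_nonneg (div_nonneg (h.q_pos (by omega)).le (h.q_pos (by omega)).le)
    (h.R_nonneg _)) hs.le

theorem tailTerm_le (h : RecData x y u g f q R) (n d : ℕ) :
    tailTerm x q R n d ≤ 2 * R 0 / √((d : ℝ) + 1) := by
  have hs := h.sub_pos (n := n + 1 + d) (by omega)
  push_cast at hs
  rw [tailTerm, div_le_div_iff₀ hs (by positivity)]
  have h1 := h.rho_le' n d
  have h2 := h.R_le (n + 1 + d)
  have h3 : 0 ≤ R 0 := h.R_nonneg 0
  have h4 : q (n + 1 + d) / q (n + 1) * R (n + 1 + d) ≤ √((d : ℝ) + 1) * R 0 :=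
    mul_le_mul h1 h2 (h.R_nonneg _) (Real.sqrt_nonneg _)
  calc _ ≤ √((d : ℝ) + 1) * R 0 * √((d : ℝ) + 1) :=
        mul_le_mul_of_nonneg_right h4 (Real.sqrt_nonneg _)
    _ = R 0 * ((d : ℝ) + 1) := by
        rw [mul_right_comm, Real.mul_self_sqrt (by positivity), mul_comm]
    _ ≤ _ := by
        have : (0 : ℝ) ≤ n := Nat.cast_nonneg n
        have : (0 : ℝ) ≤ d := Nat.cast_nonneg d
        nlinarith [h.x_le]

theorem summable_sqrt : Summable fun d : ℕ => 1 / (√((d : ℝ) + 1) * ((d : ℝ) + 1)) := by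
  have h := (summable_nat_add_iff 1).2 (Real.summable_one_div_nat_rpow.2
    (by norm_num : (1 : ℝ) < 3 / 2))
  refine h.congr fun d => ?_
  have h1 : (0 : ℝ) < ((d + 1 : ℕ) : ℝ) := by positivity
  rw [show (3 / 2 : ℝ) = 1 / 2 + 1 by norm_num, Real.rpow_add h1, Real.rpow_one,
    ← Real.sqrt_eq_rpow]
  push_cast
  rfl

/-- The quotient of the `q` grows at most like `√d` and `1 / (M - x)` decays like `1 / d`, so a
further denominator of order `d` leaves a bound of order `d ^ (-3/2)`. -/
theorem summable_tail (h : RecData x y u g f q R) (n : ℕ) {c : ℕ → ℝ}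
    (hc : ∀ d : ℕ, (d : ℝ) + 1 ≤ c d) : Summable fun d => tailTerm x q R n d / c d := by
  refine Summable.of_nonneg_of_le (fun d => ?_) (fun d => ?_)
    (summable_sqrt.mul_left (2 * R 0))
  · have h1 : (0 : ℝ) < c d := lt_of_lt_of_le (by positivity) (hc d)
    exact div_nonneg (h.tailTerm_nonneg n d) h1.le
  · have h2 : (0 : ℝ) < (d : ℝ) + 1 := by positivity
    calc tailTerm x q R n d / c d ≤ tailTerm x q R n d / ((d : ℝ) + 1) :=
          div_le_div_of_nonneg_left (h.tailTerm_nonneg n d) h2 (hc d)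
      _ ≤ (2 * R 0 / √((d : ℝ) + 1)) / ((d : ℝ) + 1) :=
          div_le_div_of_nonneg_right (h.tailTerm_le n d) h2.le
      _ = _ := by rw [div_div]; ring

/-- `∑_{M > n} ρ(n, M) R_M / (M (M - x))`. -/
noncomputable def tailT (x : ℝ) (q R : ℕ → ℝ) (n : ℕ) : ℝ :=
  ∑' d : ℕ, tailTerm x q R n d / ((n : ℝ) + 1 + d)

/-- `∑_{M > n} ρ(n, M) R_M / ((M - n) (M - x))`. -/
noncomputable def tailX (x : ℝ) (q R : ℕ → ℝ) (n : ℕ) : ℝ :=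
  ∑' d : ℕ, tailTerm x q R n d / ((d : ℝ) + 1)

/-- `∑_{M > n} ρ(n, M) R_M / ((M - n + 1) (M - x))`. -/
noncomputable def tailX' (x : ℝ) (q R : ℕ → ℝ) (n : ℕ) : ℝ :=
  ∑' d : ℕ, tailTerm x q R n d / ((d : ℝ) + 2)

theorem summable_T (h : RecData x y u g f q R) (n : ℕ) :
    Summable fun d : ℕ => tailTerm x q R n d / ((n : ℝ) + 1 + d) :=
  h.summable_tail n fun d => by
    have : (0 : ℝ) ≤ n := Nat.cast_nonneg n
    linarith

theorem summable_X (h : RecData x y u g f q R) (n : ℕ) :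
    Summable fun d : ℕ => tailTerm x q R n d / ((d : ℝ) + 1) :=
  h.summable_tail n fun _ => le_rfl

theorem summable_X' (h : RecData x y u g f q R) (n : ℕ) :
    Summable fun d : ℕ => tailTerm x q R n d / ((d : ℝ) + 2) :=
  h.summable_tail n fun d => by linarith

/-- The combination of the three summands is `n` times the difference of consecutive values of `z`;
the sum telescopes to `z 0 = R n`. -/
theorem tail_relation (h : RecData x y u g f q R) {n : ℕ} (hn : n ≠ 0) :
    ((n : ℝ) * (n - x) + y) * tailX x q R n - y * tailT x q R n -
      n * (n - 1 - x + u) * tailX' x q R n = n * R n := by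
  -- The index of `R` lags by one behind that of `q`, so the recurrences of `R` and of `q` both
  -- enter `z d - z (d + 1)`.
  set z : ℕ → ℝ := fun d => q (n + 1 + d) / q (n + 1) * R (n + d) / ((d : ℝ) + 1) with hz
  have hq := h.q_pos (n := n + 1) (by omega)
  have hterm : ∀ d : ℕ, ((n : ℝ) * (n - x) + y) * (tailTerm x q R n d / ((d : ℝ) + 1)) -
      y * (tailTerm x q R n d / ((n : ℝ) + 1 + d)) -
      n * (n - 1 - x + u) * (tailTerm x q R n d / ((d : ℝ) + 2)) = n * (z d - z (d + 1)) := by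
    intro d
    have hs := h.sub_pos (n := n + 1 + d) (by omega)
    have h1 : R (n + d) = (1 + y / (((n : ℝ) + 1 + d) * ((n : ℝ) + 1 + d - x))) *
        R (n + 1 + d) := by
      rw [h.R_eq (n + d)]
      push_cast
      rw [show n + d + 1 = n + 1 + d by ring, show (n : ℝ) + d + 1 = n + 1 + d by ring]
    have h2 : q (n + 1 + (d + 1)) = q (n + 1 + d) * (1 + u / ((n : ℝ) + 1 + d - x)) := by
      rw [← add_assoc, h.q_succ _ (by omega)]
      push_cast
      rfl
    simp only [hz, tailTerm]
    rw [h1, h2, show n + (d + 1) = n + 1 + d by ring]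
    push_cast at hs ⊢
    have h3 : (d : ℝ) + 1 ≠ 0 := by positivity
    have h4 : (d : ℝ) + 2 ≠ 0 := by positivity
    have h4' : (d : ℝ) + 1 + 1 ≠ 0 := by positivity
    have h5 : (n : ℝ) + 1 + d ≠ 0 := by positivity
    have h6 := hs.ne'
    have h7 := hq.ne'
    field_simp
    ring
  have hsum : HasSum (fun d => n * (z d - z (d + 1))) (n * z 0) := by
    have hlim : Filter.Tendsto z Filter.atTop (nhds 0) := by
      refine squeeze_zero (fun d => ?_) (g := fun d : ℕ => R 0 / √((d : ℝ) + 1)) (fun d => ?_) ?_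
      · exact div_nonneg (mul_nonneg (div_nonneg (h.q_pos (by omega)).le hq.le)
          (h.R_nonneg _)) (by positivity)
      · rw [hz, div_le_div_iff₀ (by positivity) (by positivity)]
        have h1 : q (n + 1 + d) / q (n + 1) * R (n + d) ≤ √((d : ℝ) + 1) * R 0 :=
          mul_le_mul (h.rho_le' n d) (h.R_le _) (h.R_nonneg _) (Real.sqrt_nonneg _)
        calc _ ≤ √((d : ℝ) + 1) * R 0 * √((d : ℝ) + 1) :=
              mul_le_mul_of_nonneg_right h1 (Real.sqrt_nonneg _)
          _ = R 0 * ((d : ℝ) + 1) := by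
              rw [mul_right_comm, Real.mul_self_sqrt (by positivity), mul_comm]
      · refine tendsto_const_nhds.div_atTop (Real.tendsto_sqrt_atTop.comp ?_)
        exact Filter.tendsto_atTop_add_const_right _ _ tendsto_natCast_atTop_atTop
    have h1 : HasSum (fun d => z d - z (d + 1)) (z 0) := by
      rw [Summable.hasSum_iff_tendsto_nat]
      · simp only [Finset.sum_range_sub']
        simpa using tendsto_const_nhds.sub hlim
      -- Summability of the differences is read off from the three convergent series, after dividing
      -- by `n`; this is where `n ≠ 0` is needed.
      · have h0 : (n : ℝ) ≠ 0 := by exact_mod_cast hn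
        refine (summable_mul_left_iff h0).1 ?_
        refine Summable.congr ?_ hterm
        exact (((h.summable_X n).mul_left _).sub ((h.summable_T n).mul_left _)).sub
          ((h.summable_X' n).mul_left _)
    exact h1.mul_left (n : ℝ)
  have hlhs := ((((h.summable_X n).mul_left ((n : ℝ) * (n - x) + y)).hasSum).sub
    ((h.summable_T n).mul_left y).hasSum).sub
    ((h.summable_X' n).mul_left ((n : ℝ) * (n - 1 - x + u))).hasSum
  rw [tsum_mul_left, tsum_mul_left, tsum_mul_left] at hlhs
  have h1 := hlhs.unique (by simpa only [hterm] using hsum)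
  have h2 : z 0 = R n := by
    simp [hz, hq.ne']
  rw [h2] at h1
  exact h1

theorem rho_shift (h : RecData x y u g f q R) (n d : ℕ) :
    tailTerm x q R n (d + 1) = (1 + u / ((n : ℝ) + 1 - x)) * tailTerm x q R (n + 1) d := by
  have h1 := h.q_succ (n + 1) (by omega)
  have h2 := (h.q_pos (n := n + 1) (by omega)).ne'
  have h3 := (h.q_pos (n := n + 1 + 1) (by omega)).ne'
  rw [h1] at h3
  have h4 := (mul_ne_zero_iff.1 h3).2
  rw [tailTerm, tailTerm, h1, show n + 1 + (d + 1) = n + 1 + 1 + d by ring]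
  push_cast at h4 ⊢
  rw [show (n : ℝ) + 1 + (d + 1) - x = n + 1 + 1 + d - x by ring]
  field_simp

theorem tailTerm_zero (h : RecData x y u g f q R) (n : ℕ) :
    tailTerm x q R n 0 = R (n + 1) / ((n : ℝ) + 1 - x) := by
  have h2 := (h.q_pos (n := n + 1) (by omega)).ne'
  simp [tailTerm, h2]

/-- Removing the first term turns the denominators `d + 1` into `d + 2`, hence `tailX` at `n` into
`tailX'` at `n + 1`. -/
theorem tailX_eq (h : RecData x y u g f q R) (n : ℕ) :
    tailX x q R n = R (n + 1) / ((n : ℝ) + 1 - x) +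
      (1 + u / ((n : ℝ) + 1 - x)) * tailX' x q R (n + 1) := by
  rw [tailX, (h.summable_X n).tsum_eq_zero_add, tailX', ← tsum_mul_left, h.tailTerm_zero]
  congr 1
  · simp
  · refine tsum_congr fun d => ?_
    rw [h.rho_shift]
    push_cast
    ring

theorem tailT_eq (h : RecData x y u g f q R) (n : ℕ) :
    tailT x q R n = R (n + 1) / (((n : ℝ) + 1) * ((n : ℝ) + 1 - x)) +
      (1 + u / ((n : ℝ) + 1 - x)) * tailT x q R (n + 1) := by
  rw [tailT, (h.summable_T n).tsum_eq_zero_add, tailT, ← tsum_mul_left, h.tailTerm_zero]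
  congr 1
  · rw [div_div, mul_comm]; simp
  · refine tsum_congr fun d => ?_
    rw [h.rho_shift]
    push_cast
    ring

/-- For `n = 1` the denominators `M - n + 1` and `M` coincide. This starts the induction in
`bilinear`. -/
theorem tailX'_one (x : ℝ) (q R : ℕ → ℝ) : tailX' x q R 1 = tailT x q R 1 :=
  tsum_congr fun d => by push_cast; ring

/-- `∑_{m < n} ρ(m, n) g_m / (m - x) * c_m`. -/
noncomputable def headSum (x : ℝ) (g q : ℕ → ℝ) (n : ℕ) (c : ℕ → ℝ) : ℝ :=
  ∑ m ∈ Finset.Ico 1 n, q n / q (m + 1) * (g m / ((m : ℝ) - x)) * c m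

/-- Variation of constants: `f - g` vanishes at `1` and obeys the recurrence of `q` with the
inhomogeneous term `u * g n / (n - x)`. -/
theorem headSum_one (h : RecData x y u g f q R) {n : ℕ} (hn : 1 ≤ n) :
    u * headSum x g q n (fun _ => 1) = f n - g n := by
  induction n, hn using Nat.le_induction with
  | base => simp [headSum, h.f_one, h.g_one]
  | succ n hn ih =>
    have h1 := h.q_succ n hn
    have h2 := (h.q_pos (n := n + 1) (by omega)).ne'
    have h3 := (h.q_pos hn).ne'
    have h4 : headSum x g q (n + 1) (fun _ => 1) =
        (1 + u / (n - x)) * headSum x g q n (fun _ => 1) + g n / (n - x) := by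
      rw [headSum, Finset.sum_Ico_succ_top hn, headSum, Finset.mul_sum]
      congr 1
      · refine Finset.sum_congr rfl fun m _ => ?_
        rw [h1]
        ring
      · rw [div_self h2]
        ring
    rw [h4, h.f_succ n hn, h.g_succ n hn]
    linear_combination (1 + u / (n - x)) * ih

/-- The finite counterpart of `tail_relation`, again by telescoping; `f n` enters through the
unweighted head sum of `headSum_one`. -/
theorem head_relation (h : RecData x y u g f q R) {n : ℕ} (hn : 1 ≤ n) :
    ((n : ℝ) * (n - x) + y) * headSum x g q n (fun m => 1 / ((n : ℝ) - m)) -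
      n * (n + 1 - x + u) * headSum x g q n (fun m => 1 / ((n : ℝ) + 1 - m)) + f n =
        n * g n := by
  -- The factor `m - 1` makes `z 1` vanish, and `z n = (n - 1) * g n`.
  set z : ℕ → ℝ := fun m => ((m : ℝ) - 1) / ((n : ℝ) + 1 - m) * (q n / q m) * g m with hz
  have h1 : ∑ m ∈ Finset.Ico 1 n, (z (m + 1) - z m) = ((n : ℝ) - 1) * g n := by
    rw [Finset.sum_Ico_sub z hn]
    simp [hz, (h.q_pos hn).ne']
  have h2 : f n = g n + u * headSum x g q n (fun _ => 1) := by
    rw [h.headSum_one hn]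
    ring
  rw [h2]
  simp only [headSum, Finset.mul_sum]
  have h3 : ∀ m ∈ Finset.Ico 1 n, z (m + 1) - z m =
      ((n : ℝ) * (n - x) + y) * (q n / q (m + 1) * (g m / ((m : ℝ) - x)) * (1 / ((n : ℝ) - m))) -
      n * (n + 1 - x + u) * (q n / q (m + 1) * (g m / ((m : ℝ) - x)) *
        (1 / ((n : ℝ) + 1 - m))) + u * (q n / q (m + 1) * (g m / ((m : ℝ) - x)) * 1) := by
    intro m hm
    obtain ⟨hm1, hm2⟩ := Finset.mem_Ico.1 hm
    have e1 := (h.sub_pos hm1).ne'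
    have e2 : (n : ℝ) - m ≠ 0 := sub_ne_zero.2 (by exact_mod_cast hm2.ne')
    have e3 : (n : ℝ) + 1 - m ≠ 0 := by
      have : (m : ℝ) < n := by exact_mod_cast hm2
      apply ne_of_gt
      linarith
    have e4 : (m : ℝ) ≠ 0 := by
      have : (1 : ℝ) ≤ m := by exact_mod_cast hm1
      positivity
    have e5 := (h.q_pos hm1).ne'
    have e6 : (m : ℝ) - x + u ≠ 0 := by
      have := h.sub_pos hm1
      have := h.u_nonneg
      positivity
    simp only [hz]
    rw [h.g_succ m hm1, h.q_succ m hm1]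
    push_cast
    rw [show (n : ℝ) + 1 - (m + 1) = n - m by ring, add_sub_cancel_right]
    have e7 : 1 + u / ((m : ℝ) - x) = (m - x + u) / (m - x) := by field_simp
    rw [e7]
    field_simp
    ring
  rw [Finset.sum_congr rfl h3, Finset.sum_add_distrib, Finset.sum_sub_distrib] at h1
  linarith

theorem headSum_succ (h : RecData x y u g f q R) {n : ℕ} (hn : 1 ≤ n) :
    headSum x g q (n + 1) (fun m => 1 / (((n + 1 : ℕ) : ℝ) - m)) =
      (1 + u / (n - x)) * headSum x g q n (fun m => 1 / ((n : ℝ) + 1 - m)) + g n / (n - x) := by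
  have h1 := h.q_succ n hn
  have h2 := (h.q_pos (n := n + 1) (by omega)).ne'
  rw [headSum, Finset.sum_Ico_succ_top hn, headSum, Finset.mul_sum]
  congr 1
  · refine Finset.sum_congr rfl fun m _ => ?_
    rw [h1]
    push_cast
    ring
  · rw [div_self h2]
    push_cast
    simp

/-- Induction on `n`. The recurrences express the head data at `n + 1` and the tail data at `n`
through common quantities, and the two instances of the relation then differ by multiples of
`head_relation` at `n` and `tail_relation` at `n + 1`. -/
theorem bilinear (h : RecData x y u g f q R) {n : ℕ} (hn : 1 ≤ n) :
    R n * ((n - u) * f n - n * g n -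
        u * ((n : ℝ) * (n - x) + y) * headSum x g q n (fun m => 1 / ((n : ℝ) - m))) +
      tailT x q R n * ((n - u) * y * g n - n * (y - u * (x - u)) * f n) +
      u * ((n : ℝ) * (n - x) + y) * g n * tailX x q R n = 0 := by
  induction n, hn using Nat.le_induction with
  | base =>
    -- For `n = 1` the head sum is empty and the claim is `u` times the tail relation.
    have h1 := h.tail_relation one_ne_zero
    rw [tailX'_one] at h1
    simp only [headSum, Finset.Ico_self, Finset.sum_empty, h.g_one, h.f_one]
    push_cast at h1 ⊢
    linear_combination u * h1
  | succ n hn ih =>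
    have e0 : (n : ℝ) ≠ 0 := by
      have : (1 : ℝ) ≤ n := by exact_mod_cast hn
      positivity
    have e1 := (h.sub_pos hn)
    have e2 := (h.sub_pos (n := n + 1) (by omega))
    have e3 : (n : ℝ) + 1 ≠ 0 := by positivity
    have hu := h.u_nonneg
    push_cast at e2
    have e4 : (n : ℝ) - x + u ≠ 0 := by positivity
    have e5 : (n : ℝ) + 1 - x + u ≠ 0 := by positivity
    have e1' := e1.ne'
    have e2' := e2.ne'
    have h1 := h.head_relation hn
    have h2 := h.tail_relation n.succ_ne_zero
    rw [h.headSum_succ hn, h.g_succ n hn, h.f_succ n hn]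
    rw [h.tailX_eq n, h.tailT_eq n, h.R_eq n] at ih
    push_cast at h2 ⊢
    generalize headSum x g q n (fun m => 1 / ((n : ℝ) + 1 - m)) = y1p at *
    generalize headSum x g q n (fun m => 1 / ((n : ℝ) - m)) = y1 at *
    generalize tailX x q R (n + 1) = X at *
    generalize tailX' x q R (n + 1) = X' at *
    generalize tailT x q R (n + 1) = T at *
    generalize R (n + 1) = R' at *
    generalize g n = G at *
    generalize f n = F at *
    generalize (n : ℝ) = N at *
    -- The product `T * F` occurs only in `ih` and in the goal, which forces the coefficient of
    -- `ih`. The multiple of `h1` then removes the head sums and that of `h2` removes `X` and `X'`.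
    linear_combination (norm := (field_simp; ring))
      (N + 1) * (N + 1 - x) * (N - x + u) / (N * (N + 1 - x + u) * (N - x)) * ih +
      (N + 1) * (N + 1 - x) * (N - x + u) / (N * (N + 1 - x + u) * (N - x)) *
        ((1 + y / ((N + 1) * (N + 1 - x))) * R') * u * h1 +
      u * (G * (1 + y / (N * (N - x)))) * h2

/-- The contribution of a single place to the difference of the two generating functions. -/
theorem local_identity (h : RecData x y u g f q R) {n : ℕ} (hn : 1 ≤ n) {J : ℝ}
    (hJ : ((n : ℝ) * (n - x) + y) * J = n * (g n * R n) / (n - u) - f n * R n +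
      ((y - u * n) * f n - y * g n) * tailT x q R n) :
    (y + (u - x) * n) * J - y * (f n - g n) * tailT x q R n - u * (g n * R n) / (n - u) +
      u * (n * g n * tailX x q R n -
        R n * headSum x g q n (fun m => (m : ℝ) / ((n : ℝ) - m))) = 0 := by
  have h1 := h.bilinear hn
  have h2 := h.headSum_one hn
  have h3 : headSum x g q n (fun m => (m : ℝ) / ((n : ℝ) - m)) =
      n * headSum x g q n (fun m => 1 / ((n : ℝ) - m)) - headSum x g q n (fun _ => 1) := by
    simp only [headSum, Finset.mul_sum]
    rw [← Finset.sum_sub_distrib]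
    refine Finset.sum_congr rfl fun m hm => ?_
    have e2 : (n : ℝ) - m ≠ 0 :=
      sub_ne_zero.2 (by exact_mod_cast (Finset.mem_Ico.1 hm).2.ne')
    field_simp
    ring
  have hn1 : (1 : ℝ) ≤ n := by exact_mod_cast hn
  have h4 : (n : ℝ) - u ≠ 0 := by
    have := h.u_le
    apply ne_of_gt
    linarith
  have h5 : (n : ℝ) * (n - x) + y ≠ 0 := by
    have := h.sub_pos hn
    have := h.y_nonneg
    positivity
  rw [h3]
  generalize headSum x g q n (fun m => 1 / ((n : ℝ) - m)) = y1 at *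
  generalize headSum x g q n (fun _ => 1) = y0 at *
  generalize tailX x q R n = X at *
  generalize tailT x q R n = T at *
  generalize R n = R' at *
  generalize g n = G at *
  generalize f n = F at *
  generalize (n : ℝ) = N at *
  -- `hJ` determines `J` only after multiplication by `n * (n - x) + y`, which is nonzero.
  rw [← mul_right_inj' h5, mul_zero]
  linear_combination (norm := (field_simp; ring)) (y + (u - x) * N) * hJ + N * h1 +
    R' * (N * (N - x) + y) * h2

end RecData

/-! ### Generating functions of families of words -/

theorem tsum_sum_antidiagonal (H : ℕ → ℕ → ℝ≥0∞) :
    ∑' l, ∑ p ∈ Finset.HasAntidiagonal.antidiagonal l, H p.1 p.2 = ∑' a, ∑' b, H a b := by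
  rw [← ENNReal.tsum_prod, ← Finset.HasAntidiagonal.sigmaAntidiagonalEquivProd.tsum_eq,
    ENNReal.tsum_sigma']
  refine tsum_congr fun l => ?_
  rw [tsum_fintype]
  exact (Finset.sum_coe_sort (Finset.HasAntidiagonal.antidiagonal l)
    (fun p => H p.1 p.2)).symm

/-- `∑ G(p₁, p₂)` over `p₁ + p₂ + 1 = n`. -/
def posSum {M : Type*} [AddCommMonoid M] (G : ℕ → ℕ → M) : ℕ → M
  | 0 => 0
  | n + 1 => ∑ p ∈ Finset.HasAntidiagonal.antidiagonal n, G p.1 p.2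

theorem tsum_pow_mul_posSum (U : ℝ≥0∞) (G : ℕ → ℕ → ℝ≥0∞) :
    ∑' j, U ^ j * posSum G j = ∑' a, ∑' b, U ^ (a + b + 1) * G a b := by
  rw [tsum_eq_zero_add' ENNReal.summable, posSum, mul_zero, zero_add,
    ← tsum_sum_antidiagonal]
  refine tsum_congr fun j => ?_
  rw [posSum, Finset.mul_sum]
  refine Finset.sum_congr rfl fun p hp => ?_
  rw [Finset.HasAntidiagonal.mem_antidiagonal.1 hp]

theorem tsum_pow_mul_antidiagonal (Y : ℝ≥0∞) (G : ℕ → ℕ → ℝ≥0∞) :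
    ∑' l, Y ^ l * ∑ p ∈ Finset.HasAntidiagonal.antidiagonal l, G p.1 p.2 =
      ∑' a, ∑' b, Y ^ (a + b) * G a b := by
  rw [← tsum_sum_antidiagonal]
  refine tsum_congr fun j => ?_
  rw [Finset.mul_sum]
  refine Finset.sum_congr rfl fun p hp => ?_
  rw [Finset.HasAntidiagonal.mem_antidiagonal.1 hp]

section Replicate

variable {α M : Type*}

theorem splitSumPos_replicate_append {R : Type*} [CommSemiring R] (P Q : List α → R) (j : ℕ)
    (a : α) (w : List α) :
    splitSumPos P Q (List.replicate j a ++ w) =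
      posSum (fun i k => P (List.replicate (i + 1) a) * Q (List.replicate k a ++ w)) j +
        splitSumPos (fun v => P (List.replicate j a ++ v)) Q w := by
  cases j with
  | zero => simp [posSum]
  | succ j => rw [splitSumPos_replicate_succ_append, posSum]

theorem raiseSum_replicate_append [AddCommMonoid M] (φ : List α → M) (g : α → α) (j : ℕ) (a : α)
    (w : List α) :
    raiseSum φ g (List.replicate j a ++ w) =
      posSum (fun i k => φ (List.replicate i a ++ g a :: (List.replicate k a ++ w))) j +
        raiseSum (fun v => φ (List.replicate j a ++ v)) g w := by
  induction j generalizing φ with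
  | zero => simp [posSum]
  | succ j ih =>
    rw [List.replicate_succ, List.cons_append, raiseSum, ih, ← add_assoc]
    congr 1
    cases j with
    | zero => simp [posSum]
    | succ j =>
      simp only [posSum]
      rw [Finset.Nat.sum_antidiagonal_succ]
      simp [List.replicate_succ]

theorem expandSum_replicate_append [AddCommMonoid M] (φ : Index → M) (τ j : ℕ) (w : Index) :
    expandSum φ τ (List.replicate j 2 ++ w) =
      posSum (fun i k => φ (List.replicate i 2 ++
        (List.replicate (τ + 1) 1 ++ 2 :: (List.replicate k 2 ++ w)))) j +
        expandSum (fun v => φ (List.replicate j 2 ++ v)) τ w := by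
  induction j generalizing φ with
  | zero => simp [posSum]
  | succ j ih =>
    have h2 : ((2 : ℕ+) : ℕ) - 1 = 0 + 1 := rfl
    have h3 : Nat.succPNat 0 = 1 := rfl
    have h4 : Nat.succPNat (0 + 1) = 2 := rfl
    rw [List.replicate_succ, List.cons_append, expandSum, ih, ← add_assoc, h2]
    congr 1
    cases j with
    | zero => simp [posSum, h3, h4, List.replicate_succ]
    | succ j =>
      simp only [posSum]
      rw [Finset.Nat.sum_antidiagonal_succ]
      simp [List.replicate_succ, h3, h4]

end Replicate

section Gen

variable {α : Type*} (Y U : ℝ≥0∞) (d e : α) (c : ℕ → α)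

/-- The generating function of the words `d^a`. -/
noncomputable def genG (P : List α → ℝ≥0∞) : ℝ≥0∞ := ∑' a : ℕ, Y ^ a * P (List.replicate a d)

/-- The generating function of the words `d^a e^j` with `j > 0`. -/
noncomputable def genF (P : List α → ℝ≥0∞) : ℝ≥0∞ :=
  ∑' (a : ℕ) (j : ℕ), Y ^ a * U ^ (j + 1) * P (List.replicate a d ++ List.replicate (j + 1) e)

/-- The generating function of the words `d^a e^j d d^b`. -/
noncomputable def genV (P : List α → ℝ≥0∞) : ℝ≥0∞ :=
  ∑' (j : ℕ) (a : ℕ) (b : ℕ), U ^ j * (Y ^ (a + b) *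
    P (List.replicate a d ++ (List.replicate j e ++ d :: List.replicate b d)))

/-- The generating function of the words `e^j d d^b`. -/
noncomputable def genT (P : List α → ℝ≥0∞) : ℝ≥0∞ :=
  ∑' (j : ℕ) (b : ℕ), U ^ j * Y ^ b * P (List.replicate j e ++ d :: List.replicate b d)

/-- The generating function of the words `d^a c_j d^b`. -/
noncomputable def genK (P : List α → ℝ≥0∞) : ℝ≥0∞ :=
  ∑' (j : ℕ) (a : ℕ) (b : ℕ), U ^ j * (Y ^ (a + b) *
    P (List.replicate a d ++ c j :: List.replicate b d))

theorem tsum_antidiagonal_left (A : ℕ → ℝ≥0∞) (Q : ℕ → ℕ → ℝ≥0∞) :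
    ∑' a : ℕ, ∑' b : ℕ, Y ^ (a + b) *
        ∑ p ∈ Finset.HasAntidiagonal.antidiagonal a, A p.1 * Q p.2 b =
      (∑' a : ℕ, Y ^ a * A a) * ∑' (a : ℕ) (b : ℕ), Y ^ (a + b) * Q a b := by
  rw [← ENNReal.tsum_mul_right]
  have h : ∀ a : ℕ, ∑' b : ℕ, Y ^ (a + b) *
      ∑ p ∈ Finset.HasAntidiagonal.antidiagonal a, A p.1 * Q p.2 b =
      Y ^ a * ∑ p ∈ Finset.HasAntidiagonal.antidiagonal a, A p.1 * ∑' b, Y ^ b * Q p.2 b := by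
    intro a
    simp only [pow_add, mul_assoc, ENNReal.tsum_mul_left]
    congr 1
    simp only [← ENNReal.tsum_mul_left, Finset.mul_sum]
    rw [Summable.tsum_finsetSum fun _ _ => ENNReal.summable]
    exact Finset.sum_congr rfl fun p _ => tsum_congr fun b => by ring
  rw [tsum_congr h, tsum_pow_mul_antidiagonal Y (fun i k => A i * ∑' b, Y ^ b * Q k b)]
  refine tsum_congr fun a => ?_
  rw [← ENNReal.tsum_mul_left]
  refine tsum_congr fun k => ?_
  simp only [← ENNReal.tsum_mul_left]
  exact tsum_congr fun b => by ring

theorem tsum_antidiagonal_right (P : ℕ → ℕ → ℝ≥0∞) (B : ℕ → ℝ≥0∞) :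
    ∑' a : ℕ, ∑' b : ℕ, Y ^ (a + b) *
        ∑ p ∈ Finset.HasAntidiagonal.antidiagonal b, P a p.1 * B p.2 =
      (∑' (a : ℕ) (b : ℕ), Y ^ (a + b) * P a b) * ∑' a : ℕ, Y ^ a * B a := by
  rw [← ENNReal.tsum_mul_right]
  refine tsum_congr fun a => ?_
  simp only [pow_add, mul_assoc, ENNReal.tsum_mul_left]
  congr 1
  rw [tsum_pow_mul_antidiagonal Y (fun i k => P a i * B k), ← ENNReal.tsum_mul_right]
  refine tsum_congr fun i => ?_
  rw [← ENNReal.tsum_mul_left]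
  exact tsum_congr fun k => by ring

/-- The cut lies either before or after the special letter `c j`; the part without it is a pure
power of `d`. -/
theorem genK_splitSum (P Q : List α → ℝ≥0∞) :
    genK Y U d c (splitSum P Q) =
      genG Y d P * genK Y U d c Q + genK Y U d c P * genG Y d Q := by
  have h : ∀ j a b : ℕ, splitSum P Q (List.replicate a d ++ c j :: List.replicate b d) =
      (∑ p ∈ Finset.HasAntidiagonal.antidiagonal a, P (List.replicate p.1 d) *
        Q (List.replicate p.2 d ++ c j :: List.replicate b d)) +
      ∑ p ∈ Finset.HasAntidiagonal.antidiagonal b,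
        P (List.replicate a d ++ c j :: List.replicate p.1 d) * Q (List.replicate p.2 d) := by
    intro j a b
    rw [splitSum_replicate_append, splitSumPos_cons_replicate]
  have hL := fun j => tsum_antidiagonal_left Y (fun a => P (List.replicate a d))
    (fun a b => Q (List.replicate a d ++ c j :: List.replicate b d))
  have hR := fun j => tsum_antidiagonal_right Y
    (fun a b => P (List.replicate a d ++ c j :: List.replicate b d))
    (fun a => Q (List.replicate a d))
  simp only [genK, genG, h, mul_add, ENNReal.tsum_add, ENNReal.tsum_mul_left, hL, hR]
  congr 1
  · rw [← ENNReal.tsum_mul_left]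
    exact tsum_congr fun j => by ring
  · rw [← ENNReal.tsum_mul_right]
    exact tsum_congr fun j => by ring

/-- The cut may also fall in the run of `e`, which gives the middle product. A cut right before the
run belongs to the first product, one right after a nonempty run to the middle one, so no cut is
counted twice. -/
theorem genV_splitSum (P Q : List α → ℝ≥0∞) :
    genV Y U d e (splitSum P Q) =
      genG Y d P * genV Y U d e Q + genF Y U d e P * genT Y U d e Q +
        genV Y U d e P * genG Y d Q := by
  have h : ∀ j a b : ℕ,
      splitSum P Q (List.replicate a d ++ (List.replicate j e ++ d :: List.replicate b d)) =
      (∑ p ∈ Finset.HasAntidiagonal.antidiagonal a, P (List.replicate p.1 d) *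
        Q (List.replicate p.2 d ++ (List.replicate j e ++ d :: List.replicate b d))) +
      posSum (fun i k => P (List.replicate a d ++ List.replicate (i + 1) e) *
        Q (List.replicate k e ++ d :: List.replicate b d)) j +
      ∑ p ∈ Finset.HasAntidiagonal.antidiagonal b,
        P (List.replicate a d ++ (List.replicate j e ++ d :: List.replicate p.1 d)) *
          Q (List.replicate p.2 d) := by
    intro j a b
    rw [splitSum_replicate_append, splitSumPos_replicate_append, splitSumPos_cons_replicate,
      add_assoc]
  have h2 : ∑' (j : ℕ) (a : ℕ) (b : ℕ), U ^ j * (Y ^ (a + b) *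
      posSum (fun i k => P (List.replicate a d ++ List.replicate (i + 1) e) *
        Q (List.replicate k e ++ d :: List.replicate b d)) j) =
      genF Y U d e P * genT Y U d e Q := by
    rw [ENNReal.tsum_comm, genF, ← ENNReal.tsum_mul_right]
    refine tsum_congr fun a => ?_
    rw [ENNReal.tsum_comm]
    have h3 : ∀ b : ℕ, ∑' j : ℕ, U ^ j * (Y ^ (a + b) *
        posSum (fun i k => P (List.replicate a d ++ List.replicate (i + 1) e) *
          Q (List.replicate k e ++ d :: List.replicate b d)) j) =
        Y ^ (a + b) * ∑' (i : ℕ) (k : ℕ), U ^ (i + k + 1) *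
          (P (List.replicate a d ++ List.replicate (i + 1) e) *
          Q (List.replicate k e ++ d :: List.replicate b d)) := by
      intro b
      rw [← tsum_pow_mul_posSum, ← ENNReal.tsum_mul_left]
      exact tsum_congr fun j => by ring
    rw [tsum_congr h3]
    simp only [← ENNReal.tsum_mul_left]
    rw [ENNReal.tsum_comm, ← ENNReal.tsum_mul_right]
    refine tsum_congr fun i => ?_
    rw [ENNReal.tsum_comm, genT, ← ENNReal.tsum_mul_left]
    refine tsum_congr fun k => ?_
    rw [← ENNReal.tsum_mul_left]
    exact tsum_congr fun b => by ring
  rw [← h2]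
  simp only [genV, genG, h, mul_add, ENNReal.tsum_add]
  congr 1
  · congr 1
    simp only [ENNReal.tsum_mul_left]
    have hL := fun j => tsum_antidiagonal_left Y (fun a => P (List.replicate a d))
      (fun a b => Q (List.replicate a d ++ (List.replicate j e ++ d :: List.replicate b d)))
    simp only [hL]
    rw [← ENNReal.tsum_mul_left]
    exact tsum_congr fun j => by ring
  · simp only [ENNReal.tsum_mul_left]
    have hR := fun j => tsum_antidiagonal_right Y
      (fun a b => P (List.replicate a d ++ (List.replicate j e ++ d :: List.replicate b d)))
      (fun a => Q (List.replicate a d))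
    simp only [hR]
    rw [← ENNReal.tsum_mul_right]
    exact tsum_congr fun j => by ring

theorem genG_add_genF (P : List α → ℝ≥0∞) :
    genG Y d P + genF Y U d e P =
      ∑' (a : ℕ) (j : ℕ), Y ^ a * U ^ j * P (List.replicate a d ++ List.replicate j e) := by
  rw [genG, genF, ← ENNReal.tsum_add]
  refine tsum_congr fun a => ?_
  conv_rhs => rw [tsum_eq_zero_add' ENNReal.summable]
  simp

end Gen

/-! ### Recurrences of the generating functions when the window grows -/

section Window

variable (Y U : ℝ≥0∞) (d e : ℕ → ℝ≥0∞) (c : ℕ → ℕ → ℝ≥0∞)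

theorem mul_tsum_window (C : ℝ≥0∞) (p : ℕ → Prop) [DecidablePred p] (F : ℕ → ℝ≥0∞) :
    C * ∑' m, (if p m then F m else 0) = ∑' m, if p m then C * F m else 0 := by
  rw [← ENNReal.tsum_mul_left]
  refine tsum_congr fun m => ?_
  split_ifs <;> simp

theorem tsum_window_comm {ι : Type*} (p : ℕ → Prop) [DecidablePred p] (F : ι → ℕ → ℝ≥0∞) :
    ∑' i, ∑' m, (if p m then F i m else 0) = ∑' m, if p m then ∑' i, F i m else 0 := by
  rw [ENNReal.tsum_comm]
  refine tsum_congr fun m => ?_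
  split_ifs <;> simp

/-- The new place is either unused or carries the last letter `d`. The generating function is thus a
product of factors `1 + Y * d m` over the places of the window. -/
theorem genG_succ_right {n m : ℕ} (h : n < m) :
    genG Y d (fun w => win w n (m + 1 : ℕ)) =
      genG Y d (fun w => win w n m) * (1 + Y * d m) := by
  rw [mul_add, mul_one, genG]
  conv_lhs => rw [tsum_eq_zero_add' ENNReal.summable]
  have h1 : ∀ a : ℕ, Y ^ (a + 1) * win (List.replicate (a + 1) d) n (m + 1 : ℕ) =
      Y ^ (a + 1) * win (List.replicate (a + 1) d) n m +
        Y ^ a * win (List.replicate a d) n m * (Y * d m) := by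
    intro a
    rw [List.replicate_succ', win_snoc_succ _ _ h]
    ring
  rw [tsum_congr h1, ENNReal.tsum_add, ENNReal.tsum_mul_right, ← add_assoc]
  congr 1
  rw [genG]
  conv_rhs => rw [tsum_eq_zero_add' ENNReal.summable]
  simp [win]

theorem genG_empty (n : ℕ) : genG Y d (fun w => win w n (n + 1 : ℕ)) = 1 := by
  rw [genG, tsum_eq_zero_add' ENNReal.summable]
  have h1 : ∀ a : ℕ, Y ^ (a + 1) * win (List.replicate (a + 1) d) n (n + 1 : ℕ) = 0 := fun a => by
    rw [List.replicate_succ, win_cons_empty, mul_zero]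
  rw [tsum_congr h1]
  simp [win]

theorem genG_succ_left {n : ℕ} {M : ℕ∞} (h : ((n + 1 : ℕ) : ℕ∞) < M) :
    genG Y d (fun w => win w n M) =
      (1 + Y * d (n + 1)) * genG Y d (fun w => win w (n + 1) M) := by
  rw [add_mul, one_mul, genG]
  conv_lhs => rw [tsum_eq_zero_add' ENNReal.summable]
  have h1 : ∀ a : ℕ, Y ^ (a + 1) * win (List.replicate (a + 1) d) n M =
      Y ^ (a + 1) * win (List.replicate (a + 1) d) (n + 1) M +
        (Y * d (n + 1)) * (Y ^ a * win (List.replicate a d) (n + 1) M) := by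
    intro a
    rw [List.replicate_succ, win_cons_succ _ _ h]
    ring
  rw [tsum_congr h1, ENNReal.tsum_add, ENNReal.tsum_mul_left, ← add_assoc]
  congr 1
  rw [genG]
  conv_rhs => rw [tsum_eq_zero_add' ENNReal.summable]
  simp [win]

theorem one_le_genG (n : ℕ) (M : ℕ∞) : 1 ≤ genG Y d (fun w => win w n M) := by
  refine le_trans ?_ (ENNReal.le_tsum 0)
  simp [win]

theorem genF_empty (n : ℕ) : genF Y U d e (fun w => win w n (n + 1 : ℕ)) = 0 := by
  simp only [genF, ENNReal.tsum_eq_zero]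
  intro a j
  rw [List.replicate_succ', ← List.append_assoc, win_snoc_empty, mul_zero]

/-- These words end in `e`, so only `e` can occupy the new last place; deleting it leaves a word
with a possibly empty run of `e`. -/
theorem genF_succ {n m : ℕ} (h : n < m) :
    genF Y U d e (fun w => win w n (m + 1 : ℕ)) = genF Y U d e (fun w => win w n m) +
      U * e m * (genG Y d (fun w => win w n m) + genF Y U d e (fun w => win w n m)) := by
  rw [genG_add_genF, genF, genF]
  simp only [← ENNReal.tsum_mul_left, ← ENNReal.tsum_add]
  refine tsum_congr fun a => tsum_congr fun j => ?_
  rw [List.replicate_succ', ← List.append_assoc, win_snoc_succ _ _ h]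
  ring

theorem tsum_snoc_replicate (W : List (ℕ → ℝ≥0∞)) (a f : ℕ → ℝ≥0∞) {n m : ℕ} (h : n < m) :
    ∑' b : ℕ, Y ^ b * win (W ++ a :: List.replicate b f) n (m + 1 : ℕ) =
      (∑' b : ℕ, Y ^ b * win (W ++ a :: List.replicate b f) n m) * (1 + Y * f m) +
        win W n m * a m := by
  conv_lhs => rw [tsum_eq_zero_add' ENNReal.summable]
  have h1 : ∀ b : ℕ, Y ^ (b + 1) * win (W ++ a :: List.replicate (b + 1) f) n (m + 1 : ℕ) =
      Y ^ (b + 1) * win (W ++ a :: List.replicate (b + 1) f) n m +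
        Y ^ b * win (W ++ a :: List.replicate b f) n m * (Y * f m) := by
    intro b
    rw [List.replicate_succ', show W ++ a :: (List.replicate b f ++ [f]) =
      (W ++ a :: List.replicate b f) ++ [f] by simp, win_snoc_succ _ _ h]
    ring
  rw [tsum_congr h1, ENNReal.tsum_add, ENNReal.tsum_mul_right, List.replicate_zero,
    win_snoc_succ _ _ h]
  have h2 : ∑' b : ℕ, Y ^ b * win (W ++ a :: List.replicate b f) n m =
      win (W ++ [a]) n m +
        ∑' b : ℕ, Y ^ (b + 1) * win (W ++ a :: List.replicate (b + 1) f) n m := by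
    rw [tsum_eq_zero_add' ENNReal.summable]
    simp
  rw [mul_add (∑' b : ℕ, Y ^ b * win (W ++ a :: List.replicate b f) n m), mul_one]
  nth_rewrite 2 [h2]
  simp only [pow_zero, one_mul]
  ring

/-- The new place is unused, carries a `d` of the final run, or carries `c j` itself with nothing
after it. -/
theorem genK_succ {n m : ℕ} (h : n < m) :
    genK Y U d c (fun w => win w n (m + 1 : ℕ)) =
      genK Y U d c (fun w => win w n m) * (1 + Y * d m) +
        genG Y d (fun w => win w n m) * ∑' j, U ^ j * c j m := by
  have h1 : ∀ j a : ℕ, ∑' b : ℕ, U ^ j * (Y ^ (a + b) *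
      win (List.replicate a d ++ c j :: List.replicate b d) n (m + 1 : ℕ)) =
      (∑' b : ℕ, U ^ j * (Y ^ (a + b) *
        win (List.replicate a d ++ c j :: List.replicate b d) n m)) * (1 + Y * d m) +
      (U ^ j * c j m) * (Y ^ a * win (List.replicate a d) n m) := by
    intro j a
    simp only [pow_add, mul_assoc, ENNReal.tsum_mul_left]
    rw [tsum_snoc_replicate Y _ _ _ h]
    ring
  simp only [genK, h1, ENNReal.tsum_add, ENNReal.tsum_mul_right, ENNReal.tsum_mul_left]
  rw [mul_comm (genG Y d _)]
  rfl

/-- As for `genK_succ`, with the obligatory `d` after the run of `e` in the role of the special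
letter. -/
theorem genV_succ {n m : ℕ} (h : n < m) :
    genV Y U d e (fun w => win w n (m + 1 : ℕ)) =
      genV Y U d e (fun w => win w n m) * (1 + Y * d m) +
        (genG Y d (fun w => win w n m) + genF Y U d e (fun w => win w n m)) * d m := by
  have h1 : ∀ j a : ℕ, ∑' b : ℕ, U ^ j * (Y ^ (a + b) *
      win (List.replicate a d ++ (List.replicate j e ++ d :: List.replicate b d)) n
        (m + 1 : ℕ)) =
      (∑' b : ℕ, U ^ j * (Y ^ (a + b) *
        win (List.replicate a d ++ (List.replicate j e ++ d :: List.replicate b d)) n m)) *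
          (1 + Y * d m) +
      Y ^ a * U ^ j * win (List.replicate a d ++ List.replicate j e) n m * d m := by
    intro j a
    simp only [pow_add, mul_assoc, ENNReal.tsum_mul_left, ← List.append_assoc]
    rw [tsum_snoc_replicate Y _ _ _ h]
    ring
  rw [genG_add_genF]
  simp only [genV, h1, ENNReal.tsum_add, ENNReal.tsum_mul_right]
  rw [ENNReal.tsum_comm (f := fun j a : ℕ => Y ^ a * U ^ j *
    win (List.replicate a d ++ List.replicate j e) n m)]

theorem genK_window (n : ℕ) (M : ℕ∞) :
    genK Y U d c (fun w => win w n M) = ∑' m : ℕ, if n < m ∧ (m : ℕ∞) < M then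
      genG Y d (fun w => win w n m) * (∑' j, U ^ j * c j m) * genG Y d (fun w => win w m M)
      else 0 := by
  simp only [genK, win_append_cons, mul_tsum_window, tsum_window_comm]
  refine tsum_congr fun m => if_congr Iff.rfl ?_ rfl
  rw [genG, genG, mul_comm (∑' a : ℕ, Y ^ a * win (List.replicate a d) n m), mul_assoc,
    ← ENNReal.tsum_mul_right]
  refine tsum_congr fun j => ?_
  rw [← ENNReal.tsum_mul_right, ← ENNReal.tsum_mul_left]
  refine tsum_congr fun a => ?_
  rw [← ENNReal.tsum_mul_left, ← ENNReal.tsum_mul_left]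
  exact tsum_congr fun b => by ring

theorem genT_window (n : ℕ) (M : ℕ∞) :
    genT Y U d e (fun w => win w n M) = ∑' m : ℕ, if n < m ∧ (m : ℕ∞) < M then
      genG U e (fun w => win w n m) * d m * genG Y d (fun w => win w m M) else 0 := by
  simp only [genT, win_append_cons, mul_tsum_window, tsum_window_comm]
  refine tsum_congr fun m => if_congr Iff.rfl ?_ rfl
  rw [genG, genG]
  simp only [← ENNReal.tsum_mul_right]
  refine tsum_congr fun j => ?_
  rw [← ENNReal.tsum_mul_left]
  exact tsum_congr fun b => by ring

end Window

/-! ### Generating functions of insertions and raisings -/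

section GenLinear

variable {α : Type*} (Y U : ℝ≥0∞) (d e : α) (c : ℕ → α)

theorem genK_tsum (C : ℕ → ℝ≥0∞) (S : ℕ → List α → ℝ≥0∞) :
    genK Y U d c (fun w => ∑' n, C n * S n w) = ∑' n, C n * genK Y U d c (S n) := by
  simp only [genK, ← ENNReal.tsum_mul_left]
  rw [ENNReal.tsum_comm (f := fun n j => ∑' (a : ℕ) (b : ℕ), C n * (U ^ j * (Y ^ (a + b) *
    S n (List.replicate a d ++ c j :: List.replicate b d))))]
  refine tsum_congr fun j => ?_
  rw [ENNReal.tsum_comm (f := fun n a => ∑' (b : ℕ), C n * (U ^ j * (Y ^ (a + b) *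
    S n (List.replicate a d ++ c j :: List.replicate b d))))]
  refine tsum_congr fun a => ?_
  rw [ENNReal.tsum_comm]
  exact tsum_congr fun b => tsum_congr fun n => by ring

theorem genV_tsum (C : ℕ → ℝ≥0∞) (S : ℕ → List α → ℝ≥0∞) :
    genV Y U d e (fun w => ∑' n, C n * S n w) = ∑' n, C n * genV Y U d e (S n) := by
  simp only [genV, ← ENNReal.tsum_mul_left]
  rw [ENNReal.tsum_comm (f := fun n j => ∑' (a : ℕ) (b : ℕ), C n * (U ^ j * (Y ^ (a + b) *
    S n (List.replicate a d ++ (List.replicate j e ++ d :: List.replicate b d)))))]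
  refine tsum_congr fun j => ?_
  rw [ENNReal.tsum_comm (f := fun n a => ∑' (b : ℕ), C n * (U ^ j * (Y ^ (a + b) *
    S n (List.replicate a d ++ (List.replicate j e ++ d :: List.replicate b d)))))]
  refine tsum_congr fun a => ?_
  rw [ENNReal.tsum_comm]
  exact tsum_congr fun b => tsum_congr fun n => by ring

theorem genK_map {β : Type*} (f : α → β) (P : List β → ℝ≥0∞) :
    genK Y U d c (fun w => P (w.map f)) = genK Y U (f d) (fun j => f (c j)) P := by
  simp [genK]

theorem genV_map {β : Type*} (f : α → β) (P : List β → ℝ≥0∞) :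
    genV Y U d e (fun w => P (w.map f)) = genV Y U (f d) (f e) P := by
  simp [genV]

/-- The generating function of the words `d^a e^(j+1) d d^b`. -/
noncomputable def genV' (P : List α → ℝ≥0∞) : ℝ≥0∞ :=
  ∑' j : ℕ, U ^ j * ∑' (a : ℕ) (b : ℕ), Y ^ (a + b) *
    P (List.replicate a d ++ (List.replicate (j + 1) e ++ d :: List.replicate b d))

/-- Separate the terms with `j = 0`: both families then consist of the words `d^a d d^b`. The
equation is stated with sums on both sides to avoid subtraction. -/
theorem genV_add_genK (P : List α → ℝ≥0∞) (hc : c 0 = d) :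
    genV Y U d e P + U * genK Y U d (fun j => c (j + 1)) P =
      genK Y U d c P + U * genV' Y U d e P := by
  simp only [genV, genK, genV', ENNReal.tsum_mul_left]
  rw [tsum_eq_zero_add' ENNReal.summable (f := fun j => U ^ j * ∑' (a : ℕ) (b : ℕ), Y ^ (a + b) *
    P (List.replicate a d ++ (List.replicate j e ++ d :: List.replicate b d))),
    tsum_eq_zero_add' ENNReal.summable (f := fun j => U ^ j * ∑' (a : ℕ) (b : ℕ), Y ^ (a + b) *
    P (List.replicate a d ++ c j :: List.replicate b d))]
  have h : ∀ A : ℕ → ℝ≥0∞, ∑' j, U ^ (j + 1) * A j = U * ∑' j, U ^ j * A j := fun A => by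
    rw [← ENNReal.tsum_mul_left]
    exact tsum_congr fun j => by ring
  rw [h, h]
  simp only [List.replicate_zero, List.nil_append, hc]
  ring

theorem tsum_posSum_left (F : ℕ → ℕ → ℕ → ℝ≥0∞) :
    ∑' (a : ℕ) (b : ℕ), Y ^ (a + b) * posSum (fun i k => F i k b) a =
      Y * ∑' (i : ℕ) (k : ℕ) (b : ℕ), Y ^ (i + k + b) * F i k b := by
  rw [ENNReal.tsum_comm]
  have h : ∀ b : ℕ, ∑' a : ℕ, Y ^ (a + b) * posSum (fun i k => F i k b) a =
      Y * ∑' (i : ℕ) (k : ℕ), Y ^ (i + k + b) * F i k b := by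
    intro b
    have h1 : ∀ a : ℕ, Y ^ (a + b) * posSum (fun i k => F i k b) a =
        Y ^ b * (Y ^ a * posSum (fun i k => F i k b) a) := fun a => by ring
    rw [tsum_congr h1, ENNReal.tsum_mul_left, tsum_pow_mul_posSum]
    simp only [← ENNReal.tsum_mul_left]
    exact tsum_congr fun i => tsum_congr fun k => by ring
  rw [tsum_congr h, ENNReal.tsum_mul_left, ENNReal.tsum_comm]
  congr 1
  exact tsum_congr fun i => ENNReal.tsum_comm

theorem tsum_posSum_right (F : ℕ → ℕ → ℕ → ℝ≥0∞) :
    ∑' (a : ℕ) (b : ℕ), Y ^ (a + b) * posSum (fun i k => F a i k) b =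
      Y * ∑' (a : ℕ) (i : ℕ) (k : ℕ), Y ^ (a + i + k) * F a i k := by
  rw [← ENNReal.tsum_mul_left]
  refine tsum_congr fun a => ?_
  have h1 : ∀ b : ℕ, Y ^ (a + b) * posSum (fun i k => F a i k) b =
      Y ^ a * (Y ^ b * posSum (fun i k => F a i k) b) := fun b => by ring
  rw [tsum_congr h1, ENNReal.tsum_mul_left, tsum_pow_mul_posSum]
  simp only [← ENNReal.tsum_mul_left]
  exact tsum_congr fun i => tsum_congr fun k => by ring

end GenLinear

section Blocks

variable (Y U : ℝ≥0∞) (d e : ℕ → ℝ≥0∞)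

theorem tsum_block_left (s : ℕ → ℝ≥0∞) (W : ℕ → ℕ → List (ℕ → ℝ≥0∞)) :
    ∑' (i : ℕ) (k : ℕ) (b : ℕ), Y ^ (i + k + b) * win (W i k ++ s :: List.replicate b d) 0 ⊤ =
      ∑' n : ℕ, if 0 < n then s n * ((∑' (i : ℕ) (k : ℕ), Y ^ (i + k) * win (W i k) 0 n) *
        genG Y d (fun w => win w n ⊤)) else 0 := by
  simp only [win_append_cons, mul_tsum_window, tsum_window_comm, ENat.natCast_lt_top, and_true]
  refine tsum_congr fun n => if_congr Iff.rfl ?_ rfl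
  rw [← ENNReal.tsum_mul_right, ← ENNReal.tsum_mul_left]
  refine tsum_congr fun i => ?_
  rw [← ENNReal.tsum_mul_right, ← ENNReal.tsum_mul_left]
  refine tsum_congr fun k => ?_
  rw [genG, ← ENNReal.tsum_mul_left, ← ENNReal.tsum_mul_left]
  exact tsum_congr fun b => by ring

theorem tsum_block_right (s : ℕ → ℝ≥0∞) (W : ℕ → ℕ → List (ℕ → ℝ≥0∞)) :
    ∑' (a : ℕ) (i : ℕ) (k : ℕ), Y ^ (a + i + k) * win (List.replicate a d ++ s :: W i k) 0 ⊤ =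
      ∑' n : ℕ, if 0 < n then s n * (genG Y d (fun w => win w 0 n) *
        ∑' (i : ℕ) (k : ℕ), Y ^ (i + k) * win (W i k) n ⊤) else 0 := by
  simp only [win_append_cons, mul_tsum_window, tsum_window_comm, ENat.natCast_lt_top, and_true]
  refine tsum_congr fun n => if_congr Iff.rfl ?_ rfl
  rw [genG, ← ENNReal.tsum_mul_right, ← ENNReal.tsum_mul_left]
  refine tsum_congr fun a => ?_
  rw [← ENNReal.tsum_mul_left, ← ENNReal.tsum_mul_left]
  refine tsum_congr fun i => ?_
  rw [← ENNReal.tsum_mul_left, ← ENNReal.tsum_mul_left]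
  exact tsum_congr fun k => by ring

theorem tsum_pow_mul_places (s : ℕ → ℝ≥0∞) (X : ℕ → ℕ → ℝ≥0∞) (V : ℝ≥0∞) :
    ∑' j : ℕ, U ^ j * (V * ∑' n : ℕ, if 0 < n then s n * X j n else 0) =
      ∑' n : ℕ, if 0 < n then s n * (V * ∑' j : ℕ, U ^ j * X j n) else 0 := by
  simp only [mul_tsum_window, tsum_window_comm]
  refine tsum_congr fun n => if_congr Iff.rfl ?_ rfl
  simp only [← ENNReal.tsum_mul_left]
  exact tsum_congr fun j => by ring

/-- The raised letter is a `d` to the left of `s`, the letter `s` itself, or a `d` to its right; the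
sum is then organised by the place `n` of `s`. -/
theorem raise_gen (s : ℕ → ℝ≥0∞) (g : ℕ → (ℕ → ℝ≥0∞) → ℕ → ℝ≥0∞) (h : ℕ → ℕ → ℝ≥0∞)
    (hg : ∀ j n, g j s n = h j n * s n) :
    ∑' j : ℕ, U ^ j * ∑' (a : ℕ) (b : ℕ), Y ^ (a + b) *
        raiseSum (fun w => win w 0 ⊤) (g j) (List.replicate a d ++ s :: List.replicate b d) =
      ∑' n : ℕ, if 0 < n then s n *
        (Y * (genK Y U d (fun j => g j d) (fun w => win w 0 n) * genG Y d (fun w => win w n ⊤)) +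
        (∑' j, U ^ j * h j n) *
          (genG Y d (fun w => win w 0 n) * genG Y d (fun w => win w n ⊤)) +
        Y * (genG Y d (fun w => win w 0 n) *
          genK Y U d (fun j => g j d) (fun w => win w n ⊤))) else 0 := by
  have h1 : ∀ j a b : ℕ,
      raiseSum (fun w => win w 0 ⊤) (g j) (List.replicate a d ++ s :: List.replicate b d) =
      posSum (fun i k => win ((List.replicate i d ++ g j d :: List.replicate k d) ++
        s :: List.replicate b d) 0 ⊤) a +
      win (List.replicate a d ++ g j s :: List.replicate b d) 0 ⊤ +
      posSum (fun i k => win (List.replicate a d ++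
        s :: (List.replicate i d ++ g j d :: List.replicate k d)) 0 ⊤) b := by
    intro j a b
    have h2 := raiseSum_replicate_append (fun w => win (List.replicate a d ++ s :: w) 0 ⊤)
      (g j) b d []
    simp only [List.append_nil, raiseSum, add_zero] at h2
    rw [raiseSum_replicate_append, raiseSum, h2, add_assoc]
    simp
  have h2 : ∀ j : ℕ, ∑' (a : ℕ) (b : ℕ), Y ^ (a + b) *
      win (List.replicate a d ++ g j s :: List.replicate b d) 0 ⊤ =
      ∑' n : ℕ, if 0 < n then s n * (h j n *
        (genG Y d (fun w => win w 0 n) * genG Y d (fun w => win w n ⊤))) else 0 := by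
    intro j
    simp only [win_append_cons, mul_tsum_window, tsum_window_comm, ENat.natCast_lt_top, and_true]
    refine tsum_congr fun n => if_congr Iff.rfl ?_ rfl
    rw [genG, ← ENNReal.tsum_mul_right, ← ENNReal.tsum_mul_left, ← ENNReal.tsum_mul_left]
    refine tsum_congr fun a => ?_
    rw [genG, ← ENNReal.tsum_mul_left, ← ENNReal.tsum_mul_left, ← ENNReal.tsum_mul_left]
    exact tsum_congr fun b => by rw [hg]; ring
  have h3 := tsum_pow_mul_places U s (fun j n => h j n *
    (genG Y d (fun w => win w 0 n) * genG Y d (fun w => win w n ⊤))) 1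
  simp only [one_mul] at h3
  simp only [h1, mul_add, ENNReal.tsum_add, tsum_posSum_left Y (fun i k b =>
    win ((List.replicate i d ++ g _ d :: List.replicate k d) ++ s :: List.replicate b d) 0 ⊤),
    tsum_posSum_right Y (fun a i k => win (List.replicate a d ++
        s :: (List.replicate i d ++ g _ d :: List.replicate k d)) 0 ⊤), h2,
    tsum_block_left Y d s (fun i k => List.replicate i d ++ g _ d :: List.replicate k d),
    tsum_block_right Y d s (fun i k => List.replicate i d ++ g _ d :: List.replicate k d)]
  rw [tsum_pow_mul_places, tsum_pow_mul_places, h3, ← ENNReal.tsum_add, ← ENNReal.tsum_add]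
  refine tsum_congr fun n => ?_
  split_ifs
  · simp only [genK, ENNReal.tsum_mul_left]
    have h4 : ∀ (A : ℕ → ℝ≥0∞) (B : ℝ≥0∞), ∑' j, U ^ j * (A j * B) = (∑' j, U ^ j * A j) * B :=
      fun A B => by
        rw [← ENNReal.tsum_mul_right]
        exact tsum_congr fun j => by ring
    have h5 : ∀ (A : ℕ → ℝ≥0∞) (B : ℝ≥0∞), ∑' j, U ^ j * (B * A j) = B * ∑' j, U ^ j * A j :=
      fun A B => by
        rw [← ENNReal.tsum_mul_left]
        exact tsum_congr fun j => by ring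
    rw [h4, h4, h5]
  · simp

theorem tsum_two_places (a b : ℕ → ℝ≥0∞) :
    ∑' j : ℕ, U ^ j * ∑' (i : ℕ) (k : ℕ), Y ^ (i + k) * win (List.replicate i d ++
        a :: (List.replicate j e ++ b :: List.replicate k d)) 0 ⊤ =
      ∑' m : ℕ, if 0 < m then ∑' M : ℕ, if m < M then
        genG Y d (fun w => win w 0 m) * a m * (genG U e (fun w => win w m M) *
          b M * genG Y d (fun w => win w M ⊤)) else 0 else 0 := by
  simp only [win_append_cons, mul_tsum_window, tsum_window_comm, ENat.natCast_lt_top, and_true]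
  refine tsum_congr fun m => if_congr Iff.rfl ?_ rfl
  refine tsum_congr fun M => if_congr Iff.rfl ?_ rfl
  rw [genG, genG, mul_assoc (∑' j : ℕ, U ^ j * win (List.replicate j e) m M),
    mul_left_comm, ← ENNReal.tsum_mul_right]
  refine tsum_congr fun j => ?_
  rw [mul_assoc]
  congr 1
  simp only [← ENNReal.tsum_mul_right, ← ENNReal.tsum_mul_left]
  refine tsum_congr fun i => ?_
  rw [genG]
  simp only [← ENNReal.tsum_mul_left]
  exact tsum_congr fun k => by ring

end Blocks

/-! ### The four families of Ohno sums -/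

section Families

variable (x : ℝ) (Y U : ℝ≥0∞) (s : ℕ+)

/-- The index `({2}^i, c, {2}^j)`. -/
def twoWord (c : ℕ+) (i j : ℕ) : Index := List.replicate i 2 ++ c :: List.replicate j 2

/-- The dual of the index `({2}^i, τ + 2, {2}^j)`. -/
def twoWordDual (τ i j : ℕ) : Index :=
  List.replicate j 2 ++ (List.replicate τ 1 ++ 2 :: List.replicate i 2)

theorem isAdmissible_append_cons {U V : Index} {c : ℕ+} (hc : 2 ≤ c)
    (hV : ∀ v ∈ V, 2 ≤ v) : IsAdmissible (U ++ c :: V) := by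
  refine ⟨by simp, ?_⟩
  rw [List.getLast_append_of_ne_nil _ (by simp)]
  have h : (c :: V).getLast (by simp) ∈ c :: V := List.getLast_mem _
  have h2 : 2 ≤ (c :: V).getLast (by simp) := by
    rcases List.mem_cons.1 h with h | h
    · rw [h]; exact hc
    · exact hV _ h
  exact lt_of_lt_of_le (by decide) h2

theorem isAdmissible_twoWord {c : ℕ+} (hc : 2 ≤ c) (i j : ℕ) : IsAdmissible (twoWord c i j) :=
  isAdmissible_append_cons hc fun _ hv => (List.eq_of_mem_replicate hv).ge

/-- In terms of blocks a component `2` is the self-dual pair `(1, 1)`, while `τ + 2` is `(1, τ +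
1)`, whose swap `(τ + 1, 1)` spells `{1}^τ, 2`. -/
theorem dualIndex_twoWord (τ i j : ℕ) :
    dualIndex (twoWord (τ + 1).succPNat i j) = twoWordDual τ i j := by
  have h1 : ∀ n : ℕ, ofBlocks (List.replicate n (1, 1)) = List.replicate n 2 := by
    intro n
    induction n with
    | zero => rfl
    | succ n ih =>
      rw [List.replicate_succ, List.replicate_succ, ← ih]
      rfl
  have h2 : ∀ L L' : List (ℕ+ × ℕ+), ofBlocks (L ++ L') = ofBlocks L ++ ofBlocks L' := by
    simp [ofBlocks]
  have h3 : twoWord (τ + 1).succPNat i j = ofBlocks (List.replicate i (1, 1) ++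
      ([(1, τ.succPNat)] ++ List.replicate j (1, 1))) := by
    rw [h2, h2, h1, h1]
    rfl
  rw [h3, dualIndex_ofBlocks]
  simp only [List.map_append, List.map_replicate, Prod.swap, List.reverse_append,
    List.reverse_replicate, h2, h1, List.map_cons, List.map_nil, List.reverse_cons,
    List.reverse_nil, List.nil_append, twoWordDual]
  simp [ofBlocks]
  rfl

/-- The generating function of a family of numbers attached to two natural numbers. -/
noncomputable def gen2 (α : ℕ → ℕ → ℝ≥0∞) : ℝ≥0∞ := ∑' τ : ℕ, U ^ τ * ∑' l : ℕ, Y ^ l * α τ l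

theorem gen2_antidiagonal (φ : ℕ → ℕ → ℕ → ℝ≥0∞) :
    gen2 Y U (fun τ l => ∑ p ∈ Finset.HasAntidiagonal.antidiagonal l, φ τ p.1 p.2) =
      ∑' τ : ℕ, U ^ τ * ∑' (a : ℕ) (b : ℕ), Y ^ (a + b) * φ τ a b :=
  tsum_congr fun τ => by rw [tsum_pow_mul_antidiagonal Y (φ τ)]

/-- Insertions into the shuffle product of `τ + 2` and `{2}^l`. -/
noncomputable def insA (τ l : ℕ) : ℝ≥0∞ := ∑ p ∈ Finset.HasAntidiagonal.antidiagonal l,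
  insSum (zeta x) s (twoWord (τ + 1).succPNat p.1 p.2)

/-- Insertions into the dual of the shuffle product of `τ + 2` and `{2}^l`. -/
noncomputable def insB (τ l : ℕ) : ℝ≥0∞ := ∑ p ∈ Finset.HasAntidiagonal.antidiagonal l,
  insSum (zeta x) s (twoWordDual τ p.1 p.2)

/-- Raisings by `τ + 1` of the components of the shuffle product of `s + 1` and `{2}^l`. -/
noncomputable def raiC (τ l : ℕ) : ℝ≥0∞ := ∑ p ∈ Finset.HasAntidiagonal.antidiagonal l,
  raiseSum (zeta x) (· + τ.succPNat) (twoWord (s + 1) p.1 p.2)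

/-- Raisings by `τ + 1` of the components of the dual of the shuffle product of `s + 1` and
`{2}^l`. -/
noncomputable def raiD (τ l : ℕ) : ℝ≥0∞ := ∑ p ∈ Finset.HasAntidiagonal.antidiagonal l,
  raiseSum (zeta x) (· + τ.succPNat) (dualIndex (twoWord (s + 1) p.1 p.2))

/-- The letters `τ + 2`. -/
noncomputable def wtT (τ : ℕ) : ℕ → ℝ≥0∞ := wt x (τ + 1).succPNat

theorem insA_gen :
    gen2 Y U (insA x s) = ∑' n : ℕ, if 0 < n then wt x s n *
      (genG Y (wt x 2) (fun w => win w 0 n) *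
          genK Y U (wt x 2) (wtT x) (fun w => win w n ⊤) +
        genK Y U (wt x 2) (wtT x) (fun w => win w 0 n) *
          genG Y (wt x 2) (fun w => win w n ⊤)) else 0 := by
  have h1 : gen2 Y U (insA x s) =
      genK Y U 2 (fun τ : ℕ => (τ + 1).succPNat) (insSum (zeta x) s) := by
    refine (gen2_antidiagonal Y U fun τ i k =>
      insSum (zeta x) s (twoWord (τ + 1).succPNat i k)).trans ?_
    simp only [genK, ENNReal.tsum_mul_left]
    rfl
  have h2 : insSum (zeta x) s = fun k => ∑' n : ℕ, (if 0 < n then wt x s n else 0) *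
      splitSum (fun U => win U 0 n) (fun V => win V n ⊤) (k.map (wt x)) := by
    funext k
    have h3 := insSum_listMap (wt x) (fun w => win w 0 ⊤) s k
    rw [insSum_win] at h3
    refine h3.trans (tsum_congr fun n => ?_)
    split_ifs <;> simp
  rw [h1, h2, genK_tsum Y U 2 _ _ (fun n k => splitSum (fun U => win U 0 n)
    (fun V => win V n ⊤) (k.map (wt x)))]
  refine tsum_congr fun n => ?_
  rw [genK_map Y U 2 _ (wt x) (splitSum (fun U => win U 0 n) (fun V => win V n ⊤)),
    genK_splitSum]
  split_ifs
  · rfl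
  · simp

theorem insB_gen :
    gen2 Y U (insB x s) = ∑' n : ℕ, if 0 < n then wt x s n *
      (genG Y (wt x 2) (fun w => win w 0 n) *
          genV Y U (wt x 2) (wt x 1) (fun w => win w n ⊤) +
        genF Y U (wt x 2) (wt x 1) (fun w => win w 0 n) *
          genT Y U (wt x 2) (wt x 1) (fun w => win w n ⊤) +
        genV Y U (wt x 2) (wt x 1) (fun w => win w 0 n) *
          genG Y (wt x 2) (fun w => win w n ⊤)) else 0 := by
  have h1 : gen2 Y U (insB x s) = genV Y U 2 1 (insSum (zeta x) s) := by
    refine (gen2_antidiagonal Y U fun τ i k => insSum (zeta x) s (twoWordDual τ i k)).trans ?_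
    simp only [genV, ENNReal.tsum_mul_left]
    refine tsum_congr fun j => ?_
    -- Duality exchanges the two runs of `2`, which does not matter after summation over both
    -- lengths.
    rw [ENNReal.tsum_comm]
    congr 1
    exact tsum_congr fun a => tsum_congr fun b => by rw [add_comm]; rfl
  have h2 : insSum (zeta x) s = fun k => ∑' n : ℕ, (if 0 < n then wt x s n else 0) *
      splitSum (fun U => win U 0 n) (fun V => win V n ⊤) (k.map (wt x)) := by
    funext k
    have h3 := insSum_listMap (wt x) (fun w => win w 0 ⊤) s k
    rw [insSum_win] at h3
    refine h3.trans (tsum_congr fun n => ?_)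
    split_ifs <;> simp
  rw [h1, h2, genV_tsum Y U 2 1 _ (fun n k => splitSum (fun U => win U 0 n)
    (fun V => win V n ⊤) (k.map (wt x)))]
  refine tsum_congr fun n => ?_
  rw [genV_map Y U 2 1 (wt x) (splitSum (fun U => win U 0 n) (fun V => win V n ⊤)),
    genV_splitSum]
  split_ifs
  · rfl
  · simp

theorem raiC_gen :
    gen2 Y U (raiC x s) = ∑' n : ℕ, if 0 < n then wt x (s + 1) n *
      (Y * (genK Y U (wt x 2) (fun j => wtT x (j + 1)) (fun w => win w 0 n) *
          genG Y (wt x 2) (fun w => win w n ⊤)) +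
        (∑' j : ℕ, U ^ j * (n : ℝ≥0∞)⁻¹ ^ (j + 1)) * (genG Y (wt x 2) (fun w => win w 0 n) *
          genG Y (wt x 2) (fun w => win w n ⊤)) +
        Y * (genG Y (wt x 2) (fun w => win w 0 n) *
          genK Y U (wt x 2) (fun j => wtT x (j + 1)) (fun w => win w n ⊤))) else 0 := by
  have h1 := raise_gen Y U (wt x 2) (wt x (s + 1))
    (fun j a n => (n : ℝ≥0∞)⁻¹ ^ (j + 1) * a n) (fun j n => (n : ℝ≥0∞)⁻¹ ^ (j + 1))
    (fun j n => rfl)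
  have h2 : (fun j : ℕ => fun n : ℕ => (n : ℝ≥0∞)⁻¹ ^ (j + 1) * wt x 2 n) =
      fun j => wtT x (j + 1) := by
    funext j
    have := wt_add x 2 j.succPNat
    rw [Nat.succPNat_coe] at this
    rw [← this, wtT]
    congr 1
    apply PNat.eq
    simp only [PNat.add_coe, Nat.succPNat_coe, Nat.succ_eq_add_one]
    change 2 + (j + 1) = _
    omega
  rw [h2] at h1
  rw [← h1]
  refine (gen2_antidiagonal Y U fun τ i k =>
    raiseSum (zeta x) (· + τ.succPNat) (twoWord (s + 1) i k)).trans ?_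
  refine tsum_congr fun j => ?_
  congr 1
  refine tsum_congr fun a => tsum_congr fun b => ?_
  congr 1
  have h3 := raiseSum_listMap (wt x) (fun w => win w 0 ⊤) (· + j.succPNat)
    (fun a n => (n : ℝ≥0∞)⁻¹ ^ (j + 1) * a n) (fun c => wt_add x c j.succPNat)
    (twoWord (s + 1) a b)
  refine h3.trans ?_
  simp [twoWord]

/-- By `raiseSum_dualIndex` this counts the ways of splitting one component of `({2}^a, s + 1,
{2}^b)`. A split `2` becomes `{1}^(τ+1), 2`, which gives `genV'` on either side of the place of `s +
1`; splitting `s + 1` itself leaves two places, with a run of ones between them. -/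
theorem raiD_gen (hx0 : 0 ≤ x) (hx : x < 1) :
    gen2 Y U (raiD x s) = (∑' n : ℕ, if 0 < n then wt x (s + 1) n *
      (Y * (genV' Y U (wt x 2) (wt x 1) (fun w => win w 0 n) *
          genG Y (wt x 2) (fun w => win w n ⊤)) +
        Y * (genG Y (wt x 2) (fun w => win w 0 n) *
          genV' Y U (wt x 2) (wt x 1) (fun w => win w n ⊤))) else 0) +
      ∑ p ∈ Finset.HasAntidiagonal.antidiagonal ((s : ℕ) - 1), ∑' m : ℕ, if 0 < m then
        ∑' M : ℕ, if m < M then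
          genG Y (wt x 2) (fun w => win w 0 m) * wt x p.1.succPNat m *
            (genG U (wt x 1) (fun w => win w m M) * wt x (p.2 + 1).succPNat M *
              genG Y (wt x 2) (fun w => win w M ⊤)) else 0 else 0 := by
  have hs : ((s + 1 : ℕ+) : ℕ) - 1 = ((s : ℕ) - 1) + 1 := by
    have := s.pos
    rw [PNat.add_coe, PNat.one_coe]
    omega
  have h1 : ∀ τ a b : ℕ, raiseSum (zeta x) (· + τ.succPNat) (dualIndex (twoWord (s + 1) a b)) =
      posSum (fun i k => win ((List.replicate i (wt x 2) ++ (List.replicate (τ + 1) (wt x 1) ++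
        wt x 2 :: List.replicate k (wt x 2))) ++ wt x (s + 1) :: List.replicate b (wt x 2)) 0 ⊤) a +
      (∑ p ∈ Finset.HasAntidiagonal.antidiagonal ((s : ℕ) - 1),
        win (List.replicate a (wt x 2) ++ wt x p.1.succPNat :: (List.replicate τ (wt x 1) ++
          wt x (p.2 + 1).succPNat :: List.replicate b (wt x 2))) 0 ⊤) +
      posSum (fun i k => win (List.replicate a (wt x 2) ++ wt x (s + 1) ::
        (List.replicate i (wt x 2) ++ (List.replicate (τ + 1) (wt x 1) ++
        wt x 2 :: List.replicate k (wt x 2)))) 0 ⊤) b := by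
    intro τ a b
    have hadm : IsAdmissible (twoWord (s + 1) a b) := isAdmissible_twoWord
      (by rw [← PNat.coe_le_coe, PNat.add_coe]; have := s.pos; simp; omega) a b
    have h2 := expandSum_replicate_append
      (fun w => zeta x (List.replicate a 2 ++ (s + 1) :: w)) τ b []
    simp only [List.append_nil, expandSum, add_zero] at h2
    rw [raiseSum_dualIndex hx0 hx hadm, twoWord, expandSum_replicate_append, expandSum, h2, hs,
      add_assoc]
    simp [zeta]
  refine (gen2_antidiagonal Y U fun τ i k =>
    raiseSum (zeta x) (· + τ.succPNat) (dualIndex (twoWord (s + 1) i k))).trans ?_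
  have hL := fun τ : ℕ => tsum_posSum_left Y (fun i k b =>
    win ((List.replicate i (wt x 2) ++ (List.replicate (τ + 1) (wt x 1) ++
      wt x 2 :: List.replicate k (wt x 2))) ++ wt x (s + 1) :: List.replicate b (wt x 2)) 0 ⊤)
  have hR := fun τ : ℕ => tsum_posSum_right Y (fun a i k => win (List.replicate a (wt x 2) ++
    wt x (s + 1) :: (List.replicate i (wt x 2) ++ (List.replicate (τ + 1) (wt x 1) ++
      wt x 2 :: List.replicate k (wt x 2)))) 0 ⊤)
  have hL' := fun τ : ℕ => tsum_block_left Y (wt x 2) (wt x (s + 1)) (fun i k =>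
    List.replicate i (wt x 2) ++ (List.replicate (τ + 1) (wt x 1) ++
      wt x 2 :: List.replicate k (wt x 2)))
  have hR' := fun τ : ℕ => tsum_block_right Y (wt x 2) (wt x (s + 1)) (fun i k =>
    List.replicate i (wt x 2) ++ (List.replicate (τ + 1) (wt x 1) ++
      wt x 2 :: List.replicate k (wt x 2)))
  simp only [h1, mul_add, ENNReal.tsum_add, hL, hR, hL', hR']
  rw [tsum_pow_mul_places, tsum_pow_mul_places, add_right_comm, ← ENNReal.tsum_add]
  congr 1
  · refine tsum_congr fun n => ?_
    split_ifs
    · have h4 : ∀ (A : ℕ → ℝ≥0∞) (B : ℝ≥0∞),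
          ∑' j, U ^ j * (A j * B) = (∑' j, U ^ j * A j) * B := fun A B => by
        rw [← ENNReal.tsum_mul_right]
        exact tsum_congr fun j => by ring
      have h5 : ∀ (A : ℕ → ℝ≥0∞) (B : ℝ≥0∞),
          ∑' j, U ^ j * (B * A j) = B * ∑' j, U ^ j * A j := fun A B => by
        rw [← ENNReal.tsum_mul_left]
        exact tsum_congr fun j => by ring
      rw [h4, h5, genV', genV']
    · simp
  · simp only [Finset.mul_sum]
    simp only [Summable.tsum_finsetSum fun _ _ => ENNReal.summable, Finset.mul_sum]
    refine Finset.sum_congr rfl fun p _ => ?_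
    exact tsum_two_places Y U (wt x 2) (wt x 1) _ _

end Families

/-! ### Finiteness -/

theorem win_mono (w : List (ℕ → ℝ≥0∞)) {n n' : ℕ} {M M' : ℕ∞} (hn : n' ≤ n) (hM : M ≤ M') :
    win w n M ≤ win w n' M' := by
  induction w generalizing n n' with
  | nil => simp [win]
  | cons a w ih =>
    rw [win, win]
    refine ENNReal.tsum_le_tsum fun m => ?_
    by_cases h : n < m ∧ (m : ℕ∞) < M
    · rw [if_pos h, if_pos ⟨hn.trans_lt h.1, h.2.trans_le hM⟩]
      gcongr
      exact ih le_rfl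
    · rw [if_neg h]
      exact zero_le

theorem win_replicate_le (d : ℕ → ℝ≥0∞) (a n : ℕ) (M : ℕ∞) :
    win (List.replicate a d) n M ≤ (∑' m, d m) ^ a := by
  induction a generalizing n with
  | zero => simp [win]
  | succ a ih =>
    rw [List.replicate_succ, win, pow_succ', ← ENNReal.tsum_mul_right]
    refine ENNReal.tsum_le_tsum fun m => ?_
    split_ifs
    · gcongr
      exact ih m
    · exact zero_le

/-- Dropping the order conditions bounds the generating function by a geometric series. -/
theorem genG_lt_top {Y : ℝ≥0∞} {d : ℕ → ℝ≥0∞} (h : Y * ∑' m, d m < 1) (n : ℕ) (M : ℕ∞) :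
    genG Y d (fun w => win w n M) < ⊤ := by
  calc genG Y d (fun w => win w n M) ≤ ∑' a : ℕ, (Y * ∑' m, d m) ^ a := by
        refine ENNReal.tsum_le_tsum fun a => ?_
        rw [mul_pow]
        gcongr
        exact win_replicate_le d a n M
    _ < ⊤ := by
        rw [ENNReal.tsum_geometric, ENNReal.inv_lt_top]
        exact tsub_pos_of_lt h

theorem splitSum_mono {α : Type*} {P P' Q : List α → ℝ≥0∞} (h : ∀ w, P w ≤ P' w) (k : List α) :
    splitSum P Q k ≤ splitSum P' Q k := by
  induction k generalizing P P' with
  | nil => exact mul_le_mul_left (h []) _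
  | cons a k ih =>
    rw [splitSum, splitSum]
    exact add_le_add (mul_le_mul_left (h []) _) (ih fun w => h (a :: w))

theorem splitSum_win_le (k : List (ℕ → ℝ≥0∞)) (n : ℕ) :
    splitSum (fun U => win U 0 n) (fun V => win V n ⊤) k ≤ win k 0 ⊤ := by
  rw [← win_cut k (Nat.zero_le n)]
  exact splitSum_mono (fun w => win_mono w le_rfl (by exact_mod_cast n.le_succ)) k

section Mono

variable {α : Type*} (Y U : ℝ≥0∞) (d e : α) (c : ℕ → α) {P Q : List α → ℝ≥0∞}

theorem genG_mono (h : ∀ w, P w ≤ Q w) : genG Y d P ≤ genG Y d Q :=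
  ENNReal.tsum_le_tsum fun _ => mul_le_mul_right (h _) _

theorem genK_mono (h : ∀ w, P w ≤ Q w) : genK Y U d c P ≤ genK Y U d c Q :=
  ENNReal.tsum_le_tsum fun _ => ENNReal.tsum_le_tsum fun _ => ENNReal.tsum_le_tsum fun _ =>
    mul_le_mul_right (mul_le_mul_right (h _) _) _

theorem genV_mono (h : ∀ w, P w ≤ Q w) : genV Y U d e P ≤ genV Y U d e Q :=
  ENNReal.tsum_le_tsum fun _ => ENNReal.tsum_le_tsum fun _ => ENNReal.tsum_le_tsum fun _ =>
    mul_le_mul_right (mul_le_mul_right (h _) _) _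

end Mono

/-! ### Letters -/

theorem sub_pos_of_le_half {x : ℝ} (hx : x ≤ 1 / 2) {m : ℕ} (hm : 1 ≤ m) : 0 < (m : ℝ) - x := by
  have h1 : (1 : ℝ) ≤ m := by exact_mod_cast hm
  linarith

theorem inv_natCast_eq_ofReal {m : ℕ} (hm : 1 ≤ m) :
    (m : ℝ≥0∞)⁻¹ = ENNReal.ofReal (1 / (m : ℝ)) := by
  have : (0 : ℝ) < m := by exact_mod_cast hm
  rw [one_div, ENNReal.ofReal_inv_of_pos this, ENNReal.ofReal_natCast]

theorem wt_eq_ofReal (x : ℝ) (c : ℕ+) {m : ℕ} (hm : 1 ≤ m) :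
    wt x c m = ENNReal.ofReal ((1 / (m : ℝ)) ^ ((c : ℕ) - 1) * (1 / ((m : ℝ) - x))) := by
  rw [wt, inv_natCast_eq_ofReal hm, ← ENNReal.ofReal_pow (by positivity),
    ENNReal.ofReal_mul (by positivity)]

theorem wt_zero {x : ℝ} (hx : 0 ≤ x) (c : ℕ+) : wt x c 0 = 0 := by
  rw [wt, ENNReal.ofReal_of_nonpos, mul_zero]
  rw [Nat.cast_zero, zero_sub]
  exact one_div_nonpos.2 (neg_nonpos.2 hx)

theorem wt_two (x : ℝ) {m : ℕ} (hm : 1 ≤ m) :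
    wt x 2 m = ENNReal.ofReal (1 / ((m : ℝ) * (m - x))) := by
  rw [wt_eq_ofReal x 2 hm, show ((2 : ℕ+) : ℕ) - 1 = 1 from rfl, pow_one, div_mul_div_comm,
    one_mul]

theorem wt_one (x : ℝ) {m : ℕ} (hm : 1 ≤ m) : wt x 1 m = ENNReal.ofReal (1 / ((m : ℝ) - x)) := by
  rw [wt_eq_ofReal x 1 hm, show ((1 : ℕ+) : ℕ) - 1 = 0 from rfl, pow_zero, one_mul]

theorem natCast_mul_wt_succ (x : ℝ) (c : ℕ+) {m : ℕ} (hm : 1 ≤ m) :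
    (m : ℝ≥0∞) * wt x (c + 1) m = wt x c m := by
  have h1 : (m : ℝ≥0∞) ≠ 0 := by exact_mod_cast (by omega : m ≠ 0)
  rw [wt_add]
  simp only [PNat.one_coe, pow_one]
  rw [← mul_assoc, ENNReal.mul_inv_cancel h1 (ENNReal.natCast_ne_top m), one_mul]

theorem tsum_wt_lt_top {x : ℝ} (hx0 : 0 ≤ x) (hx : x ≤ 1 / 2) {c : ℕ+} (hc : 2 ≤ c) :
    ∑' m, wt x c m < ⊤ := by
  have hs : Summable fun m : ℕ => 2 * (1 / (m : ℝ) ^ 2) :=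
    (Real.summable_one_div_nat_pow.2 (by norm_num)).mul_left 2
  refine lt_of_le_of_lt ?_ hs.tsum_ofReal_lt_top
  refine ENNReal.tsum_le_tsum fun m => ?_
  rcases Nat.eq_zero_or_pos m with rfl | hm
  · rw [wt_zero hx0]
    exact zero_le
  rw [wt_eq_ofReal x c hm]
  refine ENNReal.ofReal_le_ofReal ?_
  have h1 := sub_pos_of_le_half hx hm
  have h2 : (1 : ℝ) ≤ m := by exact_mod_cast hm
  have h3 : (2 : ℕ) ≤ c := by exact_mod_cast hc
  have h4 : (1 / (m : ℝ)) ^ ((c : ℕ) - 1) ≤ (1 / (m : ℝ)) ^ 1 :=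
    pow_le_pow_of_le_one (by positivity) ((div_le_one (by positivity)).2 h2) (by omega)
  have h5 : 1 / ((m : ℝ) - x) ≤ 2 * (1 / m) := by
    rw [mul_one_div, div_le_div_iff₀ h1 (by positivity)]
    linarith
  calc (1 / (m : ℝ)) ^ ((c : ℕ) - 1) * (1 / ((m : ℝ) - x))
      ≤ (1 / (m : ℝ)) ^ 1 * (2 * (1 / m)) := mul_le_mul h4 h5 (by positivity) (by positivity)
    _ = _ := by rw [pow_one]; field_simp

theorem tsum_pow_mul_inv_pow {u : ℝ} (hu0 : 0 ≤ u) (hu : u < 1) {m : ℕ} (hm : 1 ≤ m) :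
    ∑' j : ℕ, ENNReal.ofReal u ^ j * (m : ℝ≥0∞)⁻¹ ^ (j + 1) =
      ENNReal.ofReal (1 / ((m : ℝ) - u)) := by
  have h1 : (1 : ℝ) ≤ m := by exact_mod_cast hm
  have h2 : u / m < 1 := by
    rw [div_lt_one (by linarith)]
    linarith
  have h3 := (hasSum_geometric_of_lt_one (by positivity) h2).mul_left (1 / (m : ℝ))
  have h4 : 1 / (m : ℝ) * (1 - u / m)⁻¹ = 1 / ((m : ℝ) - u) := by
    have : (m : ℝ) - u ≠ 0 := by linarith
    have h5 : (1 : ℝ) - u / m ≠ 0 := by linarith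
    field_simp
  rw [← h4, ← h3.tsum_eq, ENNReal.ofReal_tsum_of_nonneg (fun j => by positivity) h3.summable]
  refine tsum_congr fun j => ?_
  rw [inv_natCast_eq_ofReal hm, ← ENNReal.ofReal_pow hu0, ← ENNReal.ofReal_pow (by positivity),
    ← ENNReal.ofReal_mul (by positivity)]
  congr 1
  rw [pow_succ, one_div_pow, div_pow]
  field_simp

theorem tsum_pow_mul_wtT {u : ℝ} (x : ℝ) (hu0 : 0 ≤ u) (hu : u < 1) {m : ℕ} (hm : 1 ≤ m) :
    ∑' j : ℕ, ENNReal.ofReal u ^ j * wtT x j m =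
      ENNReal.ofReal (1 / (((m : ℝ) - u) * (m - x))) := by
  have h1 : (1 : ℝ) ≤ m := by exact_mod_cast hm
  have h2 : ∀ j, wtT x j m = (m : ℝ≥0∞)⁻¹ ^ (j + 1) * ENNReal.ofReal (1 / ((m : ℝ) - x)) := by
    intro j
    rw [wtT, wt, Nat.succPNat_coe]
    rfl
  simp only [h2, ← mul_assoc]
  rw [ENNReal.tsum_mul_right, tsum_pow_mul_inv_pow hu0 hu hm, ← ENNReal.ofReal_mul
    (one_div_nonneg.2 (by linarith)), div_mul_div_comm, one_mul]

/-! ### The generating functions as real numbers -/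

/-- The ranges of the parameters in which the generating functions converge. -/
structure Small (x y u : ℝ) : Prop where
  x_nonneg : 0 ≤ x
  x_le : x ≤ 1 / 2
  y_nonneg : 0 ≤ y
  u_pos : 0 < u
  u_le : u ≤ 1 / 8
  y_mul_lt : ENNReal.ofReal y * ∑' m, wt x 2 m < 1

section Data

variable (x y u : ℝ)

/-- The words `2^a` in the window from `n` to `M`. -/
noncomputable def winG (n : ℕ) (M : ℕ∞) : ℝ≥0∞ :=
  genG (ENNReal.ofReal y) (wt x 2) fun w => win w n M

/-- The words `1^j` in the window from `n` to `M`. -/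
noncomputable def winQ (n : ℕ) (M : ℕ∞) : ℝ≥0∞ :=
  genG (ENNReal.ofReal u) (wt x 1) fun w => win w n M

/-- The words `2^a 1^j`, `j > 0`, in the window from `n` to `M`. -/
noncomputable def winF (n : ℕ) (M : ℕ∞) : ℝ≥0∞ :=
  genF (ENNReal.ofReal y) (ENNReal.ofReal u) (wt x 2) (wt x 1) fun w => win w n M

/-- The words `1^j 2 2^b` in the window from `n` to `M`. -/
noncomputable def winT (n : ℕ) (M : ℕ∞) : ℝ≥0∞ :=
  genT (ENNReal.ofReal y) (ENNReal.ofReal u) (wt x 2) (wt x 1) fun w => win w n M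

/-- The words `2^a 1^j 2 2^b` in the window from `n` to `M`. -/
noncomputable def winV (n : ℕ) (M : ℕ∞) : ℝ≥0∞ :=
  genV (ENNReal.ofReal y) (ENNReal.ofReal u) (wt x 2) (wt x 1) fun w => win w n M

/-- The words `2^a (j + 2) 2^b` in the window from `n` to `M`. -/
noncomputable def winK (n : ℕ) (M : ℕ∞) : ℝ≥0∞ :=
  genK (ENNReal.ofReal y) (ENNReal.ofReal u) (wt x 2) (wtT x) fun w => win w n M

/-- The words `2^a (j + 2) 2^b`, with all places different from `n`. -/
noncomputable def aroundK (n : ℕ) : ℝ≥0∞ :=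
  winG x y 0 n * winK x y u n ⊤ + winK x y u 0 n * winG x y n ⊤

/-- The words `2^a 1^j 2 2^b`, with all places different from `n`. -/
noncomputable def aroundV (n : ℕ) : ℝ≥0∞ :=
  winG x y 0 n * winV x y u n ⊤ + winF x y u 0 n * winT x y u n ⊤ + winV x y u 0 n * winG x y n ⊤

variable {x y u}

theorem Small.winG_lt_top (h : Small x y u) (n : ℕ) (M : ℕ∞) : winG x y n M < ⊤ :=
  genG_lt_top h.y_mul_lt n M

theorem winG_mono {n n' : ℕ} {M M' : ℕ∞} (hn : n' ≤ n) (hM : M ≤ M') :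
    winG x y n M ≤ winG x y n' M' := genG_mono _ _ fun w => win_mono w hn hM

theorem Small.u_lt_one (h : Small x y u) : u < 1 := by linarith [h.u_le]

/-- Summed over `j` with weights `u ^ j`, the special letters give `1 / ((m - u) * (m - x))`, at
most twice the letter `2`. Finiteness of the other families is derived from this bound. -/
theorem Small.winK_total_lt_top (h : Small x y u) : winK x y u 0 ⊤ < ⊤ := by
  rw [winK, genK_window]
  have h1 : ∀ m : ℕ, (if 0 < m ∧ (m : ℕ∞) < ⊤ then
      genG (ENNReal.ofReal y) (wt x 2) (fun w => win w 0 m) *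
        (∑' j, ENNReal.ofReal u ^ j * wtT x j m) *
        genG (ENNReal.ofReal y) (wt x 2) (fun w => win w m ⊤) else 0) ≤
      2 * (winG x y 0 ⊤ * winG x y 0 ⊤) * wt x 2 m := by
    intro m
    split_ifs with hm
    · have hm1 : 1 ≤ m := hm.1
      have h2 : (1 : ℝ) ≤ m := by exact_mod_cast hm1
      have h3 := sub_pos_of_le_half h.x_le hm1
      have h4 : ∑' j, ENNReal.ofReal u ^ j * wtT x j m ≤ 2 * wt x 2 m := by
        rw [tsum_pow_mul_wtT x h.u_pos.le h.u_lt_one hm1, wt_two x hm1,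
          show (2 : ℝ≥0∞) = ENNReal.ofReal 2 by simp, ← ENNReal.ofReal_mul (by norm_num)]
        refine ENNReal.ofReal_le_ofReal ?_
        have h5 := h.u_le
        rw [mul_one_div, div_le_div_iff₀ (mul_pos (by linarith) h3) (by positivity)]
        nlinarith
      calc _ ≤ winG x y 0 ⊤ * (2 * wt x 2 m) * winG x y 0 ⊤ := by
            gcongr
            · exact winG_mono le_rfl le_top
            · exact winG_mono (Nat.zero_le m) le_rfl
        _ = _ := by ring
    · exact zero_le
  refine lt_of_le_of_lt (ENNReal.tsum_le_tsum h1) ?_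
  rw [ENNReal.tsum_mul_left]
  exact ENNReal.mul_lt_top (ENNReal.mul_lt_top (by simp)
    (ENNReal.mul_lt_top (h.winG_lt_top _ _) (h.winG_lt_top _ _)))
    (tsum_wt_lt_top h.x_nonneg h.x_le le_rfl)

/-- Ohno's relation for the shuffle products of a single component with `{2}^l`. -/
theorem Small.winV_total (h : Small x y u) : winV x y u 0 ⊤ = winK x y u 0 ⊤ := by
  have h1 : winV x y u 0 ⊤ = genV (ENNReal.ofReal y) (ENNReal.ofReal u) (2 : ℕ+) 1 (zeta x) :=
    (genV_map (ENNReal.ofReal y) (ENNReal.ofReal u) 2 1 (wt x) fun w => win w 0 ⊤).symm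
  have h2 : winK x y u 0 ⊤ = genK (ENNReal.ofReal y) (ENNReal.ofReal u) (2 : ℕ+)
      (fun τ => (τ + 1).succPNat) (zeta x) :=
    (genK_map (ENNReal.ofReal y) (ENNReal.ofReal u) 2 _ (wt x) fun w => win w 0 ⊤).symm
  rw [h1, h2, genV, genK]
  refine tsum_congr fun j => ?_
  rw [ENNReal.tsum_comm]
  refine tsum_congr fun a => tsum_congr fun b => ?_
  have h3 : IsAdmissible (twoWord (j + 1).succPNat a b) := isAdmissible_twoWord
    (by rw [← PNat.coe_le_coe, Nat.succPNat_coe]; change 2 ≤ _; omega) a b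
  have h4 := zeta_dualIndex h.x_nonneg (by linarith [h.x_le]) h3
  rw [dualIndex_twoWord] at h4
  rw [add_comm b a]
  congr 2

/-- Forbidding the place `n` only discards terms of the total. -/
theorem aroundK_le (n : ℕ) : aroundK x y u n ≤ winK x y u 0 ⊤ := by
  rw [aroundK, winG, winK, winK, winG, ← genK_splitSum]
  exact genK_mono _ _ _ _ fun w => splitSum_win_le w n

theorem Small.aroundV_le (h : Small x y u) (n : ℕ) : aroundV x y u n ≤ winK x y u 0 ⊤ := by
  rw [← h.winV_total, aroundV, winG, winF, winT, winV, winV, winG, ← genV_splitSum]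
  exact genV_mono _ _ _ _ fun w => splitSum_win_le w n

/-- Unlike in `aroundK`, the left part may use the place `n`. Comparing the two isolates what
happens at `n`. -/
theorem cutK (n : ℕ) : winG x y 0 (n + 1 : ℕ) * winK x y u n ⊤ +
    winK x y u 0 (n + 1 : ℕ) * winG x y n ⊤ = winK x y u 0 ⊤ := by
  rw [winG, winK, winK, winG, ← genK_splitSum]
  congr 1
  funext w
  exact win_cut w (Nat.zero_le n)

theorem cutV (n : ℕ) : winG x y 0 (n + 1 : ℕ) * winV x y u n ⊤ +
    winF x y u 0 (n + 1 : ℕ) * winT x y u n ⊤ +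
    winV x y u 0 (n + 1 : ℕ) * winG x y n ⊤ = winV x y u 0 ⊤ := by
  rw [winG, winF, winT, winV, winV, winG, ← genV_splitSum]
  congr 1
  funext w
  exact win_cut w (Nat.zero_le n)

theorem lt_top_of_mul_left {a b : ℝ≥0∞} (ha : 1 ≤ a) (h : a * b < ⊤) : b < ⊤ :=
  lt_of_le_of_lt (le_mul_of_one_le_left zero_le ha) h

theorem lt_top_of_mul_right {a b : ℝ≥0∞} (hb : 1 ≤ b) (h : a * b < ⊤) : a < ⊤ :=
  lt_of_le_of_lt (le_mul_of_one_le_right zero_le hb) h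

theorem one_le_winG (n : ℕ) (M : ℕ∞) : 1 ≤ winG x y n M := one_le_genG _ _ n M

theorem Small.winK_right_lt_top (h : Small x y u) (n : ℕ) : winK x y u n ⊤ < ⊤ := by
  have h1 := h.winK_total_lt_top
  rw [← cutK n, ENNReal.add_lt_top] at h1
  exact lt_top_of_mul_left (one_le_winG _ _) h1.1

theorem Small.winK_left_lt_top (h : Small x y u) (n : ℕ) : winK x y u 0 n < ⊤ := by
  have h1 := h.winK_total_lt_top
  rw [← cutK n, ENNReal.add_lt_top] at h1
  exact lt_of_le_of_lt (genK_mono _ _ _ _ fun w => win_mono w le_rfl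
    (by exact_mod_cast n.le_succ)) (lt_top_of_mul_right (one_le_winG _ _) h1.2)

theorem Small.winV_right_lt_top (h : Small x y u) (n : ℕ) : winV x y u n ⊤ < ⊤ := by
  have h1 := h.winK_total_lt_top
  rw [← h.winV_total, ← cutV n, ENNReal.add_lt_top, ENNReal.add_lt_top] at h1
  exact lt_top_of_mul_left (one_le_winG _ _) h1.1.1

theorem Small.winV_left_lt_top (h : Small x y u) (n : ℕ) : winV x y u 0 n < ⊤ := by
  have h1 := h.winK_total_lt_top
  rw [← h.winV_total, ← cutV n, ENNReal.add_lt_top] at h1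
  exact lt_of_le_of_lt (genV_mono _ _ _ _ fun w => win_mono w le_rfl
    (by exact_mod_cast n.le_succ)) (lt_top_of_mul_right (one_le_winG _ _) h1.2)

theorem wt_lt_top (x : ℝ) (c : ℕ+) {m : ℕ} (hm : 1 ≤ m) : wt x c m < ⊤ := by
  rw [wt_eq_ofReal x c hm]
  exact ENNReal.ofReal_lt_top

/-- The letter `1` has a divergent sum, so finiteness is obtained by growing the window one place at
a time. -/
theorem Small.winF_left_lt_top (h : Small x y u) {n : ℕ} (hn : 1 ≤ n) :
    winF x y u 0 n < ⊤ := by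
  induction n, hn using Nat.le_induction with
  | base =>
    have := genF_empty (ENNReal.ofReal y) (ENNReal.ofReal u) (wt x 2) (wt x 1) 0
    rw [winF, show ((1 : ℕ) : ℕ∞) = ((0 + 1 : ℕ) : ℕ∞) from rfl, this]
    exact ENNReal.zero_lt_top
  | succ n hn ih =>
    rw [winF, genF_succ _ _ _ _ (show 0 < n from hn)]
    exact ENNReal.add_lt_top.2 ⟨ih, ENNReal.mul_lt_top (ENNReal.mul_lt_top ENNReal.ofReal_lt_top
      (wt_lt_top x 1 hn)) (ENNReal.add_lt_top.2 ⟨h.winG_lt_top _ _, ih⟩)⟩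

/-! ### The recurrences over the reals -/

variable (x y u)

/-- Real form of `winG`, up to the place `n`. -/
noncomputable def realG (n : ℕ) : ℝ := (winG x y 0 n).toReal

/-- Real form of `winG`, from the place `n` on. -/
noncomputable def realR (n : ℕ) : ℝ := (winG x y n ⊤).toReal

/-- Real form of `winF`. -/
noncomputable def realF (n : ℕ) : ℝ := (winF x y u 0 n).toReal

/-- Real form of `winQ`. -/
noncomputable def realQ (n : ℕ) : ℝ := (winQ x u 0 n).toReal

variable {x y u}

theorem Small.ofReal_G (h : Small x y u) (n : ℕ) :
    winG x y 0 n = ENNReal.ofReal (realG x y n) := by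
  rw [realG, ENNReal.ofReal_toReal (h.winG_lt_top _ _).ne]

theorem Small.ofReal_R (h : Small x y u) (n : ℕ) :
    winG x y n ⊤ = ENNReal.ofReal (realR x y n) := by
  rw [realR, ENNReal.ofReal_toReal (h.winG_lt_top _ _).ne]

theorem Small.ofReal_F (h : Small x y u) {n : ℕ} (hn : 1 ≤ n) :
    winF x y u 0 n = ENNReal.ofReal (realF x y u n) := by
  rw [realF, ENNReal.ofReal_toReal (h.winF_left_lt_top hn).ne]

theorem Small.recData (h : Small x y u) : RecData x y u (realG x y)
    (fun n => realG x y n + realF x y u n) (realQ x u) (realR x y) := by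
  have hpos : ∀ n : ℕ, 1 ≤ n → 0 ≤ 1 / ((n : ℝ) * (n - x)) := fun n hn => by
    have := sub_pos_of_le_half h.x_le hn
    positivity
  have hpos' : ∀ n : ℕ, 1 ≤ n → 0 ≤ 1 / ((n : ℝ) - x) := fun n hn => by
    have := sub_pos_of_le_half h.x_le hn
    positivity
  have g1 : realG x y 1 = 1 := by
    have := genG_empty (ENNReal.ofReal y) (wt x 2) 0
    rw [realG, winG, show ((1 : ℕ) : ℕ∞) = ((0 + 1 : ℕ) : ℕ∞) from rfl, this,
      ENNReal.toReal_one]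
  have gs : ∀ n : ℕ, 1 ≤ n → realG x y (n + 1) = realG x y n * (1 + y / (n * (n - x))) := by
    intro n hn
    have h1 := hpos n hn
    rw [realG, winG, genG_succ_right _ _ (show 0 < n from hn), wt_two x hn,
      ← ENNReal.ofReal_mul h.y_nonneg, mul_one_div, ENNReal.toReal_mul,
      ENNReal.toReal_add (by simp) (by simp), ENNReal.toReal_one, ENNReal.toReal_ofReal]
    · rfl
    · rw [← mul_one_div]
      exact mul_nonneg h.y_nonneg h1
  have F1 : realF x y u 1 = 0 := by
    have := genF_empty (ENNReal.ofReal y) (ENNReal.ofReal u) (wt x 2) (wt x 1) 0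
    rw [realF, winF, show ((1 : ℕ) : ℕ∞) = ((0 + 1 : ℕ) : ℕ∞) from rfl, this,
      ENNReal.toReal_zero]
  have Fs : ∀ n : ℕ, 1 ≤ n → realF x y u (n + 1) =
      realF x y u n + u / (n - x) * (realG x y n + realF x y u n) := by
    intro n hn
    have h1 := hpos' n hn
    have h2 := h.winG_lt_top 0 n
    have h3 := h.winF_left_lt_top hn
    rw [realF, winF, genF_succ _ _ _ _ (show 0 < n from hn), wt_one x hn,
      ← ENNReal.ofReal_mul h.u_pos.le, mul_one_div]
    change (winF x y u 0 n + _ * (winG x y 0 n + winF x y u 0 n)).toReal = _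
    rw [ENNReal.toReal_add h3.ne (ENNReal.mul_lt_top ENNReal.ofReal_lt_top
      (ENNReal.add_lt_top.2 ⟨h2, h3⟩)).ne, ENNReal.toReal_mul, ENNReal.toReal_add h2.ne h3.ne,
      ENNReal.toReal_ofReal]
    · rfl
    · rw [← mul_one_div]
      exact mul_nonneg h.u_pos.le h1
  exact {
    x_le := h.x_le
    y_nonneg := h.y_nonneg
    u_nonneg := h.u_pos.le
    u_le := h.u_le
    g_one := g1
    g_succ := gs
    f_one := by simp [g1, F1]
    f_succ := fun n hn => by
      simp only [gs n hn, Fs n hn]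
      ring
    q_one := by
      have := genG_empty (ENNReal.ofReal u) (wt x 1) 0
      rw [realQ, winQ, show ((1 : ℕ) : ℕ∞) = ((0 + 1 : ℕ) : ℕ∞) from rfl, this,
        ENNReal.toReal_one]
    q_succ := fun n hn => by
      have h1 := hpos' n hn
      rw [realQ, winQ, genG_succ_right _ _ (show 0 < n from hn), wt_one x hn,
        ← ENNReal.ofReal_mul h.u_pos.le, mul_one_div, ENNReal.toReal_mul,
        ENNReal.toReal_add (by simp) (by simp), ENNReal.toReal_one, ENNReal.toReal_ofReal]
      · rfl
      · rw [← mul_one_div]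
        exact mul_nonneg h.u_pos.le h1
    R_eq := fun n => by
      have h1 := hpos (n + 1) (by omega)
      rw [realR, winG, genG_succ_left _ _ (ENat.natCast_lt_top _), wt_two x (by omega),
        ← ENNReal.ofReal_mul h.y_nonneg, mul_one_div, ENNReal.toReal_mul,
        ENNReal.toReal_add (by simp) (by simp), ENNReal.toReal_one, ENNReal.toReal_ofReal]
      · push_cast
        rfl
      · rw [← mul_one_div]
        exact mul_nonneg h.y_nonneg h1
    R_nonneg := fun n => ENNReal.toReal_nonneg }

theorem Small.winQ_eq (h : Small x y u) (n d : ℕ) :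
    winQ x u n (n + 1 + d : ℕ) =
      ENNReal.ofReal (realQ x u (n + 1 + d) / realQ x u (n + 1)) := by
  have hr := h.recData
  have hq := hr.q_pos (n := n + 1) (by omega)
  induction d with
  | zero =>
    rw [winQ, add_zero, genG_empty, div_self hq.ne', ENNReal.ofReal_one]
  | succ d ih =>
    have h1 := sub_pos_of_le_half h.x_le (m := n + 1 + d) (by omega)
    have h2 := h.u_pos
    rw [← add_assoc, hr.q_succ _ (by omega), winQ, genG_succ_right _ _ (by omega)]
    change winQ x u n (n + 1 + d : ℕ) * _ = _
    rw [ih, wt_one x (by omega), ← ENNReal.ofReal_mul h.u_pos.le, ← ENNReal.ofReal_one,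
      ← ENNReal.ofReal_add (by norm_num) (by positivity), ← ENNReal.ofReal_mul
        (div_nonneg (hr.q_pos (by omega)).le hq.le)]
    congr 1
    ring

end Data

/-! ### The identity between the generating functions -/

section Pairs

variable (x y u : ℝ)

/-- `∑ ρ(n, M) R_M / ((M - n) (M - x))` over `M > n`. -/
noncomputable def pairX (n : ℕ) : ℝ≥0∞ := ∑' M : ℕ, if n < M then
  winQ x u n M * ENNReal.ofReal (1 / (((M : ℝ) - n) * (M - x))) * winG x y M ⊤ else 0

/-- `∑ g_m ρ(m, n) m / ((n - m) (m - x))` over `m < n`. -/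
noncomputable def pairY (n : ℕ) : ℝ≥0∞ := ∑' m : ℕ, if 0 < m then (if m < n then
  winG x y 0 m * ENNReal.ofReal (m / (((n : ℝ) - m) * (m - x))) * winQ x u m n else 0) else 0

variable {x y u}

theorem Small.winQ_eq' (h : Small x y u) {n M : ℕ} (hn : n < M) :
    winQ x u n M = ENNReal.ofReal (realQ x u M / realQ x u (n + 1)) := by
  obtain ⟨d, rfl⟩ := Nat.exists_eq_add_of_le (show n + 1 ≤ M from hn)
  exact h.winQ_eq n d

theorem Small.realQ_div_nonneg (h : Small x y u) {n M : ℕ} (hn : n < M) :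
    0 ≤ realQ x u M / realQ x u (n + 1) :=
  div_nonneg (h.recData.q_pos (by omega)).le (h.recData.q_pos (by omega)).le

theorem Small.winT_eq (h : Small x y u) (n : ℕ) :
    winT x y u n ⊤ = ENNReal.ofReal (RecData.tailT x (realQ x u) (realR x y) n) := by
  have hr := h.recData
  rw [RecData.tailT, ENNReal.ofReal_tsum_of_nonneg (fun d => div_nonneg (hr.tailTerm_nonneg n d)
    (by positivity)) (hr.summable_T n), winT, genT_window]
  simp only [ENat.natCast_lt_top, and_true]
  rw [tsum_gt_eq]
  refine tsum_congr fun d => ?_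
  rw [show d + (n + 1) = n + 1 + d by ring]
  change winQ x u n (n + 1 + d : ℕ) * _ * winG x y (n + 1 + d) ⊤ = _
  have h2 := sub_pos_of_le_half h.x_le (m := n + 1 + d) (by omega)
  rw [h.winQ_eq, wt_two x (by omega), h.ofReal_R,
    ← ENNReal.ofReal_mul (h.realQ_div_nonneg (by omega)),
    ← ENNReal.ofReal_mul (mul_nonneg (h.realQ_div_nonneg (by omega)) (by positivity))]
  congr 1
  push_cast at h2 ⊢
  rw [RecData.tailTerm]
  field_simp

theorem Small.pairX_eq (h : Small x y u) (n : ℕ) :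
    pairX x y u n = ENNReal.ofReal (RecData.tailX x (realQ x u) (realR x y) n) := by
  have hr := h.recData
  rw [RecData.tailX, ENNReal.ofReal_tsum_of_nonneg (fun d => div_nonneg (hr.tailTerm_nonneg n d)
    (by positivity)) (hr.summable_X n), pairX, tsum_gt_eq]
  refine tsum_congr fun d => ?_
  rw [show d + (n + 1) = n + 1 + d by ring]
  have h2 := sub_pos_of_le_half h.x_le (m := n + 1 + d) (by omega)
  have h3 : ((n + 1 + d : ℕ) : ℝ) - n = (d : ℝ) + 1 := by push_cast; ring
  rw [h3, h.winQ_eq, h.ofReal_R,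
    ← ENNReal.ofReal_mul (h.realQ_div_nonneg (by omega)),
    ← ENNReal.ofReal_mul (mul_nonneg (h.realQ_div_nonneg (by omega)) (by positivity))]
  congr 1
  push_cast at h2 ⊢
  rw [RecData.tailTerm]
  field_simp

theorem Small.pairY_eq (h : Small x y u) (n : ℕ) :
    pairY x y u n = ENNReal.ofReal (RecData.headSum x (realG x y) (realQ x u) n
      (fun m => (m : ℝ) / ((n : ℝ) - m))) := by
  have hpos : ∀ m ∈ Finset.Ico 1 n, 0 ≤ (m : ℝ) / (((n : ℝ) - m) * (m - x)) := fun m hm => by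
    have h1 := Finset.mem_Ico.1 hm
    have h2 := sub_pos_of_le_half h.x_le h1.1
    have h3 : (m : ℝ) ≤ n := by exact_mod_cast h1.2.le
    exact div_nonneg (by positivity) (mul_nonneg (sub_nonneg.2 h3) h2.le)
  have hQ : ∀ m ∈ Finset.Ico 1 n, 0 ≤ realQ x u n / realQ x u (m + 1) := fun m hm =>
    h.realQ_div_nonneg (Finset.mem_Ico.1 hm).2
  have e : ∀ m : ℕ, realQ x u n / realQ x u (m + 1) * (realG x y m / ((m : ℝ) - x)) *
      ((m : ℝ) / ((n : ℝ) - m)) = realG x y m * ((m : ℝ) / (((n : ℝ) - m) * (m - x))) *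
        (realQ x u n / realQ x u (m + 1)) := fun m => by
    simp only [div_eq_mul_inv, mul_inv]
    ring
  have hg : ∀ m, 0 ≤ realG x y m := fun m => ENNReal.toReal_nonneg
  simp only [RecData.headSum, e]
  rw [ENNReal.ofReal_sum_of_nonneg fun m hm =>
    mul_nonneg (mul_nonneg (hg m) (hpos m hm)) (hQ m hm), pairY,
    tsum_eq_sum (s := Finset.Ico 1 n)]
  · refine Finset.sum_congr rfl fun m hm => ?_
    have h1 := Finset.mem_Ico.1 hm
    rw [if_pos (by omega), if_pos h1.2, h.ofReal_G, h.winQ_eq' h1.2,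
      ENNReal.ofReal_mul (mul_nonneg (hg m) (hpos m hm)), ENNReal.ofReal_mul (hg m)]
  · intro m hm
    rw [Finset.mem_Ico] at hm
    split_ifs <;> first | rfl | omega

/-- Cutting the equal totals `winV x y u 0 ⊤ = winK x y u 0 ⊤` between `n` and `n + 1` gives one
linear equation. One step of the recurrences rewrites its left windows by windows ending before `n`;
the unknowns then occur only as `aroundV - aroundK`, with the factor `1 + y / (n * (n - x))`, which
becomes `n * (n - x) + y` after clearing denominators. -/
theorem Small.realV_identity (h : Small x y u) {n : ℕ} (hn : 1 ≤ n) :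
    ((n : ℝ) * (n - x) + y) * ((aroundV x y u n).toReal - (aroundK x y u n).toReal) =
      n * (realG x y n * realR x y n) / (n - u) -
        (realG x y n + realF x y u n) * realR x y n +
      ((y - u * n) * (realG x y n + realF x y u n) - y * realG x y n) *
        RecData.tailT x (realQ x u) (realR x y) n := by
  have hr := h.recData
  have hT0 : 0 ≤ RecData.tailT x (realQ x u) (realR x y) n :=
    tsum_nonneg fun d => div_nonneg (hr.tailTerm_nonneg n d) (by positivity)
  have hx := sub_pos_of_le_half h.x_le hn
  have hn1 : (1 : ℝ) ≤ n := by exact_mod_cast hn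
  have hu : 0 < (n : ℝ) - u := by linarith [h.u_le]
  set g := realG x y n with hg
  set R := realR x y n with hR
  set F := realF x y u n with hF
  set T := RecData.tailT x (realQ x u) (realR x y) n with hT
  set V := (winV x y u 0 n).toReal with hV
  set V' := (winV x y u n ⊤).toReal with hV'
  set K := (winK x y u 0 n).toReal with hK
  set K' := (winK x y u n ⊤).toReal with hK'
  have eV : winV x y u 0 n = ENNReal.ofReal V :=
    (ENNReal.ofReal_toReal (h.winV_left_lt_top n).ne).symm
  have eV' : winV x y u n ⊤ = ENNReal.ofReal V' :=
    (ENNReal.ofReal_toReal (h.winV_right_lt_top n).ne).symm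
  have eK : winK x y u 0 n = ENNReal.ofReal K :=
    (ENNReal.ofReal_toReal (h.winK_left_lt_top n).ne).symm
  have eK' : winK x y u n ⊤ = ENNReal.ofReal K' :=
    (ENNReal.ofReal_toReal (h.winK_right_lt_top n).ne).symm
  have hV0 : 0 ≤ V := ENNReal.toReal_nonneg
  have hV0' : 0 ≤ V' := ENNReal.toReal_nonneg
  have hK0 : 0 ≤ K := ENNReal.toReal_nonneg
  have hK0' : 0 ≤ K' := ENNReal.toReal_nonneg
  have hg0 : 0 ≤ g := ENNReal.toReal_nonneg
  have hR0 : 0 ≤ R := ENNReal.toReal_nonneg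
  have hF0 : 0 ≤ F := ENNReal.toReal_nonneg
  have hy := h.y_nonneg
  have hu0 := h.u_pos.le
  set d := 1 / ((n : ℝ) * (n - x)) with hd
  set e := 1 / ((n : ℝ) - x) with he
  set k := 1 / (((n : ℝ) - u) * (n - x)) with hk
  have hd0 : 0 ≤ d := by positivity
  have he0 : 0 ≤ e := by positivity
  have hk0 : 0 ≤ k := by positivity
  have one : (1 : ℝ≥0∞) + ENNReal.ofReal y * ENNReal.ofReal d = ENNReal.ofReal (1 + y * d) := by
    rw [ENNReal.ofReal_add (by norm_num) (by positivity), ENNReal.ofReal_mul hy,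
      ENNReal.ofReal_one]
  have eG1 : winG x y 0 (n + 1 : ℕ) = ENNReal.ofReal (g * (1 + y * d)) := by
    rw [winG, genG_succ_right _ _ (show 0 < n from hn)]
    change winG x y 0 n * _ = _
    rw [h.ofReal_G, wt_two x hn, one, ← ENNReal.ofReal_mul hg0]
  have eF1 : winF x y u 0 (n + 1 : ℕ) = ENNReal.ofReal (F + u * e * (g + F)) := by
    rw [winF, genF_succ _ _ _ _ (show 0 < n from hn)]
    change winF x y u 0 n + _ * (winG x y 0 n + winF x y u 0 n) = _
    rw [h.ofReal_G, h.ofReal_F hn, wt_one x hn, ← ENNReal.ofReal_mul hu0,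
      ← ENNReal.ofReal_add hg0 hF0, ← ENNReal.ofReal_mul (by positivity),
      ← ENNReal.ofReal_add hF0 (by positivity)]
  have eV1 : winV x y u 0 (n + 1 : ℕ) = ENNReal.ofReal (V * (1 + y * d) + (g + F) * d) := by
    rw [winV, genV_succ _ _ _ _ (show 0 < n from hn)]
    change winV x y u 0 n * _ + (winG x y 0 n + winF x y u 0 n) * _ = _
    rw [h.ofReal_G, h.ofReal_F hn, wt_two x hn, eV, one, ← ENNReal.ofReal_mul hV0,
      ← ENNReal.ofReal_add hg0 hF0, ← ENNReal.ofReal_mul (by positivity),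
      ← ENNReal.ofReal_add (by positivity) (by positivity)]
  have eK1 : winK x y u 0 (n + 1 : ℕ) = ENNReal.ofReal (K * (1 + y * d) + g * k) := by
    rw [winK, genK_succ _ _ _ _ (show 0 < n from hn),
      tsum_pow_mul_wtT x h.u_pos.le h.u_lt_one hn]
    change winK x y u 0 n * _ + winG x y 0 n * _ = _
    rw [h.ofReal_G, wt_two x hn, eK, one, ← ENNReal.ofReal_mul hK0,
      ← ENNReal.ofReal_mul (by positivity), ← ENNReal.ofReal_add (by positivity) (by positivity)]
  have aV : (aroundV x y u n).toReal = g * V' + F * T + V * R := by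
    rw [aroundV, h.ofReal_G, h.ofReal_F hn, h.ofReal_R, h.winT_eq, eV, eV',
      ← ENNReal.ofReal_mul (by positivity), ← ENNReal.ofReal_mul (by positivity),
      ← ENNReal.ofReal_mul (by positivity), ← ENNReal.ofReal_add (by positivity) (by positivity),
      ← ENNReal.ofReal_add (by positivity) (by positivity),
      ENNReal.toReal_ofReal (by positivity)]
  have aK : (aroundK x y u n).toReal = g * K' + K * R := by
    rw [aroundK, h.ofReal_G, h.ofReal_R, eK, eK',
      ← ENNReal.ofReal_mul (by positivity), ← ENNReal.ofReal_mul (by positivity),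
      ← ENNReal.ofReal_add (by positivity) (by positivity),
      ENNReal.toReal_ofReal (by positivity)]
  -- Only at this point is duality used: it equates the two totals that are being cut.
  have cut : g * (1 + y * d) * V' + (F + u * e * (g + F)) * T +
      (V * (1 + y * d) + (g + F) * d) * R =
      g * (1 + y * d) * K' + (K * (1 + y * d) + g * k) * R := by
    have h1 := (cutV n).trans (h.winV_total.trans (cutK n).symm)
    rw [eG1, eF1, eV1, eK1, h.ofReal_R, h.winT_eq, eV', eK',
      ← ENNReal.ofReal_mul (by positivity), ← ENNReal.ofReal_mul (by positivity),
      ← ENNReal.ofReal_mul (by positivity), ← ENNReal.ofReal_mul (by positivity),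
      ← ENNReal.ofReal_mul (by positivity), ← ENNReal.ofReal_add (by positivity) (by positivity),
      ← ENNReal.ofReal_add (by positivity) (by positivity),
      ← ENNReal.ofReal_add (by positivity) (by positivity),
      ENNReal.ofReal_eq_ofReal_iff (by positivity) (by positivity)] at h1
    exact h1
  rw [aV, aK]
  have ed : (n : ℝ) * (n - x) * d = 1 := by rw [hd]; field_simp
  have ee : (n : ℝ) * (n - x) * e = n := by rw [he]; field_simp
  have ek : (n : ℝ) * (n - x) * k = n / (n - u) := by rw [hk]; field_simp
  have ek2 : (n : ℝ) * (g * R) / (n - u) = n / (n - u) * (g * R) := by ring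
  rw [ek2]
  linear_combination (n : ℝ) * (n - x) * cut + (g * R) * ek - ((g + F) * R) * ed -
    u * (g + F) * T * ee - y * (g * V' + V * R - g * K' - K * R) * ed

/-- The contributions of a single place. -/
theorem Small.local_identity (h : Small x y u) {n : ℕ} (hn : 1 ≤ n) :
    ENNReal.ofReal y * aroundV x y u n + ENNReal.ofReal u * (n * aroundV x y u n) +
      ENNReal.ofReal x * (n * aroundK x y u n) +
      ENNReal.ofReal u * (n * (winG x y 0 n * pairX x y u n)) =
    ENNReal.ofReal y * aroundK x y u n + ENNReal.ofReal u * (n * aroundK x y u n) +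
      ENNReal.ofReal x * (n * aroundV x y u n) +
      ENNReal.ofReal y * (winF x y u 0 n * winT x y u n ⊤) +
      ENNReal.ofReal u * (ENNReal.ofReal (1 / ((n : ℝ) - u)) *
        (winG x y 0 n * winG x y n ⊤)) +
      ENNReal.ofReal u * (winG x y n ⊤ * pairY x y u n) := by
  have hr := h.recData
  -- Here `J` is `aroundV - aroundK`. The rest of the proof moves the negative terms to the other
  -- side, so that the identity can be stated in `ℝ≥0∞`.
  have key := hr.local_identity hn (h.realV_identity hn)
  have hT0 : 0 ≤ RecData.tailT x (realQ x u) (realR x y) n :=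
    tsum_nonneg fun d => div_nonneg (hr.tailTerm_nonneg n d) (by positivity)
  have hX0 : 0 ≤ RecData.tailX x (realQ x u) (realR x y) n :=
    tsum_nonneg fun d => div_nonneg (hr.tailTerm_nonneg n d) (by positivity)
  have hn1 : (1 : ℝ) ≤ n := by exact_mod_cast hn
  have hu : 0 < (n : ℝ) - u := by linarith [h.u_le]
  have hY0 : 0 ≤ RecData.headSum x (realG x y) (realQ x u) n
      (fun m => (m : ℝ) / ((n : ℝ) - m)) := by
    refine Finset.sum_nonneg fun m hm => ?_
    have h1 := Finset.mem_Ico.1 hm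
    have h2 := sub_pos_of_le_half h.x_le h1.1
    have h3 : (m : ℝ) < n := by exact_mod_cast h1.2
    exact mul_nonneg (mul_nonneg (h.realQ_div_nonneg h1.2)
      (div_nonneg ENNReal.toReal_nonneg h2.le)) (div_nonneg (by positivity) (by linarith))
  have eV : aroundV x y u n = ENNReal.ofReal (aroundV x y u n).toReal :=
    (ENNReal.ofReal_toReal ((h.aroundV_le n).trans_lt h.winK_total_lt_top).ne).symm
  have eK : aroundK x y u n = ENNReal.ofReal (aroundK x y u n).toReal :=
    (ENNReal.ofReal_toReal ((aroundK_le n).trans_lt h.winK_total_lt_top).ne).symm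
  have hV0 : 0 ≤ (aroundV x y u n).toReal := ENNReal.toReal_nonneg
  have hK0 : 0 ≤ (aroundK x y u n).toReal := ENNReal.toReal_nonneg
  have hg0 : 0 ≤ realG x y n := ENNReal.toReal_nonneg
  have hR0 : 0 ≤ realR x y n := ENNReal.toReal_nonneg
  have hF0 : 0 ≤ realF x y u n := ENNReal.toReal_nonneg
  have hy := h.y_nonneg
  have hx0 := h.x_nonneg
  have hu0 := h.u_pos.le
  have en : (n : ℝ≥0∞) = ENNReal.ofReal n := (ENNReal.ofReal_natCast n).symm
  rw [eV, eK, h.ofReal_G, h.ofReal_F hn, h.ofReal_R, h.winT_eq, h.pairX_eq, h.pairY_eq, en]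
  generalize (aroundV x y u n).toReal = V at *
  generalize (aroundK x y u n).toReal = K at *
  generalize RecData.tailT x (realQ x u) (realR x y) n = T at *
  generalize RecData.tailX x (realQ x u) (realR x y) n = X at *
  generalize RecData.headSum x (realG x y) (realQ x u) n (fun m => (m : ℝ) / ((n : ℝ) - m)) = Z
    at *
  generalize realG x y n = g at *
  generalize realR x y n = R at *
  generalize realF x y u n = F at *
  have hH : 0 ≤ 1 / ((n : ℝ) - u) := by positivity
  simp only [← ENNReal.ofReal_mul, hy, hx0, hu0, hg0, hR0, hF0, hH, Nat.cast_nonneg]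
  rw [← ENNReal.ofReal_add (by positivity) (by positivity),
    ← ENNReal.ofReal_add (by positivity) (by positivity),
    ← ENNReal.ofReal_add (by positivity) (by positivity),
    ← ENNReal.ofReal_add (by positivity) (by positivity),
    ← ENNReal.ofReal_add (by positivity) (by positivity),
    ← ENNReal.ofReal_add (by positivity) (by positivity),
    ← ENNReal.ofReal_add (by positivity) (by positivity),
    ← ENNReal.ofReal_add (by positivity) (by positivity)]
  congr 1
  rw [mul_div_assoc, div_eq_mul_one_div] at key
  linear_combination key

end Pairs

/-! ### Summation over all places -/

section Total

variable {x y u : ℝ}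

/-- The divided difference of `t ↦ t^{-s}`. -/
theorem sum_antidiagonal_div_pow {m M x : ℝ} (hm : 0 < m) (hM : m < M) (hxm : 0 < m - x)
    (hxM : 0 < M - x) (s : ℕ) :
    (∑ p ∈ Finset.HasAntidiagonal.antidiagonal s, (1 / m) ^ p.1 * (1 / (m - x)) *
      ((1 / M) ^ (p.2 + 1) * (1 / (M - x)))) +
      (1 / M) ^ (s + 1) * (1 / (M - x)) * (m / ((M - m) * (m - x))) =
    (1 / m) ^ (s + 1) * (1 / (m - x)) * m * (1 / ((M - m) * (M - x))) := by
  have hM0 : 0 < M := hm.trans hM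
  have hd : 0 < M - m := by linarith
  induction s with
  | zero =>
    simp
    field_simp
    ring
  | succ s ih =>
    rw [Finset.Nat.sum_antidiagonal_succ']
    have e : ∑ p ∈ Finset.HasAntidiagonal.antidiagonal s, (1 / m) ^ p.1 * (1 / (m - x)) *
        ((1 / M) ^ (p.2 + 1 + 1) * (1 / (M - x))) = (1 / M) *
        ∑ p ∈ Finset.HasAntidiagonal.antidiagonal s, (1 / m) ^ p.1 * (1 / (m - x)) *
        ((1 / M) ^ (p.2 + 1) * (1 / (M - x))) := by
      rw [Finset.mul_sum]
      exact Finset.sum_congr rfl fun p _ => by ring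
    simp only [e]
    rw [← eq_sub_iff_add_eq] at ih
    rw [ih, pow_succ (1 / m) (s + 1), pow_succ (1 / M) (s + 1)]
    generalize (1 / m) ^ (s + 1) = a
    generalize (1 / M) ^ (s + 1) = b
    have h1 := inv_mul_cancel₀ hM0.ne'
    have h2 := inv_mul_cancel₀ hd.ne'
    have h3 := inv_mul_cancel₀ hm.ne'
    simp only [div_eq_mul_inv, one_mul, mul_inv, zero_add, pow_one]
    generalize (M - m)⁻¹ = D at *
    generalize (M - x)⁻¹ = B at *
    generalize (m - x)⁻¹ = A at *
    generalize M⁻¹ = M' at *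
    generalize m⁻¹ = m' at *
    linear_combination a * A * B * (D * h1 - M' * h2 - D * h3)

/-- The words `2^a c_1 1^j c_2 2^b`, with `c_1 + c_2 = s + 2`. -/
noncomputable def twoPlaces (x y u : ℝ) (s : ℕ+) : ℝ≥0∞ :=
  ∑ p ∈ Finset.HasAntidiagonal.antidiagonal ((s : ℕ) - 1), ∑' m : ℕ, if 0 < m then
    ∑' M : ℕ, if m < M then winG x y 0 m * wt x p.1.succPNat m *
      (winQ x u m M * wt x (p.2 + 1).succPNat M * winG x y M ⊤) else 0 else 0

/-- For fixed `m < M` the sum over `p` is a divided difference of powers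
(`sum_antidiagonal_div_pow`), one part carrying the letter `s + 1` at `m` and the other at `M`.
Reading the first as a sum over `n = m` and the second as a sum over `n = M` turns pairs of places
into single places with the factors `pairX` and `pairY`. -/
theorem twoPlaces_add (hx : x ≤ 1 / 2) (s : ℕ+) :
    twoPlaces x y u s + (∑' n : ℕ, if 0 < n then
      wt x (s + 1) n * (winG x y n ⊤ * pairY x y u n) else 0) =
    ∑' n : ℕ, if 0 < n then wt x (s + 1) n * (n * (winG x y 0 n * pairX x y u n)) else 0 := by
  have hs : (s : ℕ) - 1 + 1 = s := Nat.sub_add_cancel s.pos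
  have hs' : ((s + 1 : ℕ+) : ℕ) - 1 = (s : ℕ) - 1 + 1 := by
    rw [hs, PNat.add_coe, PNat.one_coe]
    omega
  have h1 : twoPlaces x y u s = ∑' m : ℕ, ∑' M : ℕ, if 0 < m ∧ m < M then
      ∑ p ∈ Finset.HasAntidiagonal.antidiagonal ((s : ℕ) - 1), winG x y 0 m *
        wt x p.1.succPNat m * (winQ x u m M * wt x (p.2 + 1).succPNat M * winG x y M ⊤) else 0 := by
    rw [twoPlaces, ← Summable.tsum_finsetSum fun _ _ => ENNReal.summable]
    refine tsum_congr fun m => ?_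
    by_cases hm : 0 < m
    · simp only [hm, if_true, true_and]
      rw [← Summable.tsum_finsetSum fun _ _ => ENNReal.summable]
      refine tsum_congr fun M => ?_
      split_ifs <;> simp
    · simp [hm]
  have h2 : (∑' n : ℕ, if 0 < n then
      wt x (s + 1) n * (winG x y n ⊤ * pairY x y u n) else 0) =
      ∑' m : ℕ, ∑' M : ℕ, if 0 < m ∧ m < M then wt x (s + 1) M * (winG x y M ⊤ *
        (winG x y 0 m * ENNReal.ofReal (m / (((M : ℝ) - m) * (m - x))) * winQ x u m M)) else 0 := by
    rw [ENNReal.tsum_comm]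
    refine tsum_congr fun M => ?_
    rw [pairY]
    split_ifs with hM
    · rw [← ENNReal.tsum_mul_left, ← ENNReal.tsum_mul_left]
      refine tsum_congr fun m => ?_
      by_cases hm : 0 < m <;> by_cases hmM : m < M <;> simp [hm, hmM]
    · symm
      rw [ENNReal.tsum_eq_zero]
      intro m
      rw [if_neg]
      omega
  have h3 : (∑' n : ℕ, if 0 < n then
      wt x (s + 1) n * (n * (winG x y 0 n * pairX x y u n)) else 0) =
      ∑' m : ℕ, ∑' M : ℕ, if 0 < m ∧ m < M then wt x (s + 1) m * (m * (winG x y 0 m *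
        (winQ x u m M * ENNReal.ofReal (1 / (((M : ℝ) - m) * (M - x))) * winG x y M ⊤)))
        else 0 := by
    refine tsum_congr fun m => ?_
    rw [pairX]
    split_ifs with hm
    · rw [← ENNReal.tsum_mul_left, ← ENNReal.tsum_mul_left, ← ENNReal.tsum_mul_left]
      refine tsum_congr fun M => ?_
      by_cases hmM : m < M <;> simp [hm, hmM]
    · simp [hm]
  rw [h1, h2, h3, ← ENNReal.tsum_add]
  refine tsum_congr fun m => ?_
  rw [← ENNReal.tsum_add]
  refine tsum_congr fun M => ?_
  split_ifs with h
  · obtain ⟨hm, hmM⟩ := h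
    have hxm := sub_pos_of_le_half hx (m := m) hm
    have hxM := sub_pos_of_le_half hx (m := M) (by omega)
    have hm' : (0 : ℝ) < m := by exact_mod_cast hm
    have hmM' : (m : ℝ) < M := by exact_mod_cast hmM
    have hM' : (0 : ℝ) < M := hm'.trans hmM'
    have hd : (0 : ℝ) < M - m := by linarith
    have hw1 : ∀ j : ℕ, wt x j.succPNat m =
        ENNReal.ofReal ((1 / (m : ℝ)) ^ j * (1 / ((m : ℝ) - x))) := fun j => by
      rw [wt_eq_ofReal x _ hm, Nat.succPNat_coe, Nat.succ_sub_one]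
    have hw2 : ∀ j : ℕ, wt x j.succPNat M =
        ENNReal.ofReal ((1 / (M : ℝ)) ^ j * (1 / ((M : ℝ) - x))) := fun j => by
      rw [wt_eq_ofReal x _ (by omega), Nat.succPNat_coe, Nat.succ_sub_one]
    have e1 : ∑ p ∈ Finset.HasAntidiagonal.antidiagonal ((s : ℕ) - 1), winG x y 0 m *
        wt x p.1.succPNat m * (winQ x u m M * wt x (p.2 + 1).succPNat M * winG x y M ⊤) =
        winG x y 0 m * winQ x u m M * winG x y M ⊤ * ENNReal.ofReal
        (∑ p ∈ Finset.HasAntidiagonal.antidiagonal ((s : ℕ) - 1),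
          (1 / (m : ℝ)) ^ p.1 * (1 / ((m : ℝ) - x)) *
            ((1 / (M : ℝ)) ^ (p.2 + 1) * (1 / ((M : ℝ) - x)))) := by
      rw [ENNReal.ofReal_sum_of_nonneg fun p _ => by positivity, Finset.mul_sum]
      refine Finset.sum_congr rfl fun p _ => ?_
      rw [hw1, hw2, ENNReal.ofReal_mul (p := (1 / (m : ℝ)) ^ p.1 * (1 / ((m : ℝ) - x)))
        (by positivity)]
      ring
    have e2 : wt x (s + 1) M * (winG x y M ⊤ *
        (winG x y 0 m * ENNReal.ofReal (m / (((M : ℝ) - m) * (m - x))) * winQ x u m M)) =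
        winG x y 0 m * winQ x u m M * winG x y M ⊤ * ENNReal.ofReal
        ((1 / (M : ℝ)) ^ ((s : ℕ) - 1 + 1) * (1 / ((M : ℝ) - x)) *
          (m / (((M : ℝ) - m) * (m - x)))) := by
      rw [wt_eq_ofReal x _ (by omega), hs', ENNReal.ofReal_mul (q := m / (((M : ℝ) - m) * (m - x)))
        (by positivity)]
      ring
    have e3 : wt x (s + 1) m * (m * (winG x y 0 m *
        (winQ x u m M * ENNReal.ofReal (1 / (((M : ℝ) - m) * (M - x))) * winG x y M ⊤))) =
        winG x y 0 m * winQ x u m M * winG x y M ⊤ * ENNReal.ofReal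
        ((1 / (m : ℝ)) ^ ((s : ℕ) - 1 + 1) * (1 / ((m : ℝ) - x)) * m *
          (1 / (((M : ℝ) - m) * (M - x)))) := by
      rw [wt_eq_ofReal x _ hm, hs', ENNReal.ofReal_mul (q := 1 / (((M : ℝ) - m) * (M - x)))
        (by positivity), ENNReal.ofReal_mul (q := (m : ℝ)) (by positivity),
        ENNReal.ofReal_natCast]
      ring
    rw [e1, e2, e3, ← mul_add, ← ENNReal.ofReal_add (Finset.sum_nonneg fun p _ => by positivity)
      (by positivity), sum_antidiagonal_div_pow hm' hmM' hxm hxM]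
  · simp

variable (x y u) in
/-- The words `2^a (j + 3) 2^b` in the window from `n` to `M`. -/
noncomputable def winK' (n : ℕ) (M : ℕ∞) : ℝ≥0∞ :=
  genK (ENNReal.ofReal y) (ENNReal.ofReal u) (wt x 2) (fun j => wtT x (j + 1)) fun w => win w n M

variable (x y u) in
/-- The words `2^a 1^(j + 1) 2 2^b` in the window from `n` to `M`. -/
noncomputable def winV' (n : ℕ) (M : ℕ∞) : ℝ≥0∞ :=
  genV' (ENNReal.ofReal y) (ENNReal.ofReal u) (wt x 2) (wt x 1) fun w => win w n M

theorem winV_add_winK' (n : ℕ) (M : ℕ∞) :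
    winV x y u n M + ENNReal.ofReal u * winK' x y u n M =
      winK x y u n M + ENNReal.ofReal u * winV' x y u n M :=
  genV_add_genK _ _ _ _ _ _ rfl

/-- The left side is the part of `winK` with a special letter greater than `2`. -/
theorem winK'_le (n : ℕ) (M : ℕ∞) : ENNReal.ofReal u * winK' x y u n M ≤ winK x y u n M := by
  rw [winK, genK, tsum_eq_zero_add' ENNReal.summable, winK', genK, ← ENNReal.tsum_mul_left]
  refine le_trans (le_of_eq (tsum_congr fun j => ?_)) le_add_self
  simp only [ENNReal.tsum_mul_left, pow_succ']
  ring

/-- The sum of `σ_n F n` over the places `n`. -/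
noncomputable def placeSum (σ F : ℕ → ℝ≥0∞) : ℝ≥0∞ := ∑' n : ℕ, if 0 < n then σ n * F n else 0

theorem placeSum_add (σ F G : ℕ → ℝ≥0∞) :
    placeSum σ (fun n => F n + G n) = placeSum σ F + placeSum σ G := by
  rw [placeSum, placeSum, placeSum, ← ENNReal.tsum_add]
  refine tsum_congr fun n => ?_
  split_ifs <;> ring

theorem placeSum_mul (σ F : ℕ → ℝ≥0∞) (c : ℝ≥0∞) :
    placeSum σ (fun n => c * F n) = c * placeSum σ F := by
  rw [placeSum, placeSum, ← ENNReal.tsum_mul_left]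
  refine tsum_congr fun n => ?_
  split_ifs <;> ring

theorem placeSum_congr {σ F G : ℕ → ℝ≥0∞} (h : ∀ n, 1 ≤ n → F n = G n) :
    placeSum σ F = placeSum σ G := by
  refine tsum_congr fun n => ?_
  split_ifs with hn
  · rw [h n hn]
  · rfl

theorem placeSum_le {σ F : ℕ → ℝ≥0∞} {C : ℝ≥0∞} (h : ∀ n, 1 ≤ n → F n ≤ C) :
    placeSum σ F ≤ C * ∑' n, σ n := by
  rw [← ENNReal.tsum_mul_left]
  refine ENNReal.tsum_le_tsum fun n => ?_
  split_ifs with hn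
  · rw [mul_comm]
    gcongr
    exact h n hn
  · exact zero_le

theorem placeSum_natCast_mul (x : ℝ) (s : ℕ+) (F : ℕ → ℝ≥0∞) :
    placeSum (wt x (s + 1)) (fun n => n * F n) = placeSum (wt x s) F := by
  refine tsum_congr fun n => ?_
  split_ifs with hn
  · rw [← natCast_mul_wt_succ x s hn]
    ring
  · rfl

theorem insA_eq (x y u : ℝ) (s : ℕ+) :
    gen2 (ENNReal.ofReal y) (ENNReal.ofReal u) (insA x s) =
      placeSum (wt x s) (aroundK x y u) := insA_gen x _ _ s

theorem insB_eq (x y u : ℝ) (s : ℕ+) :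
    gen2 (ENNReal.ofReal y) (ENNReal.ofReal u) (insB x s) =
      placeSum (wt x s) (aroundV x y u) := insB_gen x _ _ s

theorem Small.raiC_eq (h : Small x y u) (s : ℕ+) :
    gen2 (ENNReal.ofReal y) (ENNReal.ofReal u) (raiC x s) =
      placeSum (wt x (s + 1)) (fun n =>
        ENNReal.ofReal y * (winK' x y u 0 n * winG x y n ⊤) +
        ENNReal.ofReal (1 / ((n : ℝ) - u)) * (winG x y 0 n * winG x y n ⊤) +
        ENNReal.ofReal y * (winG x y 0 n * winK' x y u n ⊤)) := by
  rw [raiC_gen]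
  refine placeSum_congr fun n hn => ?_
  rw [tsum_pow_mul_inv_pow h.u_pos.le h.u_lt_one hn]
  rfl

theorem Small.raiD_eq (h : Small x y u) (s : ℕ+) :
    gen2 (ENNReal.ofReal y) (ENNReal.ofReal u) (raiD x s) =
      placeSum (wt x (s + 1)) (fun n =>
        ENNReal.ofReal y * (winV' x y u 0 n * winG x y n ⊤) +
        ENNReal.ofReal y * (winG x y 0 n * winV' x y u n ⊤)) + twoPlaces x y u s :=
  raiD_gen x _ _ s h.x_nonneg (by linarith [h.x_le])

/-- `winV_add_winK'` is used on each side of `n`. This trades `V'` and `K'`, the natural data of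
`raiD` and `raiC`, for `aroundV` and `aroundK`, those of `insB` and `insA`; the product of `winF`
and `winT` is what `aroundV` contains in addition. -/
theorem place_relation (n : ℕ) :
    ENNReal.ofReal u * (ENNReal.ofReal y * (winV' x y u 0 n * winG x y n ⊤) +
        ENNReal.ofReal y * (winG x y 0 n * winV' x y u n ⊤)) +
      (ENNReal.ofReal y * aroundK x y u n +
        ENNReal.ofReal y * (winF x y u 0 n * winT x y u n ⊤) +
        ENNReal.ofReal u * (ENNReal.ofReal (1 / ((n : ℝ) - u)) *
          (winG x y 0 n * winG x y n ⊤))) =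
      ENNReal.ofReal y * aroundV x y u n + ENNReal.ofReal u *
        (ENNReal.ofReal y * (winK' x y u 0 n * winG x y n ⊤) +
        ENNReal.ofReal (1 / ((n : ℝ) - u)) * (winG x y 0 n * winG x y n ⊤) +
        ENNReal.ofReal y * (winG x y 0 n * winK' x y u n ⊤)) := by
  have h1 := winV_add_winK' (x := x) (y := y) (u := u) 0 n
  have h2 := winV_add_winK' (x := x) (y := y) (u := u) n ⊤
  rw [aroundK, aroundV]
  calc _ = ENNReal.ofReal y *
        ((winK x y u 0 n + ENNReal.ofReal u * winV' x y u 0 n) * winG x y n ⊤ +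
        winG x y 0 n * (winK x y u n ⊤ + ENNReal.ofReal u * winV' x y u n ⊤) +
        winF x y u 0 n * winT x y u n ⊤) + ENNReal.ofReal u *
        (ENNReal.ofReal (1 / ((n : ℝ) - u)) * (winG x y 0 n * winG x y n ⊤)) := by ring
    _ = _ := by rw [← h1, ← h2]; ring

/-- The bound of `RecData.tailTerm_le` does not depend on `n`, so the tails are dominated by one
convergent series. -/
theorem Small.winG_mul_pairX_le (h : Small x y u) : ∃ C : ℝ≥0∞, C < ⊤ ∧
    ∀ n : ℕ, winG x y 0 n * pairX x y u n ≤ C := by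
  refine ⟨winG x y 0 ⊤ * ENNReal.ofReal (∑' d : ℕ,
    2 * realR x y 0 * (1 / (√((d : ℝ) + 1) * ((d : ℝ) + 1)))),
    ENNReal.mul_lt_top (h.winG_lt_top _ _) ENNReal.ofReal_lt_top, fun n => ?_⟩
  have hr := h.recData
  refine mul_le_mul' (winG_mono le_rfl le_top) ?_
  rw [h.pairX_eq]
  refine ENNReal.ofReal_le_ofReal ((hr.summable_X n).tsum_le_tsum (fun d => ?_)
    (RecData.summable_sqrt.mul_left _))
  have h2 : (0 : ℝ) < (d : ℝ) + 1 := by positivity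
  calc RecData.tailTerm x (realQ x u) (realR x y) n d / ((d : ℝ) + 1)
      ≤ (2 * realR x y 0 / √((d : ℝ) + 1)) / ((d : ℝ) + 1) :=
        div_le_div_of_nonneg_right (hr.tailTerm_le n d) h2.le
    _ = _ := by rw [div_div]; ring

theorem Small.insA_lt_top (h : Small x y u) {s : ℕ+} (hs : 2 ≤ s) :
    gen2 (ENNReal.ofReal y) (ENNReal.ofReal u) (insA x s) < ⊤ := by
  rw [insA_eq]
  exact (placeSum_le fun n _ => aroundK_le n).trans_lt (ENNReal.mul_lt_top h.winK_total_lt_top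
    (tsum_wt_lt_top h.x_nonneg h.x_le hs))

theorem Small.insB_lt_top (h : Small x y u) {s : ℕ+} (hs : 2 ≤ s) :
    gen2 (ENNReal.ofReal y) (ENNReal.ofReal u) (insB x s) < ⊤ := by
  rw [insB_eq]
  exact (placeSum_le fun n _ => h.aroundV_le n).trans_lt (ENNReal.mul_lt_top h.winK_total_lt_top
    (tsum_wt_lt_top h.x_nonneg h.x_le hs))

theorem Small.pairX_sum_lt_top (h : Small x y u) {s : ℕ+} (hs : 2 ≤ s) :
    placeSum (wt x (s + 1)) (fun n => n * (winG x y 0 n * pairX x y u n)) < ⊤ := by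
  obtain ⟨C, hC, hle⟩ := h.winG_mul_pairX_le
  rw [placeSum_natCast_mul]
  exact (placeSum_le fun n _ => hle n).trans_lt (ENNReal.mul_lt_top hC
    (tsum_wt_lt_top h.x_nonneg h.x_le hs))

theorem two_le_add_one {s : ℕ+} (hs : 2 ≤ s) : 2 ≤ s + 1 :=
  hs.trans (PNat.lt_add_right s 1).le

theorem lt_top_of_ofReal_mul {a : ℝ} (ha : 0 < a) {b : ℝ≥0∞} (h : ENNReal.ofReal a * b < ⊤) :
    b < ⊤ := by
  by_contra hb
  rw [not_lt_top_iff.1 hb, ENNReal.mul_top (by simpa using ha)] at h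
  exact lt_irrefl _ h

/-- The relations `E3` (local identity), `E1` (`place_relation`) and `E2` (`twoPlaces_add`) are
added after summation with the weight of the letter `s + 1`. A factor `n` lowers that letter to `s`,
which is how `insA` and `insB` appear. -/
theorem Small.pairs_total (h : Small x y u) {s : ℕ+} (hs : 2 ≤ s) :
    ENNReal.ofReal u * gen2 (ENNReal.ofReal y) (ENNReal.ofReal u) (insB x s) +
      ENNReal.ofReal x * gen2 (ENNReal.ofReal y) (ENNReal.ofReal u) (insA x s) +
      ENNReal.ofReal u * gen2 (ENNReal.ofReal y) (ENNReal.ofReal u) (raiD x s) =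
    ENNReal.ofReal u * gen2 (ENNReal.ofReal y) (ENNReal.ofReal u) (insA x s) +
      ENNReal.ofReal x * gen2 (ENNReal.ofReal y) (ENNReal.ofReal u) (insB x s) +
      ENNReal.ofReal u * gen2 (ENNReal.ofReal y) (ENNReal.ofReal u) (raiC x s) := by
  set σ := wt x (s + 1) with hσ
  have E3 : placeSum σ _ = placeSum σ _ := placeSum_congr fun n hn => h.local_identity hn
  have E1 : placeSum σ _ = placeSum σ _ := placeSum_congr fun n _ =>
    place_relation (x := x) (y := y) (u := u) n
  have E2 := twoPlaces_add (y := y) (u := u) h.x_le s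
  change twoPlaces x y u s + placeSum σ _ = placeSum σ _ at E2
  rw [h.raiD_eq, h.raiC_eq, insA_eq, insB_eq, ← hσ]
  simp only [placeSum_add, placeSum_mul] at E1 E3 ⊢
  have e1 : placeSum σ (fun n => n * aroundV x y u n) = placeSum (wt x s) (aroundV x y u) :=
    placeSum_natCast_mul x s _
  have e2 : placeSum σ (fun n => n * aroundK x y u n) = placeSum (wt x s) (aroundK x y u) :=
    placeSum_natCast_mul x s _
  rw [e1, e2, ← E2] at E3
  have hfinP : placeSum σ (fun n => winG x y n ⊤ * pairY x y u n) < ⊤ := by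
    refine lt_of_le_of_lt ?_ (h.pairX_sum_lt_top hs)
    rw [← hσ, ← E2]
    exact le_add_self
  have hfinV : placeSum σ (fun n => aroundV x y u n) < ⊤ :=
    (placeSum_le fun n _ => h.aroundV_le n).trans_lt (ENNReal.mul_lt_top h.winK_total_lt_top
      (tsum_wt_lt_top h.x_nonneg h.x_le (two_le_add_one hs)))
  generalize placeSum σ (fun n => winG x y n ⊤ * pairY x y u n) = P at *
  generalize placeSum (wt x s) (aroundV x y u) = B at *
  generalize placeSum (wt x s) (aroundK x y u) = A at *
  have hc1 : ENNReal.ofReal y * placeSum σ (fun n => aroundV x y u n) +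
      ENNReal.ofReal u * P ≠ ⊤ := (ENNReal.add_lt_top.2
    ⟨ENNReal.mul_lt_top ENNReal.ofReal_lt_top hfinV,
      ENNReal.mul_lt_top ENNReal.ofReal_lt_top hfinP⟩).ne
  -- The sums of `aroundV` and of the `pairY` terms occur only as auxiliary quantities. They are
  -- finite, so they may be added to both sides and cancelled again.
  refine (ENNReal.add_right_inj hc1).1 ?_
  generalize placeSum σ (fun n => aroundV x y u n) = SV at *
  generalize placeSum σ (fun n => aroundK x y u n) = SK at *
  generalize placeSum σ (fun n => winF x y u 0 n * winT x y u n ⊤) = SF at *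
  generalize placeSum σ (fun n => ENNReal.ofReal (1 / ((n : ℝ) - u)) *
    (winG x y 0 n * winG x y n ⊤)) = SH at *
  generalize placeSum σ (fun n => winV' x y u 0 n * winG x y n ⊤) = V1 at *
  generalize placeSum σ (fun n => winG x y 0 n * winV' x y u n ⊤) = V2 at *
  generalize placeSum σ (fun n => winK' x y u 0 n * winG x y n ⊤) = K1 at *
  generalize placeSum σ (fun n => winG x y 0 n * winK' x y u n ⊤) = K2 at *
  generalize twoPlaces x y u s = D at *
  generalize ENNReal.ofReal y = Y at *
  generalize ENNReal.ofReal u = U at *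
  generalize ENNReal.ofReal x = X at *
  calc _ = (Y * SV + U * B + X * A + U * (D + P)) + U * (Y * V1 + Y * V2) := by ring
    _ = (U * (Y * V1 + Y * V2) + (Y * SK + Y * SF + U * SH)) + (U * A + X * B + U * P) := by
      rw [E3]; ring
    _ = _ := by rw [E1]; ring

theorem Small.raiC_lt_top (h : Small x y u) {s : ℕ+} (hs : 2 ≤ s) :
    gen2 (ENNReal.ofReal y) (ENNReal.ofReal u) (raiC x s) < ⊤ := by
  set W := winG x y 0 ⊤ * winG x y 0 ⊤ with hW
  have hfin : (ENNReal.ofReal y * winK x y u 0 ⊤ + ENNReal.ofReal u *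
      (ENNReal.ofReal (1 / (1 - u)) * W)) * ∑' n, wt x (s + 1) n < ⊤ :=
    ENNReal.mul_lt_top (ENNReal.add_lt_top.2
      ⟨ENNReal.mul_lt_top ENNReal.ofReal_lt_top h.winK_total_lt_top,
      ENNReal.mul_lt_top ENNReal.ofReal_lt_top (ENNReal.mul_lt_top ENNReal.ofReal_lt_top
        (ENNReal.mul_lt_top (h.winG_lt_top _ _) (h.winG_lt_top _ _)))⟩)
      (tsum_wt_lt_top h.x_nonneg h.x_le (two_le_add_one hs))
  refine lt_top_of_ofReal_mul h.u_pos (lt_of_le_of_lt ?_ hfin)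
  rw [h.raiC_eq, ← placeSum_mul]
  refine placeSum_le fun n hn => ?_
  have h1 : (1 : ℝ) ≤ n := by exact_mod_cast hn
  have h2 := h.u_lt_one
  calc _ = ENNReal.ofReal y * (winG x y 0 n * (ENNReal.ofReal u * winK' x y u n ⊤) +
        (ENNReal.ofReal u * winK' x y u 0 n) * winG x y n ⊤) + ENNReal.ofReal u *
        (ENNReal.ofReal (1 / ((n : ℝ) - u)) * (winG x y 0 n * winG x y n ⊤)) := by ring
    _ ≤ ENNReal.ofReal y * (winG x y 0 n * winK x y u n ⊤ + winK x y u 0 n * winG x y n ⊤) +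
        ENNReal.ofReal u * (ENNReal.ofReal (1 / (1 - u)) * W) := by
      rw [hW]
      gcongr
      · exact winK'_le _ _
      · exact winK'_le _ _
      · exact winG_mono le_rfl le_top
      · exact winG_mono (Nat.zero_le n) le_rfl
    _ ≤ _ := by
      gcongr
      exact aroundK_le n

/-- Finiteness comes for free from `Small.pairs_total`, whose other side is already known to be
finite. -/
theorem Small.raiD_lt_top (h : Small x y u) {s : ℕ+} (hs : 2 ≤ s) :
    gen2 (ENNReal.ofReal y) (ENNReal.ofReal u) (raiD x s) < ⊤ := by
  refine lt_top_of_ofReal_mul h.u_pos (lt_of_le_of_lt ?_ (?_ : ENNReal.ofReal u *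
    gen2 (ENNReal.ofReal y) (ENNReal.ofReal u) (insA x s) +
      ENNReal.ofReal x * gen2 (ENNReal.ofReal y) (ENNReal.ofReal u) (insB x s) +
      ENNReal.ofReal u * gen2 (ENNReal.ofReal y) (ENNReal.ofReal u) (raiC x s) < ⊤))
  · rw [← h.pairs_total hs]
    exact le_add_self
  · exact ENNReal.add_lt_top.2 ⟨ENNReal.add_lt_top.2
      ⟨ENNReal.mul_lt_top ENNReal.ofReal_lt_top (h.insA_lt_top hs),
        ENNReal.mul_lt_top ENNReal.ofReal_lt_top (h.insB_lt_top hs)⟩,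
      ENNReal.mul_lt_top ENNReal.ofReal_lt_top (h.raiC_lt_top hs)⟩

end Total

/-! ### Comparison of coefficients -/

theorem tsum_pow_zero_add (U : ℝ≥0∞) (p : ℕ → ℝ≥0∞) :
    ∑' n, U ^ n * p n = p 0 + U * ∑' n, U ^ n * p (n + 1) := by
  rw [tsum_eq_zero_add' ENNReal.summable, pow_zero, one_mul, ← ENNReal.tsum_mul_left]
  congr 1
  exact tsum_congr fun n => by ring

theorem ofReal_pos_ne_zero {u : ℝ} (hu : 0 < u) : ENNReal.ofReal u ≠ 0 := by simpa using hu

theorem coeff_lt_top {u : ℝ} (hu : 0 < u) {p : ℕ → ℝ≥0∞}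
    (h : ∑' n, ENNReal.ofReal u ^ n * p n < ⊤) (n : ℕ) : p n < ⊤ := by
  have h1 : ENNReal.ofReal u ^ n * p n < ⊤ :=
    (ENNReal.le_tsum (f := fun n => ENNReal.ofReal u ^ n * p n) n).trans_lt h
  rw [← ENNReal.ofReal_pow hu.le] at h1
  exact lt_top_of_ofReal_mul (pow_pos hu n) h1

/-- Let `u` tend to `0`: the terms of positive degree on the right are at most `u * C`, with `C`
computed at `u₀`. -/
theorem coeff_zero_le {u₀ : ℝ} (hu₀ : 0 < u₀) {p q : ℕ → ℝ≥0∞}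
    (hfin : ∑' n, ENNReal.ofReal u₀ ^ n * q n < ⊤)
    (h : ∀ u, 0 < u → u ≤ u₀ →
      ∑' n, ENNReal.ofReal u ^ n * p n = ∑' n, ENNReal.ofReal u ^ n * q n) : p 0 ≤ q 0 := by
  set C := ∑' n, ENNReal.ofReal u₀ ^ n * q (n + 1) with hC
  have hCfin : C < ⊤ := by
    rw [tsum_pow_zero_add] at hfin
    exact lt_top_of_ofReal_mul hu₀ (ENNReal.add_lt_top.1 hfin).2
  refine ENNReal.le_of_forall_pos_le_add fun ε hε _ => ?_
  have hε' : (0 : ℝ) < ε := hε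
  have hC0 : 0 ≤ C.toReal := ENNReal.toReal_nonneg
  -- This choice makes `u * C ≤ ε`; the `+ 1` avoids division by zero.
  set u := min u₀ (ε / (C.toReal + 1)) with hu
  have hu0 : 0 < u := lt_min hu₀ (by positivity)
  have hule : u ≤ u₀ := min_le_left _ _
  have h1 := h u hu0 hule
  rw [tsum_pow_zero_add _ p, tsum_pow_zero_add _ q] at h1
  calc p 0 ≤ q 0 + ENNReal.ofReal u * ∑' n, ENNReal.ofReal u ^ n * q (n + 1) := by
        rw [← h1]
        exact le_self_add
    _ ≤ q 0 + ENNReal.ofReal u * C := by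
        gcongr
        exact ENNReal.tsum_le_tsum fun n => by gcongr
    _ ≤ q 0 + ε := by
        gcongr
        rw [← ENNReal.ofReal_toReal hCfin.ne, ← ENNReal.ofReal_mul hu0.le,
          ← ENNReal.ofReal_coe_nnreal]
        refine ENNReal.ofReal_le_ofReal ?_
        have h2 : u ≤ ε / (C.toReal + 1) := min_le_right _ _
        rw [le_div_iff₀ (by positivity)] at h2
        nlinarith

/-- Identify the constant terms, cancel them, divide by `u` and repeat. Finiteness at `u₀` passes to
the shifted series. -/
theorem coeff_eq {u₀ : ℝ} (hu₀ : 0 < u₀) {p q : ℕ → ℝ≥0∞}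
    (hfin : ∑' n, ENNReal.ofReal u₀ ^ n * q n < ⊤)
    (h : ∀ u, 0 < u → u ≤ u₀ →
      ∑' n, ENNReal.ofReal u ^ n * p n = ∑' n, ENNReal.ofReal u ^ n * q n) (n : ℕ) :
    p n = q n := by
  have hfin' : ∑' n, ENNReal.ofReal u₀ ^ n * p n < ⊤ := by rwa [h u₀ hu₀ le_rfl]
  have h0 : p 0 = q 0 := le_antisymm (coeff_zero_le hu₀ hfin h)
    (coeff_zero_le hu₀ hfin' fun u h1 h2 => (h u h1 h2).symm)
  induction n generalizing p q with
  | zero => exact h0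
  | succ n ih =>
    have hq := coeff_lt_top hu₀ hfin 0
    have hfq : ∑' n, ENNReal.ofReal u₀ ^ n * q (n + 1) < ⊤ := by
      rw [tsum_pow_zero_add] at hfin
      exact lt_top_of_ofReal_mul hu₀ (ENNReal.add_lt_top.1 hfin).2
    have hfp : ∑' n, ENNReal.ofReal u₀ ^ n * p (n + 1) < ⊤ := by
      rw [tsum_pow_zero_add] at hfin'
      exact lt_top_of_ofReal_mul hu₀ (ENNReal.add_lt_top.1 hfin').2
    have h' : ∀ u, 0 < u → u ≤ u₀ → ∑' n, ENNReal.ofReal u ^ n * p (n + 1) =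
        ∑' n, ENNReal.ofReal u ^ n * q (n + 1) := fun u h1 h2 => by
      have h3 := h u h1 h2
      rw [tsum_pow_zero_add _ p, tsum_pow_zero_add _ q, h0, ENNReal.add_right_inj hq.ne,
        ENNReal.mul_right_inj (ofReal_pos_ne_zero h1) ENNReal.ofReal_ne_top] at h3
      exact h3
    exact ih (p := fun n => p (n + 1)) (q := fun n => q (n + 1)) hfq h' hfp
      (le_antisymm (coeff_zero_le hu₀ hfq h')
        (coeff_zero_le hu₀ hfp fun u h1 h2 => (h' u h1 h2).symm))

section Gen2

variable (Y U : ℝ≥0∞)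

/-- The family multiplied by the first variable. -/
def shiftFst (α : ℕ → ℕ → ℝ≥0∞) : ℕ → ℕ → ℝ≥0∞
  | 0, _ => 0
  | τ + 1, l => α τ l

theorem gen2_shiftFst (α : ℕ → ℕ → ℝ≥0∞) : gen2 Y U (shiftFst α) = U * gen2 Y U α := by
  rw [gen2, tsum_pow_zero_add]
  simp [shiftFst, gen2]

theorem gen2_add (α β : ℕ → ℕ → ℝ≥0∞) :
    gen2 Y U (fun τ l => α τ l + β τ l) = gen2 Y U α + gen2 Y U β := by
  simp only [gen2, mul_add, ENNReal.tsum_add]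

theorem gen2_mul (c : ℝ≥0∞) (α : ℕ → ℕ → ℝ≥0∞) :
    gen2 Y U (fun τ l => c * α τ l) = c * gen2 Y U α := by
  simp only [gen2, ← ENNReal.tsum_mul_left]
  exact tsum_congr fun τ => tsum_congr fun l => by ring

theorem gen2_coeff_lt_top {y u : ℝ} (hy : 0 < y) (hu : 0 < u) {α : ℕ → ℕ → ℝ≥0∞}
    (h : gen2 (ENNReal.ofReal y) (ENNReal.ofReal u) α < ⊤) (τ l : ℕ) : α τ l < ⊤ :=
  coeff_lt_top hy (coeff_lt_top hu h τ) l

theorem gen2_coeff_eq {y₀ u₀ : ℝ} (hy₀ : 0 < y₀) (hu₀ : 0 < u₀) {α β : ℕ → ℕ → ℝ≥0∞}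
    (hfin : ∀ y, 0 < y → y ≤ y₀ → gen2 (ENNReal.ofReal y) (ENNReal.ofReal u₀) β < ⊤)
    (h : ∀ y u, 0 < y → y ≤ y₀ → 0 < u → u ≤ u₀ →
      gen2 (ENNReal.ofReal y) (ENNReal.ofReal u) α =
        gen2 (ENNReal.ofReal y) (ENNReal.ofReal u) β) (τ l : ℕ) : α τ l = β τ l :=
  coeff_eq hy₀ (coeff_lt_top hu₀ (hfin y₀ hy₀ le_rfl) τ)
    (fun y hy hy' => coeff_eq hu₀ (hfin y hy hy') (fun u hu hu' => h y u hy hy' hu hu') τ) l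

end Gen2

section Coefficients

variable {x : ℝ} {s : ℕ+}

theorem exists_small (hx0 : 0 ≤ x) (hx : x ≤ 1 / 2) :
    ∃ y₀ : ℝ, 0 < y₀ ∧ ∀ y u, 0 < y → y ≤ y₀ → 0 < u → u ≤ 1 / 8 → Small x y u := by
  have hfin := tsum_wt_lt_top hx0 hx (c := 2) le_rfl
  set S := (∑' m, wt x 2 m).toReal with hS
  have hS0 : 0 ≤ S := ENNReal.toReal_nonneg
  -- For `y ≤ 1 / (S + 1)` one has `y * S < 1`, the condition under which the geometric bound
  -- converges.
  refine ⟨1 / (S + 1), by positivity, fun y u hy hy0 hu hu8 => ⟨hx0, hx, hy.le, hu, hu8, ?_⟩⟩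
  rw [← ENNReal.ofReal_toReal hfin.ne, ← hS, ← ENNReal.ofReal_mul hy.le, ENNReal.ofReal_lt_one]
  rw [le_div_iff₀ (by positivity)] at hy0
  linarith

theorem coeff_finite (hx0 : 0 ≤ x) (hx : x ≤ 1 / 2) (hs : 2 ≤ s) (τ l : ℕ) :
    insA x s τ l < ⊤ ∧ insB x s τ l < ⊤ ∧ raiC x s τ l < ⊤ ∧ raiD x s τ l < ⊤ := by
  obtain ⟨y₀, hy₀, h⟩ := exists_small hx0 hx
  have h1 := h y₀ (1 / 8) hy₀ le_rfl (by norm_num) le_rfl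
  have h2 : (0 : ℝ) < 1 / 8 := by norm_num
  exact ⟨gen2_coeff_lt_top hy₀ h2 (h1.insA_lt_top hs) τ l,
    gen2_coeff_lt_top hy₀ h2 (h1.insB_lt_top hs) τ l,
    gen2_coeff_lt_top hy₀ h2 (h1.raiC_lt_top hs) τ l,
    gen2_coeff_lt_top hy₀ h2 (h1.raiD_lt_top hs) τ l⟩

/-- In `Small.pairs_total` the factor `u` shifts the index `τ` by one, while the terms with the
factor `x` stay in place. Hence the coefficient at `τ + 1` involves `τ` and `τ + 1`. -/
theorem coeff_identity (hx0 : 0 ≤ x) (hx : x ≤ 1 / 2) (hs : 2 ≤ s) (τ l : ℕ) :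
    insB x s τ l + ENNReal.ofReal x * insA x s (τ + 1) l + raiD x s τ l =
      insA x s τ l + ENNReal.ofReal x * insB x s (τ + 1) l + raiC x s τ l := by
  obtain ⟨y₀, hy₀, h⟩ := exists_small hx0 hx
  have h2 : (0 : ℝ) < 1 / 8 := by norm_num
  have key := gen2_coeff_eq hy₀ h2
    (α := fun τ l => shiftFst (insB x s) τ l + ENNReal.ofReal x * insA x s τ l +
      shiftFst (raiD x s) τ l)
    (β := fun τ l => shiftFst (insA x s) τ l + ENNReal.ofReal x * insB x s τ l +
      shiftFst (raiC x s) τ l)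
    (fun y hy hy' => by
      have h1 := h y _ hy hy' h2 le_rfl
      rw [gen2_add, gen2_add, gen2_mul, gen2_shiftFst, gen2_shiftFst]
      exact ENNReal.add_lt_top.2 ⟨ENNReal.add_lt_top.2
        ⟨ENNReal.mul_lt_top ENNReal.ofReal_lt_top (h1.insA_lt_top hs),
        ENNReal.mul_lt_top ENNReal.ofReal_lt_top (h1.insB_lt_top hs)⟩,
        ENNReal.mul_lt_top ENNReal.ofReal_lt_top (h1.raiC_lt_top hs)⟩)
    (fun y u hy hy' hu hu' => by
      rw [gen2_add, gen2_add, gen2_mul, gen2_shiftFst, gen2_shiftFst, gen2_add, gen2_add,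
        gen2_mul, gen2_shiftFst, gen2_shiftFst]
      exact (h y u hy hy' hu hu').pairs_total hs) (τ + 1) l
  exact key

end Coefficients

/-! ### The harmonic product -/

section Harmonic

variable {x : ℝ}

/-- From `1 / (m - x) = 1 / m + x / (m * (m - x))`. -/
theorem wt_eq_add (x : ℝ) (hx0 : 0 ≤ x) (hx : x ≤ 1 / 2) (t : ℕ+) {m : ℕ} (hm : 1 ≤ m) :
    wt x t m = (m : ℝ≥0∞)⁻¹ ^ (t : ℕ) + ENNReal.ofReal x * wt x (t + 1) m := by
  have h1 := sub_pos_of_le_half hx hm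
  have h2 : (0 : ℝ) < m := by exact_mod_cast hm
  have h3 : ((t + 1 : ℕ+) : ℕ) - 1 = (t : ℕ) - 1 + 1 := by
    have := t.pos
    rw [PNat.add_coe, PNat.one_coe]
    omega
  have h4 : (t : ℕ) = (t : ℕ) - 1 + 1 := (Nat.sub_add_cancel t.pos).symm
  rw [wt_eq_ofReal x _ hm, wt_eq_ofReal x _ hm, inv_natCast_eq_ofReal hm,
    ← ENNReal.ofReal_pow (by positivity), ← ENNReal.ofReal_mul hx0,
    ← ENNReal.ofReal_add (by positivity) (by positivity), h3]
  nth_rewrite 2 [h4]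
  congr 1
  rw [pow_succ]
  field_simp
  ring

theorem insSum_wt_eq (hx0 : 0 ≤ x) (hx : x ≤ 1 / 2) (t : ℕ+) (k : Index) :
    insSum (zeta x) t k = insSum (fun w => win w 0 ⊤) (fun n => (n : ℝ≥0∞)⁻¹ ^ (t : ℕ))
      (k.map (wt x)) + ENNReal.ofReal x * insSum (zeta x) (t + 1) k := by
  have h := fun c => insSum_listMap (wt x) (fun w => win w 0 ⊤) c k
  have h1 : zeta x = fun k => win (k.map (wt x)) 0 ⊤ := rfl
  rw [h1, h, h, insSum_win, insSum_win, insSum_win, ← ENNReal.tsum_mul_left, ← ENNReal.tsum_add]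
  refine tsum_congr fun n => ?_
  split_ifs with hn
  · rw [wt_eq_add x hx0 hx t hn]
    ring
  · simp

/-- The harmonic product with `∑ n^{-t}` inserts the letter `n^{-t}`, which is not the letter `wt x
t`; `wt_eq_add` corrects for this at the cost of an insertion of `t + 1`. -/
theorem insSum_add_raiseSum (hx0 : 0 ≤ x) (hx : x ≤ 1 / 2) (t : ℕ+) (k : Index) :
    insSum (zeta x) t k + raiseSum (zeta x) (· + t) k =
      (∑' n : ℕ, if 0 < n then (n : ℝ≥0∞)⁻¹ ^ (t : ℕ) else 0) * zeta x k +
        ENNReal.ofReal x * insSum (zeta x) (t + 1) k := by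
  have h1 := raiseSum_listMap (wt x) (fun w => win w 0 ⊤) (· + t)
    (fun a n => (n : ℝ≥0∞)⁻¹ ^ (t : ℕ) * a n) (fun c => wt_add x c t) k
  have h2 : raiseSum (zeta x) (· + t) k = _ := h1
  rw [insSum_wt_eq hx0 hx, h2, zeta, tsum_mul_win]
  ring

/-- The product term in `insSum_add_raiseSum` is the same for an index and its dual. For `t = 1` it
may be infinite, so it is matched rather than cancelled. -/
theorem insSum_dualIndex_balance (hx0 : 0 ≤ x) (hx : x ≤ 1 / 2) (t : ℕ+) {k : Index}
    (hk : IsAdmissible k) :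
    insSum (zeta x) t k + raiseSum (zeta x) (· + t) k +
        ENNReal.ofReal x * insSum (zeta x) (t + 1) (dualIndex k) =
      insSum (zeta x) t (dualIndex k) + raiseSum (zeta x) (· + t) (dualIndex k) +
        ENNReal.ofReal x * insSum (zeta x) (t + 1) k := by
  rw [insSum_add_raiseSum hx0 hx, insSum_add_raiseSum hx0 hx,
    zeta_dualIndex hx0 (by linarith) hk]
  ring

theorem ins_balance (hx0 : 0 ≤ x) (hx : x ≤ 1 / 2) (σ τ l : ℕ) :
    insA x τ.succPNat (σ + 1) l + raiC x (σ + 1).succPNat τ l +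
        ENNReal.ofReal x * insB x (τ + 1).succPNat (σ + 1) l =
      insB x τ.succPNat (σ + 1) l + raiD x (σ + 1).succPNat τ l +
        ENNReal.ofReal x * insA x (τ + 1).succPNat (σ + 1) l := by
  simp only [insA, insB, raiC, raiD, Finset.mul_sum, ← Finset.sum_add_distrib]
  refine Finset.sum_congr rfl fun p _ => ?_
  have h1 : (τ + 1).succPNat = τ.succPNat + 1 := rfl
  have h2 : (σ + 1).succPNat + 1 = (σ + 1 + 1).succPNat := rfl
  rw [h1, h2, ← dualIndex_twoWord]
  exact insSum_dualIndex_balance hx0 hx _ (isAdmissible_twoWord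
    (by rw [← PNat.coe_le_coe, Nat.succPNat_coe]; change 2 ≤ _; omega) _ _)

/-- The four families of insertions, after elimination of the raisings. -/
theorem four_families (hx0 : 0 ≤ x) (hx : x ≤ 1 / 2) (σ τ l : ℕ) :
    (insA x (σ + 1).succPNat (τ + 1) l + insB x (τ + 1).succPNat (σ + 1) l) +
      ENNReal.ofReal x *
        (insB x (σ + 1).succPNat (τ + 2) l + insA x (τ + 2).succPNat (σ + 1) l) =
    (insB x (σ + 1).succPNat (τ + 1) l + insA x (τ + 1).succPNat (σ + 1) l) +
      ENNReal.ofReal x *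
        (insA x (σ + 1).succPNat (τ + 2) l + insB x (τ + 2).succPNat (σ + 1) l) := by
  have hs : 2 ≤ (σ + 1).succPNat := by
    rw [← PNat.coe_le_coe, Nat.succPNat_coe]
    change 2 ≤ _
    omega
  obtain ⟨-, -, hC, hD⟩ := coeff_finite hx0 hx hs (τ + 1) l
  have h1 := coeff_identity hx0 hx hs (τ + 1) l
  have h2 := ins_balance hx0 hx σ (τ + 1) l
  -- The raisings occur in both evaluations; being finite, they can be added to both sides and
  -- eliminated.
  refine (ENNReal.add_left_inj (ENNReal.add_lt_top.2 ⟨hC, hD⟩).ne).1 ?_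
  generalize raiC x (σ + 1).succPNat (τ + 1) l = C at *
  generalize raiD x (σ + 1).succPNat (τ + 1) l = D at *
  rw [add_assoc τ 1 1, one_add_one_eq_two] at h1 h2
  calc _ = (insA x (σ + 1).succPNat (τ + 1) l + ENNReal.ofReal x *
        insB x (σ + 1).succPNat (τ + 2) l + C) + (insB x (τ + 1).succPNat (σ + 1) l + D +
        ENNReal.ofReal x * insA x (τ + 2).succPNat (σ + 1) l) := by ring
    _ = _ := by
      rw [← h1, ← h2]
      ring

end Harmonic

/-! ### Expansion in powers of the variable -/

/-- The summand `m^{-c}` of a multiple zeta value. -/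
noncomputable def pw (c : ℕ+) (m : ℕ) : ℝ≥0∞ := (m : ℝ≥0∞)⁻¹ ^ (c : ℕ)

theorem tsum_fin_cons {β : Type*} {r : ℕ} (f : (Fin (r + 1) → β) → ℝ≥0∞) :
    ∑' e, f e = ∑' (a : β) (e : Fin r → β), f (Fin.cons a e) := by
  rw [← (Fin.consEquiv fun _ : Fin (r + 1) => β).tsum_eq, ENNReal.tsum_prod']
  rfl

theorem forall_lt_and_strictMono_cons {r n : ℕ} (a : ℕ+) (m : Fin r → ℕ+) :
    (StrictMono (Fin.cons a m : Fin (r + 1) → ℕ+) ∧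
      ∀ i, n < (Fin.cons a m : Fin (r + 1) → ℕ+) i) ↔
      n < a ∧ StrictMono m ∧ ∀ i, (a : ℕ) < m i := by
  constructor
  · rintro ⟨h1, h2⟩
    refine ⟨by simpa using h2 0, fun i j hij => ?_, fun i => ?_⟩
    · simpa using h1 (Fin.succ_lt_succ_iff.2 hij)
    · simpa using h1 (Fin.succ_pos i)
  · rintro ⟨h1, h2, h3⟩
    constructor
    · intro i j
      refine Fin.cases ?_ (fun i => ?_) i <;> refine Fin.cases ?_ (fun j => ?_) j
      · simp
      · intro _
        simpa using h3 j
      · intro h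
        exact absurd h (by simp)
      · intro h
        simpa using h2 (Fin.succ_lt_succ_iff.1 h)
    · intro i
      refine Fin.cases ?_ (fun i => ?_) i
      · simpa using h1
      · simpa using h1.trans (h3 i)

theorem win_pw_eq (k : Index) (n : ℕ) : win (k.map pw) n ⊤ =
    ∑' m : Fin k.length → ℕ+, {m : Fin k.length → ℕ+ | StrictMono m ∧ ∀ i, n < m i}.indicator
      (fun m => ∏ i, pw (k.get i) (m i)) m := by
  classical
  induction k generalizing n with
  | nil => simp [win, Set.indicator, Subsingleton.strictMono]
  | cons c k ih =>
    rw [List.map_cons, win]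
    simp only [ENat.natCast_lt_top, and_true]
    refine Eq.trans ?_ (tsum_fin_cons (r := k.length) _).symm
    have h1 : ∀ m : ℕ, (if n < m then pw c m * win (k.map pw) m ⊤ else 0) =
        if 0 < m then (if n < m then pw c m * win (k.map pw) m ⊤ else 0) else 0 := by
      intro m
      by_cases h : n < m
      · rw [if_pos h, if_pos (by omega)]
      · simp [h]
    rw [tsum_congr h1, tsum_gt_eq, ← tsum_pnat_eq_tsum_succ
      (f := fun m => if n < m then pw c m * win (k.map pw) m ⊤ else 0)]
    refine tsum_congr fun a => ?_
    rw [ih]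
    split_ifs with h
    · rw [← ENNReal.tsum_mul_left]
      refine tsum_congr fun m => ?_
      have h2 := forall_lt_and_strictMono_cons (n := n) a m
      by_cases h3 : StrictMono m ∧ ∀ i, (a : ℕ) < m i
      · rw [Set.indicator_of_mem (by exact h3),
          Set.indicator_of_mem (by exact h2.2 ⟨h, h3⟩)]
        exact (Fin.prod_univ_succ (n := k.length)
          (fun i => pw ((c :: k).get i) ((Fin.cons a m : Fin (k.length + 1) → ℕ+) i))).symm
      · rw [Set.indicator_of_notMem (by exact h3), mul_zero,
          Set.indicator_of_notMem (by exact fun h4 => h3 (h2.1 h4).2)]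
    · symm
      rw [ENNReal.tsum_eq_zero]
      intro m
      rw [Set.indicator_of_notMem]
      exact fun h4 => h ((forall_lt_and_strictMono_cons (n := n) a m).1 h4).1

/-- No admissibility is needed: if the series diverges, both sides take the default value `0`. -/
theorem toReal_win_pw (k : Index) : (win (k.map pw) 0 ⊤).toReal = mzv k := by
  have h1 : {m : Fin k.length → ℕ+ | StrictMono m ∧ ∀ i, 0 < (m i : ℕ)} =
      {m | StrictMono m} := by
    ext m
    simp
  have h2 : ∀ (c m : ℕ+), pw c m = ENNReal.ofReal (1 / (m : ℝ) ^ (c : ℕ)) := fun c m => by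
    rw [pw, inv_natCast_eq_ofReal m.pos, ← ENNReal.ofReal_pow (by positivity), one_div_pow]
  rw [win_pw_eq, h1, ← tsum_subtype {m : Fin k.length → ℕ+ | StrictMono m}
    (fun m => ∏ i, pw (k.get i) (m i)), ENNReal.tsum_toReal_eq, mzv]
  · refine tsum_congr fun m => ?_
    rw [ENNReal.toReal_prod, one_div, ← Finset.prod_inv_distrib]
    refine Finset.prod_congr rfl fun i _ => ?_
    rw [h2, ENNReal.toReal_ofReal (by positivity), one_div]
  · intro m
    refine ENNReal.prod_ne_top fun i _ => ?_
    rw [h2]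
    exact ENNReal.ofReal_ne_top

/-- The Ohno sum as a sum of truncated multiple sums. -/
noncomputable def ohnoSum (m : ℕ) (k : Index) : ℝ≥0∞ :=
  ∑ e ∈ Finset.Nat.antidiagonalTuple k.length m, win ((addSeq k e).map pw) 0 ⊤

theorem toReal_ohnoSum {m : ℕ} {k : Index} (h : ohnoSum m k < ⊤) :
    (ohnoSum m k).toReal = ohnoCoeff m k := by
  rw [ohnoSum, ENNReal.sum_lt_top] at h
  rw [ohnoSum, ENNReal.toReal_sum fun e he => (h e he).ne, ohnoCoeff]
  exact Finset.sum_congr rfl fun e _ => toReal_win_pw _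

/-- The sum of a positive integer and a natural number. -/
def addNat (c : ℕ+) (a : ℕ) : ℕ+ := ⟨(c : ℕ) + a, Nat.add_pos_left c.pos _⟩

theorem addSeq_cons (c : ℕ+) (k : Index) (a : ℕ) (e : Fin k.length → ℕ) :
    addSeq (c :: k) (Fin.cons a e : Fin (k.length + 1) → ℕ) =
      addNat c a :: addSeq k e := by
  rw [addSeq]
  exact List.ofFn_succ

/-- Geometric series in `x / m`: the weight of `c` collects all `c + j`. -/
theorem wt_eq_tsum {x : ℝ} (hx0 : 0 ≤ x) (hx : x < 1) (c : ℕ+) {m : ℕ} (hm : 1 ≤ m) :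
    wt x c m = ∑' j : ℕ, ENNReal.ofReal x ^ j * pw (addNat c j) m := by
  rw [wt, ← tsum_pow_mul_inv_pow hx0 hx hm, ← ENNReal.tsum_mul_left]
  refine tsum_congr fun j => ?_
  have h : (c : ℕ) + j = ((c : ℕ) - 1) + (j + 1) := by
    have := c.pos
    omega
  rw [pw, addNat, PNat.mk_coe, h, pow_add _ ((c : ℕ) - 1)]
  ring

theorem win_wt_eq {x : ℝ} (hx0 : 0 ≤ x) (hx : x < 1) (k : Index) (n : ℕ) :
    win (k.map (wt x)) n ⊤ = ∑' e : Fin k.length → ℕ,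
      ENNReal.ofReal x ^ (∑ i, e i) * win ((addSeq k e).map pw) n ⊤ := by
  induction k generalizing n with
  | nil =>
    have h0 : ∀ e, addSeq [] e = [] := fun _ => rfl
    simp [win, h0]
  | cons c k ih =>
    refine Eq.trans ?_ (tsum_fin_cons (r := k.length) _).symm
    have h1 : ∀ (a : ℕ) (e : Fin k.length → ℕ), ENNReal.ofReal x ^
        (∑ i : Fin (k.length + 1), (Fin.cons a e : Fin (k.length + 1) → ℕ) i) *
        win ((addSeq (c :: k) (Fin.cons a e : Fin (k.length + 1) → ℕ)).map pw) n ⊤ =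
        ∑' m : ℕ, if n < m then (ENNReal.ofReal x ^ a *
          pw (addNat c a) m) * (ENNReal.ofReal x ^ (∑ i, e i) *
            win ((addSeq k e).map pw) m ⊤) else 0 := by
      intro a e
      rw [Fin.sum_univ_succ, addSeq_cons, List.map_cons, win, ← ENNReal.tsum_mul_left]
      simp only [Fin.cons_zero, Fin.cons_succ, ENat.natCast_lt_top, and_true]
      refine tsum_congr fun m => ?_
      split_ifs
      · ring
      · simp
    refine Eq.trans ?_ (tsum_congr fun a => tsum_congr fun e => (h1 a e).symm)
    rw [List.map_cons, win]
    simp only [ENat.natCast_lt_top, and_true, tsum_window_comm, ENNReal.tsum_mul_left,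
      ENNReal.tsum_mul_right]
    refine tsum_congr fun m => ?_
    split_ifs with h
    · rw [wt_eq_tsum hx0 hx c (by omega), ih]
    · rfl

/-- Expanding every letter by `wt_eq_tsum` and grouping the exponents by their sum produces the Ohno
sums as coefficients. This links the analytic function of `x` to the series in the theorem. -/
theorem zeta_eq_tsum {x : ℝ} (hx0 : 0 ≤ x) (hx : x < 1) (k : Index) :
    zeta x k = ∑' m : ℕ, ENNReal.ofReal x ^ m * ohnoSum m k := by
  rw [zeta, win_wt_eq hx0 hx,
    ← (Finset.Nat.sigmaAntidiagonalTupleEquivTuple k.length).tsum_eq, ENNReal.tsum_sigma']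
  refine tsum_congr fun m => ?_
  rw [tsum_fintype, ohnoSum, Finset.mul_sum]
  refine Eq.trans (Finset.sum_congr rfl fun e _ => ?_)
    (Finset.sum_coe_sort (Finset.Nat.antidiagonalTuple k.length m)
      fun e => ENNReal.ofReal x ^ m * win ((addSeq k e).map pw) 0 ⊤)
  change ENNReal.ofReal x ^ (∑ i, e.1 i) * _ = _
  rw [Finset.Nat.mem_antidiagonalTuple.1 e.2]
  rfl

/-! ### Coefficients of the insertions -/

theorem insSum_tsum {α : Type*} (C : ℕ → ℝ≥0∞) (S : ℕ → List α → ℝ≥0∞) (h : α) (k : List α) :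
    insSum (fun w => ∑' m, C m * S m w) h k = ∑' m, C m * insSum (S m) h k := by
  induction k generalizing S with
  | nil => rfl
  | cons a k ih =>
    simp only [insSum, mul_add, ENNReal.tsum_add]
    rw [ih fun m w => S m (a :: w)]

theorem toReal_insSum {α : Type*} {φ : List α → ℝ≥0∞} {ψ : List α → ℝ}
    (H : ∀ w, φ w < ⊤ → (φ w).toReal = ψ w) {h : α} {k : List α} (hk : insSum φ h k < ⊤) :
    (insSum φ h k).toReal = insSum ψ h k := by
  induction k generalizing φ ψ with
  | nil => exact H _ hk
  | cons a k ih =>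
    rw [insSum, ENNReal.add_lt_top] at hk
    rw [insSum, ENNReal.toReal_add hk.1.ne hk.2.ne, H _ hk.1, ih (fun w => H (a :: w)) hk.2, insSum]

/-- The coefficients of `insA`. -/
noncomputable def coeffA (m : ℕ) (s : ℕ+) (τ l : ℕ) : ℝ≥0∞ :=
  ∑ p ∈ Finset.HasAntidiagonal.antidiagonal l,
    insSum (ohnoSum m) s (twoWord (τ + 1).succPNat p.1 p.2)

/-- The coefficients of `insB`. -/
noncomputable def coeffB (m : ℕ) (s : ℕ+) (τ l : ℕ) : ℝ≥0∞ :=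
  ∑ p ∈ Finset.HasAntidiagonal.antidiagonal l, insSum (ohnoSum m) s (twoWordDual τ p.1 p.2)

theorem sum_insSum_eq_tsum {x : ℝ} (hx0 : 0 ≤ x) (hx : x < 1) (s : ℕ+) {ι : Type*} (S : Finset ι)
    (w : ι → Index) : ∑ p ∈ S, insSum (zeta x) s (w p) =
      ∑' m : ℕ, ENNReal.ofReal x ^ m * ∑ p ∈ S, insSum (ohnoSum m) s (w p) := by
  have h1 : zeta x = fun k => ∑' m : ℕ, ENNReal.ofReal x ^ m * ohnoSum m k :=
    funext fun k => zeta_eq_tsum hx0 hx k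
  simp only [h1, insSum_tsum, Finset.mul_sum]
  rw [Summable.tsum_finsetSum fun _ _ => ENNReal.summable]

theorem insA_eq_tsum {x : ℝ} (hx0 : 0 ≤ x) (hx : x < 1) (s : ℕ+) (τ l : ℕ) :
    insA x s τ l = ∑' m : ℕ, ENNReal.ofReal x ^ m * coeffA m s τ l :=
  sum_insSum_eq_tsum hx0 hx s _ _

theorem insB_eq_tsum {x : ℝ} (hx0 : 0 ≤ x) (hx : x < 1) (s : ℕ+) (τ l : ℕ) :
    insB x s τ l = ∑' m : ℕ, ENNReal.ofReal x ^ m * coeffB m s τ l :=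
  sum_insSum_eq_tsum hx0 hx s _ _

theorem two_le_succPNat (n : ℕ) : 2 ≤ (n + 1).succPNat := by
  rw [← PNat.coe_le_coe, Nat.succPNat_coe]
  change 2 ≤ _
  omega

/-- The value `1 / 2` is a convenient positive point at which the whole series is known to be
finite. -/
theorem coeffA_lt_top (m : ℕ) {s : ℕ+} (hs : 2 ≤ s) (τ l : ℕ) : coeffA m s τ l < ⊤ := by
  have h := (coeff_finite (x := 1 / 2) (by norm_num) le_rfl hs τ l).1
  rw [insA_eq_tsum (by norm_num) (by norm_num)] at h
  exact coeff_lt_top (by norm_num) h m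

theorem coeffB_lt_top (m : ℕ) {s : ℕ+} (hs : 2 ≤ s) (τ l : ℕ) : coeffB m s τ l < ⊤ := by
  have h := (coeff_finite (x := 1 / 2) (by norm_num) le_rfl hs τ l).2.1
  rw [insB_eq_tsum (by norm_num) (by norm_num)] at h
  exact coeff_lt_top (by norm_num) h m

/-- Multiplication of a power series by its variable. -/
def shift (p : ℕ → ℝ≥0∞) : ℕ → ℝ≥0∞
  | 0 => 0
  | n + 1 => p n

theorem tsum_pow_shift (U : ℝ≥0∞) (p : ℕ → ℝ≥0∞) :
    ∑' n, U ^ n * shift p n = U * ∑' n, U ^ n * p n := by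
  rw [tsum_pow_zero_add]
  simp [shift]

theorem coeff_four_families (σ τ l m : ℕ) :
    (coeffA m (σ + 1).succPNat (τ + 1) l + coeffB m (τ + 1).succPNat (σ + 1) l) +
      shift (fun m => coeffB m (σ + 1).succPNat (τ + 2) l +
        coeffA m (τ + 2).succPNat (σ + 1) l) m =
    (coeffB m (σ + 1).succPNat (τ + 1) l + coeffA m (τ + 1).succPNat (σ + 1) l) +
      shift (fun m => coeffA m (σ + 1).succPNat (τ + 2) l +
        coeffB m (τ + 2).succPNat (σ + 1) l) m := by
  refine coeff_eq (u₀ := 1 / 2) (p := fun m => (coeffA m (σ + 1).succPNat (τ + 1) l +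
      coeffB m (τ + 1).succPNat (σ + 1) l) +
      shift (fun m => coeffB m (σ + 1).succPNat (τ + 2) l +
        coeffA m (τ + 2).succPNat (σ + 1) l) m)
    (q := fun m => (coeffB m (σ + 1).succPNat (τ + 1) l + coeffA m (τ + 1).succPNat (σ + 1) l) +
      shift (fun m => coeffA m (σ + 1).succPNat (τ + 2) l +
        coeffB m (τ + 2).succPNat (σ + 1) l) m) (by norm_num) ?_ ?_ m
  · simp only [mul_add, ENNReal.tsum_add, tsum_pow_shift]
    rw [← insA_eq_tsum (by norm_num) (by norm_num), ← insA_eq_tsum (by norm_num) (by norm_num),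
      ← insB_eq_tsum (by norm_num) (by norm_num), ← insB_eq_tsum (by norm_num) (by norm_num)]
    have hf : ∀ σ τ : ℕ, _ := fun σ τ => coeff_finite (x := 1 / 2) (by norm_num) le_rfl
      (two_le_succPNat σ) τ l
    exact ENNReal.add_lt_top.2 ⟨ENNReal.add_lt_top.2 ⟨(hf _ _).2.1, (hf _ _).1⟩,
      ENNReal.add_lt_top.2 ⟨ENNReal.mul_lt_top ENNReal.ofReal_lt_top (hf _ _).1,
        ENNReal.mul_lt_top ENNReal.ofReal_lt_top (hf (τ + 1) _).2.1⟩⟩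
  · intro x hx0 hx
    simp only [mul_add, ENNReal.tsum_add, tsum_pow_shift]
    simp only [← insA_eq_tsum hx0.le (by linarith : x < 1),
      ← insB_eq_tsum hx0.le (by linarith : x < 1), ← mul_add]
    exact four_families hx0.le hx σ τ l

/-- By `coeff_four_families` the defect of symmetry at `(σ, τ)` is `x` times the defect at `(σ, τ +
1)`. Its coefficient of degree `m + 1` at `τ` is therefore that of degree `m` at `τ + 1`, which is
why `τ` must vary in the induction. -/
theorem coeff_symm (σ τ l m : ℕ) :
    coeffA m (σ + 1).succPNat (τ + 1) l + coeffB m (τ + 1).succPNat (σ + 1) l =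
      coeffB m (σ + 1).succPNat (τ + 1) l + coeffA m (τ + 1).succPNat (σ + 1) l := by
  induction m generalizing τ with
  | zero => simpa [shift] using coeff_four_families σ τ l 0
  | succ m ih =>
    have h := coeff_four_families σ τ l (m + 1)
    simp only [shift] at h
    have hi := ih (τ + 1)
    rw [add_assoc τ 1 1, one_add_one_eq_two] at hi
    rw [hi] at h
    exact (ENNReal.add_left_inj (ENNReal.add_lt_top.2 ⟨coeffB_lt_top m (two_le_succPNat σ) _ l,
      coeffA_lt_top m (two_le_succPNat (τ + 1)) _ l⟩).ne).1 h

/-! ### Formal sums of indices -/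

theorem shuffle_single (k l : Index) : shuffle (single k) (single l) = shuffleIndex k l := by
  simp [shuffle, single]

theorem shuffleFront_singleton (c : ℕ+) (k : Index) :
    shuffleFront [c] k = insSum single c k := by
  induction k with
  | nil => rw [shuffleFront, insSum]
  | cons a k ih =>
    rw [shuffleFront, shuffleFront, ih, insSum]
    congr 1
    · simp [consMap, single]
    · have h := insSum_map (consMap a).toAddMonoidHom single c k
      refine h.trans ?_
      congr 1
      funext w
      simp [consMap, single]

/-- Shuffling in a single component inserts it at every position; the reversal in the definition is
harmless because insertion commutes with reversal. -/
theorem shuffleIndex_singleton (c : ℕ+) (k : Index) :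
    shuffleIndex [c] k = insSum single c k := by
  rw [shuffleIndex, List.reverse_singleton, shuffleFront_singleton]
  have h := insSum_map revMap.toAddMonoidHom single c k.reverse
  refine h.trans ?_
  rw [← insSum_reverse single c k]
  congr 1
  funext w
  simp [revMap, single]

theorem ohno_insSum (c : ℕ+) (k : Index) : ohno (insSum single c k) = insSum ohnoSeries c k := by
  have h := insSum_map ohno.toAddMonoidHom single c k
  refine h.trans ?_
  congr 1
  funext w
  simp [ohno, single]

theorem coeff_insSum (m : ℕ) (c : ℕ+) (k : Index) :
    PowerSeries.coeff m (insSum ohnoSeries c k) = insSum (ohnoCoeff m) c k := by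
  have h := insSum_map (PowerSeries.coeff (R := ℝ) m).toAddMonoidHom ohnoSeries c k
  refine h.trans ?_
  congr 1
  funext w
  simp [ohnoSeries]

theorem shuffle_replicate (c : ℕ+) (l : ℕ) :
    shuffle (single [c]) (single (List.replicate l 2)) =
      ∑ p ∈ Finset.HasAntidiagonal.antidiagonal l, single (twoWord c p.1 p.2) := by
  rw [shuffle_single, shuffleIndex_singleton, insSum_replicate]
  rfl

theorem dual_single (k : Index) : dual (single k) = single (dualIndex k) := by
  simp [dual, single]

/-- The passage from the formal statement to the families in `ℝ≥0∞`. Since `2 ≤ s`, the total sums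
are finite, hence so is every summand, and `toReal` commutes with all the sums. -/
theorem coeff_F (m : ℕ) {s : ℕ+} (hs : 2 ≤ s) (τ l : ℕ) :
    PowerSeries.coeff m (F s (shuffle (single [(τ + 1).succPNat])
      (single (List.replicate l 2)))) = (coeffA m s τ l).toReal - (coeffB m s τ l).toReal := by
  have hA := coeffA_lt_top m hs τ l
  have hB := coeffB_lt_top m hs τ l
  rw [coeffA, ENNReal.sum_lt_top] at hA
  rw [coeffB, ENNReal.sum_lt_top] at hB
  rw [F, shuffle_replicate]
  simp only [map_sum, map_sub, dual_single, shuffle_single, shuffleIndex_singleton, ohno_insSum,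
    coeff_insSum, dualIndex_twoWord]
  rw [coeffA, coeffB, ENNReal.toReal_sum fun p hp => (hA p hp).ne,
    ENNReal.toReal_sum fun p hp => (hB p hp).ne]
  congr 1
  · exact Finset.sum_congr rfl fun p hp =>
      (toReal_insSum (fun w => toReal_ohnoSum) (hA p hp)).symm
  · exact Finset.sum_congr rfl fun p hp =>
      (toReal_insSum (fun w => toReal_ohnoSum) (hB p hp)).symm

end OhnoSum

theorem theorem1p3 (s t : ℕ+) (l : ℕ) (hs : 2 ≤ s) (ht : 2 ≤ t) :
    OhnoSum.F s (OhnoSum.shuffle (OhnoSum.single [t + 1])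
        (OhnoSum.single (List.replicate l 2))) =
      OhnoSum.F t (OhnoSum.shuffle (OhnoSum.single [s + 1])
        (OhnoSum.single (List.replicate l 2))) := by
  have key : ∀ c : ℕ+, 2 ≤ c → ∃ n : ℕ, c = (n + 1).succPNat := fun c hc => by
    refine ⟨(c : ℕ) - 2, PNat.eq ?_⟩
    have : 2 ≤ (c : ℕ) := by exact_mod_cast hc
    rw [Nat.succPNat_coe]
    omega
  -- With `s = σ + 2` and `t = τ + 2`, the component `t + 1` has parameter `τ + 1` and `s + 1` has
  -- parameter `σ + 1`, matching `coeff_symm`.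
  obtain ⟨σ, rfl⟩ := key s hs
  obtain ⟨τ, rfl⟩ := key t ht
  have h1 : ∀ n : ℕ, (n + 1).succPNat + 1 = (n + 1 + 1).succPNat := fun n => rfl
  ext m
  rw [h1, h1, OhnoSum.coeff_F m hs, OhnoSum.coeff_F m ht, sub_eq_sub_iff_add_eq_add]
  have h2 := congrArg ENNReal.toReal (OhnoSum.coeff_symm σ τ l m)
  have hA := fun a b => (OhnoSum.coeffA_lt_top m (OhnoSum.two_le_succPNat a) b l).ne
  have hB := fun a b => (OhnoSum.coeffB_lt_top m (OhnoSum.two_le_succPNat a) b l).ne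
  rw [ENNReal.toReal_add (hA _ _) (hB _ _), ENNReal.toReal_add (hB _ _) (hA _ _)] at h2
  linarith
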